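/- Let $\gamma\ge 1$ be an integer, let $\overline{M}_\gamma=\{(z,w)\in(\mathbb{C}\cup\{\infty\})^2 : w^{\gamma+1}=z(z^2-1)^\gamma\}$, regarded as a compact Riemann surface, and let $M=\overline{M}_\gamma\setminus\{(0,0),(\infty,\infty)\}$. For $c>0$ put \[ g=cw,\qquad \eta=i\,\frac{dz}{z^2w},\qquad \Phi=\bigl((1-g^2)\eta,\ i(1+g^2)\eta,\ 2g\eta\bigr). \] Put \[ A_\gamma=\frac{\gamma}{\gamma+2}\int_0^1\frac{dt}{\sqrt[\gamma+1]{t(1-t^2)^\gamma}},\qquad B_\gamma=2\int_0^1\sqrt[\gamma+1]{\frac{t}{1-t^2}}\,dt , \] where both integrals converge and both numbers are positive. Then there is a unique $c>0$ for which the period condition $\operatorname{Re}\oint_\ell\Phi=\mathbf 0$ holds for all loops $\ell$ in $M$. Equivalently, for every base point $q_0\in M$ there is a unique $c>0$ for which the map \[ f(q)=\operatorname{Re}\int_{q_0}^{q}\Phi\colon\ M\to\mathbb{R}^3 \] is well defined. In both cases this constant is \[ c=\sqrt{A_\gamma/B_\gamma}, \] and for this $c$ the map $f$ is a conformal minimal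 immersion. If $\gamma=1$, then $\overline{M}_\gamma$ has genus one and, for this $c$, the extended Gauss map $g\colon\overline{M}_\gamma\to\mathbb{C}\cup\{\infty\}$ has degree $\gamma+2=3$. -/

import Mathlib

open scoped Topology OnePoint

noncomputable section

namespace TwoEnds

/-- The inversion `x ↦ 1 / x`, as a map from `ℂ` to the Riemann sphere `ℂ ∪ {∞}`. -/
def sphereInv (x : ℂ) : OnePoint ℂ :=
  open Classical in if x = 0 then ∞ else ((x⁻¹ : ℂ) : OnePoint ℂ)

/-- `f` is holomorphic near `t` as a map into the Riemann sphere: in one of the two standard charts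
`x` and `1 / x` of the sphere it is given by a holomorphic function. -/
def SphereHolomorphicAt (f : ℂ → OnePoint ℂ) (t : ℂ) : Prop :=
  (∃ h : ℂ → ℂ, AnalyticAt ℂ h t ∧ ∀ᶠ s in 𝓝 t, f s = (h s : OnePoint ℂ)) ∨
  (∃ h : ℂ → ℂ, AnalyticAt ℂ h t ∧ ∀ᶠ s in 𝓝 t, f s = sphereInv (h s))

/-- The curve `w ^ (γ + 1) = z (z ^ 2 - 1) ^ γ` in `(ℂ ∪ {∞})²`. If one of `z`, `w` is `∞`, the
equation says that both are. -/
def compactCurve (γ : ℕ) : Set (OnePoint ℂ × OnePoint ℂ) :=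
  {q | (∃ z w : ℂ, q = ((z : OnePoint ℂ), (w : OnePoint ℂ)) ∧
      w ^ (γ + 1) = z * (z ^ 2 - 1) ^ γ) ∨ q = (∞, ∞)}

/-- The curve with the two points `(0, 0)` and `(∞, ∞)` removed. -/
def puncturedCurve (γ : ℕ) : Set (OnePoint ℂ × OnePoint ℂ) :=
  compactCurve γ \ {(((0 : ℂ) : OnePoint ℂ), ((0 : ℂ) : OnePoint ℂ)), (∞, ∞)}

/-- A holomorphic local parametrization (inverse of a holomorphic chart) of the compact Riemann
surface of the curve: an injective map of an open set of `ℂ` into the curve for which both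
coordinates `z`, `w` are holomorphic maps into the sphere. The curve has a single branch at each of
its points, so that the underlying set of the Riemann surface is the curve itself, and an injective
map of this kind is biholomorphic onto an open subset of the Riemann surface, also at the cusps
`(1, 0)`, `(-1, 0)`, `(0, 0)`, `(∞, ∞)`; conversely the inverse of any chart is such a map. -/
structure LocalParam (γ : ℕ) where
  /-- the domain -/
  U : Set ℂ
  /-- the parametrization (only its values on `U` matter) -/
  φ : ℂ → OnePoint ℂ × OnePoint ℂ
  isOpen : IsOpen U
  mapsTo : Set.MapsTo φ U (compactCurve γ)
  injOn : Set.InjOn φ U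
  holomorphic_z : ∀ t ∈ U, SphereHolomorphicAt (fun s => (φ s).1) t
  holomorphic_w : ∀ t ∈ U, SphereHolomorphicAt (fun s => (φ s).2) t

/-- The space of holomorphic differentials on the compact Riemann surface: a differential is given
in every local parametrization `P` by `a P t dt` with `a P` holomorphic on the domain, compatibly
with changes of parameter. (Outside the domain, `a P` is normalized to be `0`.) -/
def holomorphicForms (γ : ℕ) : Submodule ℂ (LocalParam γ → ℂ → ℂ) where
  carrier := {a | (∀ P, DifferentiableOn ℂ (a P) P.U) ∧ (∀ P, ∀ t ∉ P.U, a P t = 0) ∧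
    ∀ (P Q : LocalParam γ) (t : ℂ) (h : ℂ → ℂ), AnalyticAt ℂ h t → t ∈ P.U → h t ∈ Q.U →
      (∀ᶠ s in 𝓝 t, P.φ s = Q.φ (h s)) → a P t = a Q (h t) * deriv h t}
  add_mem' := by
    rintro a b ⟨ha, ha', ha''⟩ ⟨hb, hb', hb''⟩
    refine ⟨fun P => (ha P).add (hb P), fun P t ht => ?_, fun P Q t h h1 h2 h3 h4 => ?_⟩
    · simp [ha' P t ht, hb' P t ht]
    · simp [ha'' P Q t h h1 h2 h3 h4, hb'' P Q t h h1 h2 h3 h4, add_mul]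
  zero_mem' := by
    refine ⟨fun P => ?_, fun P t ht => rfl, fun P Q t h h1 h2 h3 h4 => ?_⟩
    · exact differentiableOn_const (c := (0 : ℂ))
    · simp
  smul_mem' := by
    rintro r a ⟨ha, ha', ha''⟩
    refine ⟨fun P => (ha P).const_smul r, fun P t ht => ?_, fun P Q t h h1 h2 h3 h4 => ?_⟩
    · simp [ha' P t ht]
    · simp [ha'' P Q t h h1 h2 h3 h4, mul_assoc]

/-- The genus of the compact Riemann surface: the dimension of its space of holomorphic
differentials. -/
def genus (γ : ℕ) : ℕ := Module.finrank ℂ (holomorphicForms γ)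

/-- The map `g` from the compact Riemann surface to the sphere has degree `d`: all but finitely many
values are taken at exactly `d` points. -/
def HasDegree (γ : ℕ) (g : OnePoint ℂ × OnePoint ℂ → OnePoint ℂ) (d : ℕ) : Prop :=
  ∃ S : Set (OnePoint ℂ), S.Finite ∧ ∀ v ∉ S, {q ∈ compactCurve γ | g q = v}.encard = d

/-- The finite value of a point of the sphere (junk value `0` at `∞`). -/
def finitePart (x : OnePoint ℂ) : ℂ := x.elim 0 id

/-- The coordinate `z` on the punctured curve. -/
def zCoord (q : OnePoint ℂ × OnePoint ℂ) : ℂ := finitePart q.1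

/-- The coordinate `w` on the punctured curve. -/
def wCoord (q : OnePoint ℂ × OnePoint ℂ) : ℂ := finitePart q.2

/-- On one side of the parameter `s` (the side on which the interval `I` lies), `p` is a `C¹` path
in the Riemann surface. -/
def IsC1At (γ : ℕ) (p : ℝ → OnePoint ℂ × OnePoint ℂ) (I : Set ℝ) (s : ℝ) : Prop :=
  ∃ (P : LocalParam γ) (τ : ℝ → ℂ), ContDiffWithinAt ℝ 1 τ I s ∧
    ∀ᶠ r in 𝓝[I] s, τ r ∈ P.U ∧ p r = P.φ (τ r)

/-- `p`, restricted to `[0, 1]`, is a piecewise `C¹` path in the punctured Riemann surface: at every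
parameter it is `C¹` on a one-sided neighbourhood to the left and on one to the right. -/
def IsPiecewiseC1Path (γ : ℕ) (p : ℝ → OnePoint ℂ × OnePoint ℂ) : Prop :=
  (∀ s ∈ Set.Icc (0 : ℝ) 1, p s ∈ puncturedCurve γ) ∧
  ∀ s ∈ Set.Icc (0 : ℝ) 1, IsC1At γ p (Set.Icc 0 s) s ∧ IsC1At γ p (Set.Icc s 1) s

/-- The Gauss map `g = c w`. -/
def gauss (c : ℝ) (q : OnePoint ℂ × OnePoint ℂ) : ℂ := c * wCoord q

/-- The coefficient of `dz` in `η = i dz / (z² w)`. -/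
def etaCoeff (q : OnePoint ℂ × OnePoint ℂ) : ℂ := Complex.I / (zCoord q ^ 2 * wCoord q)

/-- The coefficients of `dz` in `Φ = ((1 - g²) η, i (1 + g²) η, 2 g η)`. -/
def PhiCoeff (c : ℝ) (q : OnePoint ℂ × OnePoint ℂ) : Fin 3 → ℂ :=
  ![(1 - gauss c q ^ 2) * etaCoeff q, Complex.I * (1 + gauss c q ^ 2) * etaCoeff q,
    2 * gauss c q * etaCoeff q]

/-- `∫_p a dz = ∫₀¹ a(p(s)) (z ∘ p)'(s) ds`. For `a dz` one of the components of `Φ`, which are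
holomorphic on the punctured Riemann surface, the integrand is the pull-back of `a dz` by `p` except
possibly at break points of `p` and where `p` passes through the points `(1, 0)`, `(-1, 0)` (at which
`w = 0`) with non-zero velocity, altogether a countable set of parameters. -/
def pathIntegral (a : OnePoint ℂ × OnePoint ℂ → ℂ) (p : ℝ → OnePoint ℂ × OnePoint ℂ) : ℂ :=
  ∫ s in (0 : ℝ)..1, a (p s) * deriv (fun r => zCoord (p r)) s

/-- `Re ∫_p Φ ∈ ℝ³`. -/
def rePhiIntegral (c : ℝ) (p : ℝ → OnePoint ℂ × OnePoint ℂ) : EuclideanSpace ℝ (Fin 3) :=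
  WithLp.toLp 2 fun j => (pathIntegral (fun q => PhiCoeff c q j) p).re

/-- The period condition: `Re ∮_ℓ Φ = 0` for every loop `ℓ` in the punctured Riemann surface. -/
def PeriodCondition (γ : ℕ) (c : ℝ) : Prop :=
  ∀ p, IsPiecewiseC1Path γ p → p 0 = p 1 → rePhiIntegral c p = 0

/-- `f(q) = Re ∫_{q₀}^q Φ` for all `q`, along whatever path from `q₀` to `q`. -/
def IsWeierstrassMap (γ : ℕ) (c : ℝ) (q₀ : puncturedCurve γ)
    (f : puncturedCurve γ → EuclideanSpace ℝ (Fin 3)) : Prop :=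
  ∀ (q : puncturedCurve γ) (p : ℝ → OnePoint ℂ × OnePoint ℂ), IsPiecewiseC1Path γ p →
    p 0 = q₀ → p 1 = q → f q = rePhiIntegral c p

/-- The formula `f(q) = Re ∫_{q₀}^q Φ` well-defines a map on the punctured Riemann surface. -/
def WellDefined (γ : ℕ) (c : ℝ) (q₀ : puncturedCurve γ) : Prop :=
  ∃! f : puncturedCurve γ → EuclideanSpace ℝ (Fin 3), IsWeierstrassMap γ c q₀ f

/-- `f` is a conformal minimal immersion of the punctured Riemann surface: in local parametrizations
it is harmonic, and its differential is a non-zero multiple of a linear isometry. -/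
def IsConformalMinimalImmersion (γ : ℕ)
    (f : puncturedCurve γ → EuclideanSpace ℝ (Fin 3)) : Prop :=
  ∀ (P : LocalParam γ), ∀ t ∈ P.U, P.φ t ∈ puncturedCurve γ →
    InnerProductSpace.HarmonicAt (Function.extend Subtype.val f 0 ∘ P.φ) t ∧
    ConformalAt (Function.extend Subtype.val f 0 ∘ P.φ) t

/-- The Gauss map `g = c w`, extended to the compact Riemann surface with values in the sphere. -/
def gaussSphere (c : ℝ) (q : OnePoint ℂ × OnePoint ℂ) : OnePoint ℂ :=
  q.2.elim ∞ fun w => ((c * w : ℂ) : OnePoint ℂ)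

/-- The integrand `1 / (t (1 - t²)^γ)^(1/(γ+1))`. -/
def integrandA (γ : ℕ) (t : ℝ) : ℝ := 1 / (t * (1 - t ^ 2) ^ γ) ^ (1 / ((γ : ℝ) + 1))

/-- The integrand `(t / (1 - t²))^(1/(γ+1))`. -/
def integrandB (γ : ℕ) (t : ℝ) : ℝ := (t / (1 - t ^ 2)) ^ (1 / ((γ : ℝ) + 1))

/-- The constant `A_γ`. -/
def constA (γ : ℕ) : ℝ := (γ : ℝ) / ((γ : ℝ) + 2) * ∫ t in (0 : ℝ)..1, integrandA γ t

/-- The constant `B_γ`. -/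
def constB (γ : ℕ) : ℝ := 2 * ∫ t in (0 : ℝ)..1, integrandB γ t

end TwoEnds

end

noncomputable section

namespace TwoEnds

open Filter Set Complex MeasureTheory
open scoped ComplexConjugate

/-! Put α = dz/(z²w) and β = w dz/z². Then Φ = (i(α − c²β), −(α + c²β), 2ic dz/z²), and the third
component is exact. So Re ∮Φ = 0 means ∮α + c² conj(∮β) = 0: the multivalued harmonic function h =
∫α + c² conj(∫β) must have no periods.

Modulo exact forms, α is γ/(γ+2) · dz/w and β is 2w dz/(z² − 1); this is the origin of the factors
in A and B. The punctured curve is covered by two charts centred at (1, 0) and (−1, 0) (`sideMap`),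
whose domain is star-shaped, so α and β have primitives there. To compare them on the overlap Im z ≠
0, a third chart is used, centred at the puncture (0, 0) (`middleMap`): α and β have poles there,
but dz/w and w dz/(z² − 1) do not. Along 0 < z < 1 the primitives centred at (0, 0) and at (1, 0)
differ by a unimodular number times one of the two real integrals, up to sign (`middleA_sub_sideA`,
`middleB_sub_sideB`), and the symmetry (z, w) ↦ (−z, εw) treats the other side. The outcome
(`sideAlpha_add`): the primitive of α jumps by −(θ⁻¹ + θ'⁻¹)A and that of β by (θ + θ')B, with |θ| =
|θ'| = 1. As conj θ = θ⁻¹, the function h jumps by (θ⁻¹ + θ'⁻¹)(c²B − A), which is zero when c² =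
A/B (`sideHarmonic_eq`).

Conversely, going from (−1, 0) to (1, 0) through z = i on one sheet and back on another gives a loop
with ∮β ≠ 0 (`exists_loop`). The equation ∮α = −c² conj(∮β) then determines c² (`eq_of_loop`).

The immersion is conformal because αβ = (dz/z²)² makes Φ a null vector, and Φ has no zeros. For γ =
1 the form dz/w is holomorphic without zeros on the compact curve, so any holomorphic form is a
function times dz/w, and the maximum principle makes that function constant: the genus is one. The
degree counts the roots of z³ − z = w². -/

/-! ### Complex analysis preliminaries -/

/-- A holomorphic function on an open set which is star-shaped about `0` has a primitive. -/
theorem exists_primitive_of_starConvex {U : Set ℂ} {f : ℂ → ℂ} (hU : IsOpen U)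
    (hs : StarConvex ℝ 0 U) (hf : DifferentiableOn ℂ f U) :
    ∃ F : ℂ → ℂ, F 0 = 0 ∧ ∀ z ∈ U, HasDerivAt F (f z) z := by
  set ω : ℂ → ℂ →L[ℂ] ℂ := fun z => f z • (1 : ℂ →L[ℂ] ℂ) with hω
  have hd : ∀ z ∈ U, HasDerivAt ω (deriv f z • (1 : ℂ →L[ℂ] ℂ)) z := fun z hz =>
    HasDerivAt.smul_const (F := ℂ →L[ℂ] ℂ) ((hf.differentiableAt (hU.mem_nhds hz)).hasDerivAt) _
  set dω : ℂ → ℂ →L[ℝ] ℂ →L[ℂ] ℂ := fun z =>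
    (ContinuousLinearMap.toSpanSingleton ℂ (deriv f z • (1 : ℂ →L[ℂ] ℂ))).restrictScalars ℝ
  have hfd : ∀ z ∈ U, HasFDerivAt ω (dω z) z := fun z hz =>
    (hd z hz).hasFDerivAt.restrictScalars ℝ
  -- The derivative of f dz is complex bilinear on a one-dimensional space, hence symmetric: the
  -- form is closed, and its integral around a triangle vanishes.
  have hsymm : ∀ z x y, dω z x y = dω z y x := fun z x y => by
    simp only [dω, ContinuousLinearMap.coe_restrictScalars',
      ContinuousLinearMap.toSpanSingleton_apply, _root_.smul_apply,
      one_apply_eq_self, smul_eq_mul]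
    ring
  refine ⟨fun b => curveIntegral ω (.segment 0 b), by simp, fun a ha => ?_⟩
  obtain ⟨r, hr, hball⟩ := Metric.isOpen_iff.1 hU a ha
  have hadd : ∀ b ∈ Metric.ball a r, curveIntegral ω (.segment 0 b) =
      curveIntegral ω (.segment 0 a) + curveIntegral ω (.segment a b) := by
    intro b hb
    have hsub : convexHull ℝ {0, a, b} ⊆ U := by
      rw [convexHull_insert ⟨a, by simp⟩, convexHull_pair]
      intro x hx
      obtain ⟨p, hp, y, hy, hx⟩ := mem_convexJoin.1 hx
      rw [mem_singleton_iff.1 hp] at hx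
      exact (starConvex_iff_segment_subset.1 hs
        (hball ((convex_ball a r).segment_subset (Metric.mem_ball_self hr) hb hy))) hx
    have hmem : ∀ x ∈ ({0, a, b} : Set ℂ), x ∈ convexHull ℝ {0, a, b} :=
      fun x hx => subset_convexHull ℝ _ hx
    exact ((convex_convexHull ℝ {0, a, b}).curveIntegral_segment_add_eq_of_hasFDerivWithinAt_symmetric
      (fun x hx => (hfd x (hsub hx)).hasFDerivWithinAt) (fun x _ u _ v _ => hsymm x u v)
      (hmem 0 (by simp)) (hmem a (by simp)) (hmem b (by simp))).symm
  have h1 : HasFDerivAt (fun b => curveIntegral ω (.segment a b)) (ω a) a := by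
    refine HasFDerivAt.curveIntegral_segment_source' ?_
    filter_upwards [hU.mem_nhds ha] with z hz using (hd z hz).continuousAt
  have h2 : HasDerivAt (fun b => curveIntegral ω (.segment 0 a) + curveIntegral ω (.segment a b))
      (f a) a := by
    have := h1.hasDerivAt.const_add (curveIntegral ω (.segment 0 a))
    simpa [hω] using this
  refine h2.congr_of_eventuallyEq ?_
  filter_upwards [Metric.ball_mem_nhds a hr] with b hb using hadd b hb

/-- An injective holomorphic function has non-vanishing derivative. -/
theorem deriv_ne_zero_of_injOn {f : ℂ → ℂ} {a : ℂ} {V : Set ℂ} (hf : AnalyticAt ℂ f a)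
    (hV : V ∈ 𝓝 a) (hinj : InjOn f V) : deriv f a ≠ 0 := by
  intro h0
  have hf' : AnalyticAt ℂ (fun z => f z - f a) a := hf.sub analyticAt_const
  have hord := hf.analyticOrderAt_deriv_add_one
  have hnetop : analyticOrderAt (fun z => f z - f a) a ≠ ⊤ := by
    intro htop
    have h := (analyticOrderAt_eq_top.1 htop).and hV
    obtain ⟨z, hz, hza⟩ := ((h.filter_mono nhdsWithin_le_nhds).and
      (self_mem_nhdsWithin (s := {a}ᶜ))).exists
    exact hza (hinj hz.2 (mem_of_mem_nhds hV) (sub_eq_zero.1 hz.1))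
  obtain ⟨m, hm⟩ := ENat.ne_top_iff_exists.1 hnetop
  have hd1 : (1 : ℕ∞) ≤ analyticOrderAt (deriv f) a :=
    Order.one_le_iff_ne_zero.2 (by
      rw [ne_eq, hf.deriv.analyticOrderAt_eq_zero]
      simpa using h0)
  have hm2 : 2 ≤ m := by
    have : (2 : ℕ∞) ≤ m := by
      rw [hm, ← hord]
      calc (2 : ℕ∞) = 1 + 1 := by norm_num
        _ ≤ _ := by gcongr
    exact_mod_cast this
  obtain ⟨g, hg, hga, hfg⟩ := (hf'.analyticOrderAt_eq_natCast).1 hm.symm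
  -- an `m`-th root of `f - f a`
  set k : ℂ → ℂ := fun z => (z - a) * (g a ^ ((m : ℂ)⁻¹) * (g z / g a) ^ ((m : ℂ)⁻¹)) with hk
  have hm0 : m ≠ 0 := by omega
  -- Dividing by `g a` moves the base of the power to 1, away from the cut of `cpow`.
  have hga1 : g a / g a ∈ Complex.slitPlane := by rw [div_self hga]; exact Complex.one_mem_slitPlane
  have hkan : AnalyticAt ℂ k a := by
    refine (analyticAt_id.sub analyticAt_const).mul (analyticAt_const.mul ?_)
    exact (hg.div analyticAt_const hga).cpow analyticAt_const hga1
  have hkpow : ∀ᶠ z in 𝓝 a, k z ^ m = f z - f a := by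
    filter_upwards [hfg] with z hz
    rw [hz, hk]
    simp only [mul_pow, Complex.cpow_nat_inv_pow _ hm0, smul_eq_mul]
    field_simp
  have hka : k a = 0 := by simp [hk]
  have hopen : 𝓝 (k a) ≤ map k (𝓝 a) := by
    refine (hkan.eventually_constant_or_nhds_le_map_nhds).resolve_left fun hc => ?_
    have h := (hc.and hkpow).and hV
    obtain ⟨z, hz, hza⟩ := ((h.filter_mono nhdsWithin_le_nhds).and
      (self_mem_nhdsWithin (s := {a}ᶜ))).exists
    refine hza (hinj hz.2 (mem_of_mem_nhds hV) (sub_eq_zero.1 ?_))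
    rw [← hz.1.2, hz.1.1, hka, zero_pow hm0]
  -- The root `k` is an open map at `a`, so near 0 both y and ξy are values of it; their m-th powers
  -- agree, which contradicts injectivity of `f` since m ≥ 2.
  obtain ⟨ξ, hξ⟩ := Complex.isPrimitiveRoot_exp m hm0 |>.pow_eq_one |> fun h => (⟨_, rfl⟩ :
    ∃ ξ, ξ = Complex.exp (2 * Real.pi * Complex.I / m))
  have hprim : IsPrimitiveRoot ξ m := hξ ▸ Complex.isPrimitiveRoot_exp m hm0
  have himg : k '' (V ∩ {z | k z ^ m = f z - f a}) ∈ 𝓝 (0 : ℂ) := by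
    rw [← hka]
    exact hopen (image_mem_map (inter_mem hV hkpow))
  have himg2 : ∀ᶠ y in 𝓝 (0 : ℂ), ξ * y ∈ k '' (V ∩ {z | k z ^ m = f z - f a}) := by
    have : Tendsto (fun y : ℂ => ξ * y) (𝓝 0) (𝓝 0) := by
      simpa using (tendsto_id (α := ℂ) (x := 𝓝 0)).const_mul ξ
    exact this himg
  obtain ⟨y, ⟨hy1, hy2⟩, hy0⟩ := (((Filter.Eventually.and himg himg2).filter_mono
    (nhdsWithin_le_nhds (s := {0}ᶜ))).and self_mem_nhdsWithin).exists
  obtain ⟨z1, ⟨hz1V, hz1⟩, hz1y⟩ := hy1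
  obtain ⟨z2, ⟨hz2V, hz2⟩, hz2y⟩ := hy2
  have heq : f z1 = f z2 := by
    have : k z1 ^ m = k z2 ^ m := by rw [hz1y, hz2y, mul_pow, hprim.pow_eq_one, one_mul]
    have h1 : k z1 ^ m = f z1 - f a := hz1
    have h2 : k z2 ^ m = f z2 - f a := hz2
    rw [h1, h2] at this
    simpa using this
  have h12 := hinj hz1V hz2V heq
  rw [h12, hz2y] at hz1y
  have : ξ = 1 := by
    have := mul_right_cancel₀ hy0 (hz1y.trans (one_mul y).symm)
    exact this
  exact hprim.ne_one (by omega) this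

/-- Two functions with the same derivative on a preconnected open set differ by a constant. -/
theorem exists_eq_add_const {U : Set ℂ} {f g d : ℂ → ℂ} (hU : IsOpen U) (hc : IsPreconnected U)
    (hf : ∀ z ∈ U, HasDerivAt f (d z) z) (hg : ∀ z ∈ U, HasDerivAt g (d z) z) :
    ∃ c, ∀ z ∈ U, f z = g z + c := by
  obtain ⟨c, hc⟩ := hU.exists_is_const_of_fderiv_eq_zero (𝕜 := ℂ) (f := fun z => f z - g z) hc
    (fun z hz => ((hf z hz).sub (hg z hz)).differentiableAt.differentiableWithinAt)
    (fun z hz => by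
      have := ((hf z hz).sub (hg z hz))
      rw [sub_self] at this
      have h := this.hasFDerivAt.fderiv
      change fderiv ℂ (f - g) z = 0
      ext
      simpa using congrArg (fun L : ℂ →L[ℂ] ℂ => L 1) h)
  exact ⟨c, fun z hz => by rw [← hc z hz]; ring⟩

/-- The parameters at which a function vanishes with non-zero velocity are countable in number. -/
theorem countable_simple_zeros (u u' : ℝ → ℂ) (J : Set ℝ) (hu : ∀ r ∈ J, HasDerivAt u (u' r) r) :
    {r ∈ J | u r = 0 ∧ u' r ≠ 0}.Countable := by
  set S := {r ∈ J | u r = 0 ∧ u' r ≠ 0}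
  -- A zero with non-zero velocity is isolated, and a discrete subset of the line is countable.
  have hdisc : DiscreteTopology S := by
    rw [discreteTopology_subtype_iff]
    intro x hx
    rw [← disjoint_iff, Filter.disjoint_principal_right]
    filter_upwards [(hu x hx.1).eventually_ne (c := 0) hx.2.2] with z hz hzS
    exact hz hzS.2.1
  exact Set.countable_coe_iff.1 (countable_of_Lindelof_of_discrete (X := S))

/-! ### Branches of the roots -/

/-- The principal branch of the `(γ + 1)`-st root. -/
def root (γ : ℕ) (x : ℂ) : ℂ := x ^ (((γ + 1 : ℕ) : ℂ)⁻¹)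

section root
variable (γ : ℕ)

theorem natCast_succ_ne_zero : ((γ : ℂ) + 1) ≠ 0 := by exact_mod_cast Nat.succ_ne_zero γ

theorem root_pow (x : ℂ) : root γ x ^ (γ + 1) = x := cpow_nat_inv_pow x (Nat.succ_ne_zero γ)

theorem root_pow_mul (x : ℂ) : root γ x ^ γ * root γ x = x := by rw [← pow_succ, root_pow]

theorem root_zero : root γ 0 = 0 :=
  zero_cpow (inv_ne_zero (by exact_mod_cast Nat.succ_ne_zero γ))

variable {γ}

theorem root_ne_zero {x : ℂ} (hx : x ≠ 0) : root γ x ≠ 0 := fun h => hx (by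
  rw [← root_pow γ x, h, zero_pow (Nat.succ_ne_zero γ)])

theorem analyticAt_root {x : ℂ} (hx : x ∈ slitPlane) : AnalyticAt ℂ (root γ) x :=
  analyticAt_id.cpow analyticAt_const hx

theorem hasDerivAt_root {x : ℂ} (hx : x ∈ slitPlane) :
    HasDerivAt (root γ) (root γ x / (((γ : ℂ) + 1) * x)) x := by
  have h := (hasDerivAt_id x).cpow_const (c := ((γ + 1 : ℕ) : ℂ)⁻¹) hx
  refine h.congr_deriv ?_
  have hx0 : x ≠ 0 := slitPlane_ne_zero hx
  have := natCast_succ_ne_zero γ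
  simp only [id, root]
  rw [cpow_sub _ _ hx0, cpow_one]
  push_cast
  field_simp

theorem continuousAt_root_zero : ContinuousAt (root γ) 0 := by
  have h : ContinuousAt (fun p : ℂ × ℂ => p.1 ^ p.2) ((0 : ℂ), ((γ + 1 : ℕ) : ℂ)⁻¹) := by
    apply continuousAt_cpow_zero_of_re_pos
    rw [← ofReal_natCast, ← ofReal_inv, ofReal_re]
    positivity
  exact h.comp (f := fun x : ℂ => (x, ((γ + 1 : ℕ) : ℂ)⁻¹))
    (Continuous.prodMk continuous_id continuous_const).continuousAt

theorem root_ofReal {x : ℝ} (hx : 0 ≤ x) :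
    root γ (x : ℂ) = ((x ^ (1 / ((γ : ℝ) + 1)) : ℝ) : ℂ) := by
  rw [root, ofReal_cpow hx]
  congr 1
  push_cast
  rw [one_div]

end root

/-- A branch of `(z (1 + z) ^ γ) ^ (1 / (γ + 1))`. -/
def sideRoot (γ : ℕ) (z : ℂ) : ℂ := root γ z * root γ (1 + z) ^ γ

/-- The number `exp (π i / (γ + 1))`, a root of `-1`. -/
def eps (γ : ℕ) : ℂ := exp (Real.pi * I / ((γ : ℂ) + 1))

theorem eps_pow (γ : ℕ) : eps γ ^ (γ + 1) = -1 := by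
  rw [eps, ← exp_nat_mul, ← exp_pi_mul_I]
  congr 1
  have := natCast_succ_ne_zero γ
  push_cast
  field_simp

theorem eps_ne_zero (γ : ℕ) : eps γ ≠ 0 := exp_ne_zero _

/-- A branch of `((z ^ 2 - 1) ^ γ) ^ (1 / (γ + 1))`. -/
def middleRoot (γ : ℕ) (z : ℂ) : ℂ := eps γ ^ γ * (root γ (1 - z) ^ γ * root γ (1 + z) ^ γ)

theorem one_add_mem_slitPlane {z : ℂ} (hz : z ∈ slitPlane) : 1 + z ∈ slitPlane := by
  rw [mem_slitPlane_iff] at hz ⊢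
  simp only [add_re, one_re, add_im, one_im]
  rcases hz with h | h
  · left; linarith
  · right; simpa using h

section sideRoot
variable {γ : ℕ} {z : ℂ}

theorem sideRoot_pow (z : ℂ) : sideRoot γ z ^ (γ + 1) = z * (1 + z) ^ γ := by
  rw [sideRoot, mul_pow, root_pow, ← pow_mul, mul_comm γ, pow_mul, root_pow]

theorem sideRoot_ne_zero (hz : z ∈ slitPlane) : sideRoot γ z ≠ 0 :=
  mul_ne_zero (root_ne_zero (slitPlane_ne_zero hz))
    (pow_ne_zero _ (root_ne_zero (slitPlane_ne_zero (one_add_mem_slitPlane hz))))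

theorem hasDerivAt_sideRoot (hz : z ∈ slitPlane) :
    HasDerivAt (sideRoot γ)
      (sideRoot γ z / ((γ : ℂ) + 1) * (1 / z + γ / (1 + z))) z := by
  have h1 := hasDerivAt_root (γ := γ) hz
  have hz' := one_add_mem_slitPlane hz
  have h2 : HasDerivAt (fun z => root γ (1 + z))
      (root γ (1 + z) / (((γ : ℂ) + 1) * (1 + z))) z := by
    simpa [Function.comp_def] using
      (hasDerivAt_root (γ := γ) hz').comp z ((hasDerivAt_id z).const_add 1)
  have h3 := h1.mul (h2.pow γ)
  refine h3.congr_deriv ?_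
  have a1 := natCast_succ_ne_zero γ
  have a2 := slitPlane_ne_zero hz
  have a3 := slitPlane_ne_zero hz'
  simp only [sideRoot]
  -- The power rule produces the truncated exponent γ − 1, which forces the case split.
  rcases γ with _ | γ
  · simp; field_simp
  · simp only [Nat.add_sub_cancel, Pi.pow_apply, pow_succ]
    field_simp

theorem analyticAt_sideRoot (hz : z ∈ slitPlane) : AnalyticAt ℂ (sideRoot γ) z :=
  (analyticAt_root hz).mul (((analyticAt_root (one_add_mem_slitPlane hz)).comp
    (analyticAt_const.add analyticAt_id)).pow γ)

theorem middleRoot_pow (z : ℂ) : middleRoot γ z ^ (γ + 1) = (z ^ 2 - 1) ^ γ := by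
  have h : ∀ x : ℂ, (x ^ γ) ^ (γ + 1) = (x ^ (γ + 1)) ^ γ := fun x => by
    rw [← pow_mul, mul_comm, pow_mul]
  rw [middleRoot, mul_pow, mul_pow, h, h, h, root_pow, root_pow, eps_pow, ← mul_pow, ← mul_pow]
  congr 1
  ring

theorem middleRoot_ne_zero (h1 : 1 - z ≠ 0) (h2 : 1 + z ≠ 0) : middleRoot γ z ≠ 0 :=
  mul_ne_zero (pow_ne_zero _ (eps_ne_zero γ)) (mul_ne_zero (pow_ne_zero _ (root_ne_zero h1))
    (pow_ne_zero _ (root_ne_zero h2)))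

/-- Evenness is what makes (z, w) ↦ (−z, εw) act on the chart at (0, 0) as v ↦ εv. -/
theorem middleRoot_neg (z : ℂ) : middleRoot γ (-z) = middleRoot γ z := by
  rw [middleRoot, middleRoot, sub_neg_eq_add, ← sub_eq_add_neg, mul_comm (root γ (1 + z) ^ γ)]

theorem analyticAt_middleRoot (h1 : 1 - z ∈ slitPlane) (h2 : 1 + z ∈ slitPlane) :
    AnalyticAt ℂ (middleRoot γ) z :=
  analyticAt_const.mul ((((analyticAt_root h1).comp (analyticAt_const.sub analyticAt_id)).pow γ).mul
    (((analyticAt_root h2).comp (analyticAt_const.add analyticAt_id)).pow γ))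

end sideRoot

/-! ### The charts around (±1, 0) and (0, 0) -/

/-- The domain of the parametrizations of the curve around `(± 1, 0)`. -/
def sideDomain (γ : ℕ) : Set ℂ := {u | 1 + u ^ (γ + 1) ∈ slitPlane}

/-- For `s = ± 1` and `e ^ (γ + 1) = s`, a parametrization of the part of the curve where `s z` is
in the slit plane. -/
def sideMap (γ : ℕ) (s e u : ℂ) : OnePoint ℂ × OnePoint ℂ :=
  (((s * (1 + u ^ (γ + 1)) : ℂ) : OnePoint ℂ),
    ((e * (u ^ γ * sideRoot γ (1 + u ^ (γ + 1))) : ℂ) : OnePoint ℂ))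

/-- The domain of the parametrization of the curve around `(0, 0)`. -/
def middleDomain (γ : ℕ) : Set ℂ :=
  {v | 1 - v ^ (γ + 1) ∈ slitPlane ∧ 1 + v ^ (γ + 1) ∈ slitPlane}

/-- A parametrization of the part of the curve where `1 - z` and `1 + z` are in the slit plane. -/
def middleMap (γ : ℕ) (v : ℂ) : OnePoint ℂ × OnePoint ℂ :=
  (((v ^ (γ + 1) : ℂ) : OnePoint ℂ), ((v * middleRoot γ (v ^ (γ + 1)) : ℂ) : OnePoint ℂ))

section charts
variable {γ : ℕ} {s e : ℂ}

theorem isOpen_sideDomain : IsOpen (sideDomain γ) :=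
  isOpen_slitPlane.preimage (by fun_prop)

theorem isOpen_middleDomain : IsOpen (middleDomain γ) :=
  (isOpen_slitPlane.preimage (by fun_prop : Continuous fun v : ℂ => 1 - v ^ (γ + 1))).inter
    (isOpen_slitPlane.preimage (by fun_prop : Continuous fun v : ℂ => 1 + v ^ (γ + 1)))

/-- The slit plane is star-shaped about 1. Scaling the coordinate by r scales its (γ + 1)-st power
by r^(γ+1), so the chart domains are star-shaped about 0. -/
theorem one_add_smul_mem_slitPlane {x : ℂ} (hx : 1 + x ∈ slitPlane) {r : ℝ} (h0 : 0 ≤ r)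
    (h1 : r ≤ 1) : 1 + r * x ∈ slitPlane := by
  rw [mem_slitPlane_iff] at hx ⊢
  simp only [add_re, one_re, add_im, one_im, zero_add, mul_re, ofReal_re, ofReal_im, zero_mul,
    sub_zero, mul_im, add_zero] at hx ⊢
  rcases hx with h | h
  · left
    rcases le_total 0 x.re with hx | hx
    · nlinarith [mul_nonneg h0 hx]
    · nlinarith [mul_nonneg (sub_nonneg.2 h1) (neg_nonneg.2 hx)]
  · rcases h0.eq_or_lt with rfl | h0
    · left; simp
    · right; exact mul_ne_zero h0.ne' h

theorem starConvex_sideDomain : StarConvex ℝ 0 (sideDomain γ) := by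
  refine (starConvex_zero_iff).2 fun u hu r h0 h1 => ?_
  have := one_add_smul_mem_slitPlane hu (pow_nonneg h0 (γ + 1)) (pow_le_one₀ h0 h1)
  simpa [sideDomain, real_smul, mul_pow] using this

theorem starConvex_middleDomain : StarConvex ℝ 0 (middleDomain γ) := by
  refine (starConvex_zero_iff).2 fun u hu r h0 h1 => ?_
  have h2 := one_add_smul_mem_slitPlane hu.2 (pow_nonneg h0 (γ + 1)) (pow_le_one₀ h0 h1)
  have h3 := one_add_smul_mem_slitPlane (x := - u ^ (γ + 1)) (by simpa [sub_eq_add_neg] using hu.1)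
    (pow_nonneg h0 (γ + 1)) (pow_le_one₀ h0 h1)
  refine ⟨?_, ?_⟩
  · simpa [real_smul, mul_pow, sub_eq_add_neg] using h3
  · simpa [real_smul, mul_pow] using h2

theorem zero_mem_sideDomain : (0 : ℂ) ∈ sideDomain γ := by
  simp [sideDomain]

theorem zero_mem_middleDomain : (0 : ℂ) ∈ middleDomain γ := by
  simp [middleDomain]

theorem sphereHolomorphicAt_coe {f : ℂ → ℂ} {t : ℂ} (hf : AnalyticAt ℂ f t) :
    SphereHolomorphicAt (fun s => ((f s : ℂ) : OnePoint ℂ)) t :=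
  Or.inl ⟨f, hf, Eventually.of_forall fun _ => rfl⟩

theorem sideMap_mem (hs : s ^ 2 = 1) (he : e ^ (γ + 1) = s) (u : ℂ) :
    sideMap γ s e u ∈ compactCurve γ := by
  refine Or.inl ⟨_, _, rfl, ?_⟩
  rw [mul_pow, mul_pow, he, sideRoot_pow, ← pow_mul, mul_comm γ, pow_mul, mul_pow s, hs, one_mul]
  generalize u ^ (γ + 1) = x
  rw [show (1 + x) ^ 2 - 1 = x * (1 + (1 + x)) by ring, mul_pow]
  ring

/-- The coordinate z determines u^(γ+1), and then w determines u^γ; their quotient is u. -/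
theorem sideMap_injOn (hs : s ≠ 0) (he : e ≠ 0) : InjOn (sideMap γ s e) (sideDomain γ) := by
  intro u hu v hv h
  simp only [sideMap, Prod.mk.injEq, OnePoint.coe_eq_coe] at h
  obtain ⟨h1, h2⟩ := h
  have h1 : u ^ (γ + 1) = v ^ (γ + 1) := add_left_cancel (mul_left_cancel₀ hs h1)
  rw [h1] at h2
  have h3 := mul_right_cancel₀ (sideRoot_ne_zero hv) (mul_left_cancel₀ he h2)
  by_cases hv0 : v = 0
  · rw [hv0, zero_pow (Nat.succ_ne_zero γ)] at h1
    rw [hv0, eq_zero_of_pow_eq_zero h1]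
  · rw [pow_succ, pow_succ, h3] at h1
    exact mul_left_cancel₀ (pow_ne_zero _ hv0) h1

theorem analyticAt_sideRoot_comp {u : ℂ} (hu : u ∈ sideDomain γ) :
    AnalyticAt ℂ (fun u => sideRoot γ (1 + u ^ (γ + 1))) u :=
  AnalyticAt.fun_comp (analyticAt_sideRoot hu) (analyticAt_const.add (analyticAt_id.pow _))

theorem analyticAt_middleRoot_comp {v : ℂ} (hv : v ∈ middleDomain γ) :
    AnalyticAt ℂ (fun v => middleRoot γ (v ^ (γ + 1))) v :=
  AnalyticAt.fun_comp (analyticAt_middleRoot hv.1 hv.2) (analyticAt_id.pow _)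

/-- The parametrization `sideMap` as a local parametrization. -/
def sideParam (γ : ℕ) (s e : ℂ) (hs : s ^ 2 = 1) (he : e ^ (γ + 1) = s) : LocalParam γ where
  U := sideDomain γ
  φ := sideMap γ s e
  isOpen := isOpen_sideDomain
  mapsTo := fun u _ => sideMap_mem hs he u
  injOn := by
    have hs0 : s ≠ 0 := by rintro rfl; simp at hs
    refine sideMap_injOn hs0 ?_
    rintro rfl
    exact hs0 (by rw [← he, zero_pow (Nat.succ_ne_zero γ)])
  holomorphic_z := fun t _ => sphereHolomorphicAt_coe
    (analyticAt_const.mul (analyticAt_const.add (analyticAt_id.pow _)))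
  holomorphic_w := fun t ht => sphereHolomorphicAt_coe
    (analyticAt_const.mul ((analyticAt_id.pow _).mul (analyticAt_sideRoot_comp ht)))

/-- The parametrization `middleMap` as a local parametrization. -/
def middleParam (γ : ℕ) : LocalParam γ where
  U := middleDomain γ
  φ := middleMap γ
  isOpen := isOpen_middleDomain
  mapsTo := fun v _ => Or.inl ⟨_, _, rfl, by rw [mul_pow, middleRoot_pow]⟩
  injOn := by
    intro u hu v hv h
    simp only [middleMap, Prod.mk.injEq, OnePoint.coe_eq_coe] at h
    rw [h.1] at h
    exact mul_right_cancel₀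
      (middleRoot_ne_zero (slitPlane_ne_zero hv.1) (slitPlane_ne_zero hv.2)) h.2
  holomorphic_z := fun t _ => sphereHolomorphicAt_coe (analyticAt_id.pow _)
  holomorphic_w := fun t ht => sphereHolomorphicAt_coe
    (analyticAt_id.mul (analyticAt_middleRoot_comp ht))

end charts

/-! ### Local parametrizations factor through the charts -/

section factor
variable {γ : ℕ} {s e : ℂ}

theorem SphereHolomorphicAt.exists_finite {f : ℂ → OnePoint ℂ} {t z₀ : ℂ}
    (hf : SphereHolomorphicAt f t) (h0 : f t = (z₀ : OnePoint ℂ)) :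
    ∃ z : ℂ → ℂ, AnalyticAt ℂ z t ∧ ∀ᶠ r in 𝓝 t, f r = ((z r : ℂ) : OnePoint ℂ) := by
  rcases hf with hf | ⟨h, hh, hfh⟩
  · exact hf
  · have ht : h t ≠ 0 := by
      intro h00
      have := hfh.self_of_nhds
      rw [h0, sphereInv, if_pos h00] at this
      exact OnePoint.coe_ne_infty _ this
    refine ⟨fun r => (h r)⁻¹, hh.inv ht, ?_⟩
    filter_upwards [hfh, hh.continuousAt.eventually_ne ht] with r hr hr0
    rw [hr, sphereInv, if_neg hr0]

theorem SphereHolomorphicAt.exists_infty {f : ℂ → OnePoint ℂ} {t : ℂ}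
    (hf : SphereHolomorphicAt f t) (h0 : f t = ∞) :
    ∃ h : ℂ → ℂ, AnalyticAt ℂ h t ∧ h t = 0 ∧ ∀ᶠ r in 𝓝 t, f r = sphereInv (h r) := by
  rcases hf with ⟨h, hh, hfh⟩ | ⟨h, hh, hfh⟩
  · exact absurd (h0.symm.trans hfh.self_of_nhds).symm (OnePoint.coe_ne_infty _)
  · refine ⟨h, hh, ?_, hfh⟩
    by_contra hne
    have := hfh.self_of_nhds
    rw [h0, sphereInv, if_neg hne] at this
    exact OnePoint.coe_ne_infty _ this.symm

theorem mem_compactCurve_coe {z w : ℂ} :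
    ((z : OnePoint ℂ), (w : OnePoint ℂ)) ∈ compactCurve γ ↔
      w ^ (γ + 1) = z * (z ^ 2 - 1) ^ γ := by
  constructor
  · rintro (⟨z', w', h, h'⟩ | h)
    · simp only [Prod.mk.injEq, OnePoint.coe_eq_coe] at h
      rw [h.1, h.2, h']
    · exact absurd (congrArg Prod.fst h) (OnePoint.coe_ne_infty _)
  · exact fun h => Or.inl ⟨z, w, rfl, h⟩

/-- Near a parameter of a finite point, a local parametrization is given by two holomorphic
functions. -/
theorem LocalParam.exists_coords (P : LocalParam γ) {t z₀ w₀ : ℂ} (ht : t ∈ P.U)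
    (h : P.φ t = ((z₀ : OnePoint ℂ), (w₀ : OnePoint ℂ))) :
    ∃ z w : ℂ → ℂ, AnalyticAt ℂ z t ∧ AnalyticAt ℂ w t ∧ z t = z₀ ∧ w t = w₀ ∧ ∀ᶠ r in 𝓝 t,
      r ∈ P.U ∧ P.φ r = ((z r : OnePoint ℂ), (w r : OnePoint ℂ)) ∧
        w r ^ (γ + 1) = z r * (z r ^ 2 - 1) ^ γ := by
  obtain ⟨z, hz, hz'⟩ := (P.holomorphic_z t ht).exists_finite (congrArg Prod.fst h)
  obtain ⟨w, hw, hw'⟩ := (P.holomorphic_w t ht).exists_finite (congrArg Prod.snd h)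
  have hall : ∀ᶠ r in 𝓝 t, r ∈ P.U ∧ P.φ r = ((z r : OnePoint ℂ), (w r : OnePoint ℂ)) ∧
        w r ^ (γ + 1) = z r * (z r ^ 2 - 1) ^ γ := by
    filter_upwards [hz', hw', P.isOpen.mem_nhds ht] with r h1 h2 h3
    have h4 : P.φ r = ((z r : OnePoint ℂ), (w r : OnePoint ℂ)) := Prod.ext h1 h2
    exact ⟨h3, h4, mem_compactCurve_coe.1 (h4 ▸ P.mapsTo h3)⟩
  have h5 := hall.self_of_nhds.2.1
  rw [h] at h5
  simp only [Prod.mk.injEq, OnePoint.coe_eq_coe] at h5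
  exact ⟨z, w, hz, hw, h5.1.symm, h5.2.symm, hall⟩

/-- A change of parameter has non-vanishing derivative. -/
theorem LocalParam.deriv_ne_zero (P : LocalParam γ) {C : ℂ → OnePoint ℂ × OnePoint ℂ} {h : ℂ → ℂ}
    {t : ℂ} (ht : t ∈ P.U) (hh : AnalyticAt ℂ h t) (hC : ∀ᶠ r in 𝓝 t, P.φ r = C (h r)) :
    deriv h t ≠ 0 := by
  refine deriv_ne_zero_of_injOn hh (inter_mem hC (P.isOpen.mem_nhds ht)) ?_
  rintro x ⟨hx, hxU⟩ y ⟨hy, hyU⟩ hxy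
  refine P.injOn hxU hyU ?_
  rw [show P.φ x = C (h x) from hx, show P.φ y = C (h y) from hy, hxy]

theorem LocalParam.not_eventually_const (P : LocalParam γ) {t : ℂ} (ht : t ∈ P.U)
    {q : OnePoint ℂ × OnePoint ℂ} : ¬ ∀ᶠ r in 𝓝 t, P.φ r = q := by
  intro hc
  have h := hc.and (P.isOpen.mem_nhds ht)
  obtain ⟨x, hx, hxt⟩ := ((h.filter_mono nhdsWithin_le_nhds).and
    (self_mem_nhdsWithin (s := {t}ᶜ))).exists
  exact hxt (P.injOn hx.2 ht (hx.1.trans h.self_of_nhds.1.symm))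

/-- The chart is inverted by v = w / `middleRoot` z, which is holomorphic in z and w, so no
singularity has to be removed. -/
theorem LocalParam.exists_middle_factor (P : LocalParam γ) {t z₀ w₀ : ℂ} (ht : t ∈ P.U)
    (h : P.φ t = ((z₀ : OnePoint ℂ), (w₀ : OnePoint ℂ))) (h1 : 1 - z₀ ∈ slitPlane)
    (h2 : 1 + z₀ ∈ slitPlane) :
    ∃ k : ℂ → ℂ, AnalyticAt ℂ k t ∧ k t ∈ middleDomain γ ∧
      ∀ᶠ r in 𝓝 t, P.φ r = middleMap γ (k r) := by
  obtain ⟨z, w, hz, hw, rfl, rfl, hall⟩ := P.exists_coords ht h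
  have hpow : ∀ r, w r ^ (γ + 1) = z r * (z r ^ 2 - 1) ^ γ → 1 - z r ∈ slitPlane →
      1 + z r ∈ slitPlane → (w r / middleRoot γ (z r)) ^ (γ + 1) = z r := by
    intro r hr h1 h2
    have := middleRoot_ne_zero (γ := γ) (slitPlane_ne_zero h1) (slitPlane_ne_zero h2)
    rw [div_pow, hr, ← middleRoot_pow, mul_div_assoc, div_self (pow_ne_zero _ this), mul_one]
  have e1 : ∀ᶠ r in 𝓝 t, 1 - z r ∈ slitPlane :=
    (continuousAt_const.sub hz.continuousAt).eventually_mem (isOpen_slitPlane.mem_nhds h1)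
  have e2 : ∀ᶠ r in 𝓝 t, 1 + z r ∈ slitPlane :=
    (continuousAt_const.add hz.continuousAt).eventually_mem (isOpen_slitPlane.mem_nhds h2)
  refine ⟨fun r => w r / middleRoot γ (z r), hw.div ((analyticAt_middleRoot h1 h2).fun_comp hz)
    (middleRoot_ne_zero (slitPlane_ne_zero h1) (slitPlane_ne_zero h2)), ?_, ?_⟩
  · have := hpow t hall.self_of_nhds.2.2 h1 h2
    simp only [middleDomain, mem_ofPred_eq, this]
    exact ⟨h1, h2⟩
  · filter_upwards [hall, e1, e2] with r hr h1 h2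
    have h3 := hpow r hr.2.2 h1 h2
    rw [hr.2.1, middleMap, h3, div_mul_cancel₀ _
      (middleRoot_ne_zero (slitPlane_ne_zero h1) (slitPlane_ne_zero h2))]

/-- The chart is inverted by u = u^(γ+1) / u^γ, where u^(γ+1) = sz − 1 and u^γ = (w/e) / `sideRoot`
(sz). -/
theorem exists_side_coord {z w : ℂ} (hs : s ^ 2 = 1) (he : e ^ (γ + 1) = s)
    (hzw : w ^ (γ + 1) = z * (z ^ 2 - 1) ^ γ) (hz : s * z ∈ slitPlane) (hγ : 0 < γ) :
    ((s * z - 1) * sideRoot γ (s * z) / (w / e)) ^ (γ + 1) = s * z - 1 ∧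
    sideMap γ s e ((s * z - 1) * sideRoot γ (s * z) / (w / e)) =
      ((z : OnePoint ℂ), (w : OnePoint ℂ)) := by
  have hs0 : s ≠ 0 := by rintro rfl; simp at hs
  have he0 : e ≠ 0 := by rintro rfl; exact hs0 (by rw [← he, zero_pow (Nat.succ_ne_zero γ)])
  set x := s * z with hx
  set y := w / e with hy
  have hzx : z = s * x := by rw [hx, ← mul_assoc, ← sq, hs, one_mul]
  have hwy : w = e * y := by rw [hy, mul_div_cancel₀ _ he0]
  have hxy : y ^ (γ + 1) = (x - 1) ^ γ * (x * (1 + x) ^ γ) := by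
    rw [hwy, hzx, mul_pow, he, mul_assoc, mul_pow s, hs, one_mul] at hzw
    rw [mul_left_cancel₀ hs0 hzw, mul_left_comm, ← mul_pow]
    congr 2
    ring
  have hE := sideRoot_ne_zero (γ := γ) hz
  have key : ((x - 1) * sideRoot γ x / y) ^ (γ + 1) = x - 1 ∧
      ((x - 1) * sideRoot γ x / y) ^ γ * sideRoot γ x = y := by
    -- At the branch point, w = 0 forces sz = 1, and division by zero returns the correct value u =
    -- 0.
    by_cases hy0 : y = 0
    · rw [hy0, zero_pow (Nat.succ_ne_zero γ)] at hxy
      have h1x := slitPlane_ne_zero (one_add_mem_slitPlane hz)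
      have hx1 : x - 1 = 0 := by
        rcases mul_eq_zero.1 hxy.symm with h | h
        · exact eq_zero_of_pow_eq_zero h
        · exact absurd h (mul_ne_zero (slitPlane_ne_zero hz) (pow_ne_zero _ h1x))
      simp [hx1, hy0, hγ.ne']
    · constructor
      · rw [div_pow, mul_pow, sideRoot_pow, hxy, pow_succ, mul_right_comm, mul_comm _ (x - 1),
          mul_div_assoc]
        have : (x - 1) ^ γ * (x * (1 + x) ^ γ) ≠ 0 := hxy ▸ pow_ne_zero _ hy0
        rw [div_self this, mul_one]
      · rw [div_pow, mul_pow, div_mul_eq_mul_div, mul_assoc, ← pow_succ, sideRoot_pow, ← hxy,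
          pow_succ, mul_div_cancel_left₀ _ (pow_ne_zero _ hy0)]
  refine ⟨key.1, ?_⟩
  rw [sideMap, key.1, add_sub_cancel, key.2, ← hwy, ← hzx]

/-- Where w ≠ 0 the inverse chart is a holomorphic quotient. A zero of w is isolated, for otherwise
the parametrization would be locally constant, and it is a removable singularity of u. -/
theorem LocalParam.exists_side_factor (P : LocalParam γ) (hγ : 0 < γ) (hs : s ^ 2 = 1)
    (he : e ^ (γ + 1) = s) {t z₀ w₀ : ℂ} (ht : t ∈ P.U)
    (h : P.φ t = ((z₀ : OnePoint ℂ), (w₀ : OnePoint ℂ))) (h1 : s * z₀ ∈ slitPlane) :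
    ∃ k : ℂ → ℂ, AnalyticAt ℂ k t ∧ k t ∈ sideDomain γ ∧
      ∀ᶠ r in 𝓝 t, P.φ r = sideMap γ s e (k r) := by
  obtain ⟨z, w, hz, hw, rfl, rfl, hall⟩ := P.exists_coords ht h
  have he0 : e ≠ 0 := by
    rintro rfl
    rw [zero_pow (Nat.succ_ne_zero γ)] at he
    simp [← he] at hs
  have e1 : ∀ᶠ r in 𝓝 t, s * z r ∈ slitPlane :=
    (continuousAt_const.mul hz.continuousAt).eventually_mem (isOpen_slitPlane.mem_nhds h1)
  set k : ℂ → ℂ := fun r => (s * z r - 1) * sideRoot γ (s * z r) / (w r / e) with hk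
  have hkey : ∀ᶠ r in 𝓝 t, k r ^ (γ + 1) = s * z r - 1 ∧ P.φ r = sideMap γ s e (k r) := by
    filter_upwards [hall, e1] with r hr hr1
    have := exists_side_coord hs he hr.2.2 hr1 hγ
    exact ⟨this.1, hr.2.1.trans this.2.symm⟩
  have hnum : AnalyticAt ℂ (fun r => (s * z r - 1) * sideRoot γ (s * z r)) t :=
    ((analyticAt_const.mul hz).sub analyticAt_const).mul
      (AnalyticAt.fun_comp (g := sideRoot γ) (f := fun r => s * z r)
        (analyticAt_sideRoot h1) (analyticAt_const.mul hz))
  have hden : AnalyticAt ℂ (fun r => w r / e) t := hw.div analyticAt_const he0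
  have hkan : AnalyticAt ℂ k t := by
    by_cases hw0 : w t = 0
    · have hpunct : ∀ᶠ r in 𝓝[≠] t, w r ≠ 0 := by
        refine hw.eventually_eq_zero_or_eventually_ne_zero.resolve_left fun hc => ?_
        refine P.not_eventually_const ht (q := P.φ t) ?_
        have hone : ∀ᶠ r in 𝓝 t, s * z r = 1 := by
          filter_upwards [hc, hkey] with r hr hr2
          have : k r = 0 := by simp [hk, hr]
          rw [this, zero_pow (Nat.succ_ne_zero γ)] at hr2
          exact (sub_eq_zero.1 hr2.1.symm)
        filter_upwards [hkey, hc, hall] with r hr hr2 hr3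
        have a1 : k r = 0 := by simp [hk, hr2]
        have a2 : k t = 0 := by simp [hk, hw0]
        rw [hr.2, hkey.self_of_nhds.2, a1, a2]
      refine analyticAt_of_differentiable_on_punctured_nhds_of_continuousAt ?_ ?_
      · filter_upwards [hpunct, hnum.eventually_analyticAt.filter_mono nhdsWithin_le_nhds,
          hden.eventually_analyticAt.filter_mono nhdsWithin_le_nhds] with r hr h1 h2
        exact (h1.div h2 (div_ne_zero hr he0)).differentiableAt
      · have hkt : k t = 0 := by simp [hk, hw0]
        have ht1 := hkey.self_of_nhds.1
        rw [hkt, zero_pow (Nat.succ_ne_zero γ)] at ht1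
        rw [ContinuousAt, hkt]
        -- Continuity of u at the zero of w is read off from u^(γ+1) = sz − 1 → 0 by taking roots of
        -- absolute values.
        have hlim : Tendsto (fun r => k r ^ (γ + 1)) (𝓝 t) (𝓝 0) := by
          have : Tendsto (fun r => s * z r - 1) (𝓝 t) (𝓝 (s * z t - 1)) :=
            (continuousAt_const.mul hz.continuousAt).sub continuousAt_const
          rw [← ht1] at this
          exact this.congr' (hkey.mono fun r hr => hr.1.symm)
        rw [tendsto_zero_iff_norm_tendsto_zero] at hlim ⊢
        simp only [norm_pow] at hlim
        have h2 := hlim.rpow_const (p := ((γ + 1 : ℕ) : ℝ)⁻¹) (Or.inr (by positivity))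
        rw [Real.zero_rpow (by positivity)] at h2
        refine h2.congr fun r => Real.pow_rpow_inv_natCast (norm_nonneg _) (Nat.succ_ne_zero γ)
    · exact hnum.div hden (div_ne_zero hw0 he0)
  refine ⟨k, hkan, ?_, hkey.mono fun r hr => hr.2⟩
  have := hkey.self_of_nhds.1
  simp only [sideDomain, mem_ofPred_eq, this, add_sub_cancel]
  exact h1

end factor

/-! ### Convergence and positivity of the real integrals -/

/-- A branch of `(z (1 - z ^ 2) ^ γ) ^ (1 / (γ + 1))`, positive on `(0, 1)`. -/
def fullRoot (γ : ℕ) (z : ℂ) : ℂ := root γ z * (root γ (1 - z) ^ γ * root γ (1 + z) ^ γ)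

section integrals
variable {γ : ℕ}

theorem fullRoot_ofReal {t : ℝ} (h0 : 0 < t) (h1 : t < 1) :
    fullRoot γ t = (((t * (1 - t ^ 2) ^ γ) ^ (1 / ((γ : ℝ) + 1)) : ℝ) : ℂ) := by
  have a1 : (0 : ℝ) ≤ 1 - t := by linarith
  have a2 : (0 : ℝ) ≤ 1 + t := by linarith
  rw [fullRoot, root_ofReal h0.le, ← ofReal_one, ← ofReal_sub, ← ofReal_add, root_ofReal a1,
    root_ofReal a2, ← ofReal_pow, ← ofReal_pow, ← ofReal_mul, ← ofReal_mul,
    show 1 - t ^ 2 = (1 - t) * (1 + t) by ring, mul_pow, Real.mul_rpow h0.le (by positivity),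
    Real.mul_rpow (by positivity) (by positivity), Real.rpow_pow_comm a1, Real.rpow_pow_comm a2]

theorem integrandB_eq {t : ℝ} (h1 : |t| < 1) (h0 : 0 < t) :
    integrandB γ t = (t * (1 - t ^ 2) ^ γ) ^ (1 / ((γ : ℝ) + 1)) / (1 - t ^ 2) := by
  have h2 : 0 < 1 - t ^ 2 := by nlinarith [abs_of_pos h0]
  have h3 : t / (1 - t ^ 2) = t * (1 - t ^ 2) ^ γ / (1 - t ^ 2) ^ (γ + 1) := by
    field_simp
    ring
  rw [integrandB, h3, Real.div_rpow (by positivity) (by positivity), one_div]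
  congr 1
  have := Real.pow_rpow_inv_natCast h2.le (Nat.succ_ne_zero γ)
  push_cast at this
  exact this

theorem ofReal_integrandA {t : ℝ} (h0 : 0 < t) (h1 : t < 1) :
    ((integrandA γ t : ℝ) : ℂ) = (fullRoot γ t)⁻¹ := by
  rw [fullRoot_ofReal h0 h1, integrandA, one_div, ofReal_inv]

theorem ofReal_integrandB {t : ℝ} (h0 : 0 < t) (h1 : t < 1) :
    ((integrandB γ t : ℝ) : ℂ) = fullRoot γ t / (1 - (t : ℂ) ^ 2) := by
  rw [fullRoot_ofReal h0 h1, integrandB_eq (by rwa [abs_of_pos h0]) h0]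
  push_cast
  rfl

theorem integrandA_pos {t : ℝ} (h0 : 0 < t) (h1 : t < 1) : 0 < integrandA γ t := by
  have : 0 < 1 - t ^ 2 := by nlinarith
  unfold integrandA
  positivity

theorem integrandB_pos {t : ℝ} (h0 : 0 < t) (h1 : t < 1) : 0 < integrandB γ t := by
  have : 0 < 1 - t ^ 2 := by nlinarith
  unfold integrandB
  positivity

/-- As 1 − t ≤ 1 − t², the integrand is bounded by that of the beta integral with parameters γ/(γ+1)
and 1/(γ+1). -/
theorem integrandA_le {t : ℝ} (h0 : 0 < t) (h1 : t < 1) :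
    integrandA γ t ≤ t ^ ((γ : ℝ) / (γ + 1) - 1) * (1 - t) ^ (1 / ((γ : ℝ) + 1) - 1) := by
  have h2 : 0 < 1 - t := by linarith
  have h3 : integrandA γ t ≤ ((t * (1 - t) ^ γ) ^ (1 / ((γ : ℝ) + 1)))⁻¹ := by
    rw [integrandA, one_div]
    have : 1 - t ≤ 1 - t ^ 2 := by nlinarith
    gcongr
  refine h3.trans (le_of_eq ?_)
  have hn : (γ : ℝ) + 1 ≠ 0 := by positivity
  rw [Real.mul_rpow h0.le (by positivity), mul_inv, ← Real.rpow_natCast, ← Real.rpow_mul h2.le,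
    ← Real.rpow_neg h0.le, ← Real.rpow_neg h2.le]
  congr 2 <;> field_simp <;> ring

theorem intervalIntegrable_integrandA (hγ : 0 < γ) :
    IntervalIntegrable (integrandA γ) volume 0 1 := by
  have hγ' : (0 : ℝ) < γ := by exact_mod_cast hγ
  have hb := (betaIntegral_convergent (u := (((γ : ℝ) / (γ + 1) : ℝ) : ℂ))
    (v := ((1 / ((γ : ℝ) + 1) : ℝ) : ℂ)) (by rw [ofReal_re]; positivity)
    (by rw [ofReal_re]; positivity)).norm
  refine hb.mono_fun' ?_ ?_
  · unfold integrandA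
    exact (Measurable.aestronglyMeasurable (by fun_prop))
  · rw [EventuallyLE, ae_restrict_iff' measurableSet_uIoc]
    have : ∀ᵐ t : ℝ, t ≠ 1 := by simp [ae_iff, measure_singleton]
    filter_upwards [this] with t ht1 ht
    rw [uIoc_of_le zero_le_one] at ht
    have h1 : t < 1 := lt_of_le_of_ne ht.2 ht1
    rw [Real.norm_of_nonneg (integrandA_pos ht.1 h1).le]
    refine (integrandA_le ht.1 h1).trans (le_of_eq ?_)
    have h2 : 0 < 1 - t := by linarith
    rw [norm_mul, ← ofReal_one, ← ofReal_sub, ← ofReal_sub, ← ofReal_sub,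
      norm_cpow_eq_rpow_re_of_pos ht.1, norm_cpow_eq_rpow_re_of_pos h2, ofReal_re, ofReal_re]

/-- For γ ≥ 1 and 0 < t < 1 one has t/(1 − t²) ≤ 1/(t(1 − t²)^γ), so the first integrand dominates.
-/
theorem intervalIntegrable_integrandB (hγ : 0 < γ) :
    IntervalIntegrable (integrandB γ) volume 0 1 := by
  refine (intervalIntegrable_integrandA hγ).mono_fun' ?_ ?_
  · unfold integrandB
    exact (Measurable.aestronglyMeasurable (by fun_prop))
  · rw [EventuallyLE, ae_restrict_iff' measurableSet_uIoc]
    have : ∀ᵐ t : ℝ, t ≠ 1 := by simp [ae_iff, measure_singleton]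
    filter_upwards [this] with t ht1 ht
    rw [uIoc_of_le zero_le_one] at ht
    have h1 : t < 1 := lt_of_le_of_ne ht.2 ht1
    have h0 := ht.1
    have h2 : 0 < 1 - t ^ 2 := by nlinarith
    rw [Real.norm_of_nonneg (integrandB_pos h0 h1).le, integrandA, integrandB,
      one_div (_ ^ (1 / ((γ : ℝ) + 1))), ← Real.inv_rpow (by positivity)]
    have h3 : (1 - t ^ 2) ^ γ ≤ 1 - t ^ 2 := by
      calc (1 - t ^ 2) ^ γ ≤ (1 - t ^ 2) ^ 1 := pow_le_pow_of_le_one h2.le (by nlinarith) hγ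
        _ = _ := pow_one _
    have h4 : t / (1 - t ^ 2) ≤ (t * (1 - t ^ 2) ^ γ)⁻¹ := by
      calc t / (1 - t ^ 2) ≤ t⁻¹ / (1 - t ^ 2) := by
            gcongr
            exact h1.le.trans ((one_le_inv₀ h0).2 h1.le)
        _ = (t * (1 - t ^ 2))⁻¹ := by rw [mul_inv, div_eq_mul_inv]
        _ ≤ _ := by gcongr
    gcongr

theorem integral_integrandA_pos (hγ : 0 < γ) : 0 < ∫ t in (0 : ℝ)..1, integrandA γ t :=
  intervalIntegral.intervalIntegral_pos_of_pos_on (intervalIntegrable_integrandA hγ)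
    (fun _ ht => integrandA_pos ht.1 ht.2) zero_lt_one

theorem integral_integrandB_pos (hγ : 0 < γ) : 0 < ∫ t in (0 : ℝ)..1, integrandB γ t :=
  intervalIntegral.intervalIntegral_pos_of_pos_on (intervalIntegrable_integrandB hγ)
    (fun _ ht => integrandB_pos ht.1 ht.2) zero_lt_one

theorem constA_pos (hγ : 0 < γ) : 0 < constA γ := by
  have := integral_integrandA_pos hγ
  have hγ' : (0 : ℝ) < γ := by exact_mod_cast hγ
  unfold constA
  positivity

theorem constB_pos (hγ : 0 < γ) : 0 < constB γ := by
  have := integral_integrandB_pos hγ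
  unfold constB
  positivity

end integrals

/-! ### Primitives of dz/w and w dz/(z² − 1) in the charts -/

section primitives
variable (γ : ℕ)

/-- With z = 1 + u^(γ+1) the zero of dz = (γ+1)u^γ du cancels that of w = u^γ `sideRoot` z, so dz/w
is holomorphic at the branch point. -/
theorem exists_sideA : ∃ F : ℂ → ℂ, F 0 = 0 ∧ ∀ u ∈ sideDomain γ,
    HasDerivAt F (((γ : ℂ) + 1) / sideRoot γ (1 + u ^ (γ + 1))) u :=
  exists_primitive_of_starConvex isOpen_sideDomain starConvex_sideDomain fun _ hu =>
    (analyticAt_const.div (analyticAt_sideRoot_comp hu)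
      (sideRoot_ne_zero hu)).differentiableAt.differentiableWithinAt

theorem exists_sideB : ∃ F : ℂ → ℂ, F 0 = 0 ∧ ∀ u ∈ sideDomain γ,
    HasDerivAt F (((γ : ℂ) + 1) * u ^ (γ - 1) * sideRoot γ (1 + u ^ (γ + 1)) /
      (1 + (1 + u ^ (γ + 1)))) u :=
  exists_primitive_of_starConvex isOpen_sideDomain starConvex_sideDomain fun u hu =>
    (AnalyticAt.div ((analyticAt_const.mul (analyticAt_id.pow _)).mul (analyticAt_sideRoot_comp hu))
      (by fun_prop) (slitPlane_ne_zero (one_add_mem_slitPlane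
        (z := 1 + u ^ (γ + 1)) hu))).differentiableAt.differentiableWithinAt

/-- With z = v^(γ+1) and w = v `middleRoot` z, the quotient dz/w keeps the factor v^(γ−1); it is
regular at (0, 0) because γ ≥ 1, whereas dz/(z²w) has a pole there. -/
theorem exists_middleA : ∃ F : ℂ → ℂ, F 0 = 0 ∧ ∀ v ∈ middleDomain γ,
    HasDerivAt F (((γ : ℂ) + 1) * v ^ (γ - 1) / middleRoot γ (v ^ (γ + 1))) v :=
  exists_primitive_of_starConvex isOpen_middleDomain starConvex_middleDomain fun v hv =>
    (AnalyticAt.div (by fun_prop) (analyticAt_middleRoot_comp hv)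
      (middleRoot_ne_zero (slitPlane_ne_zero hv.1)
        (slitPlane_ne_zero hv.2))).differentiableAt.differentiableWithinAt

theorem exists_middleB : ∃ F : ℂ → ℂ, F 0 = 0 ∧ ∀ v ∈ middleDomain γ,
    HasDerivAt F (((γ : ℂ) + 1) * v ^ (γ + 1) * middleRoot γ (v ^ (γ + 1)) /
      ((v ^ (γ + 1)) ^ 2 - 1)) v :=
  exists_primitive_of_starConvex isOpen_middleDomain starConvex_middleDomain fun v hv =>
    (AnalyticAt.div ((analyticAt_const.mul (analyticAt_id.pow _)).mul
      (analyticAt_middleRoot_comp hv)) (by fun_prop) (by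
        rw [show (v ^ (γ + 1)) ^ 2 - 1 = -((1 - v ^ (γ + 1)) * (1 + v ^ (γ + 1))) by ring]
        exact neg_ne_zero.2 (mul_ne_zero (slitPlane_ne_zero hv.1)
          (slitPlane_ne_zero hv.2)))).differentiableAt.differentiableWithinAt

/-- The integral of `dz / w` around `(1, 0)`. -/
def sideA : ℂ → ℂ := (exists_sideA γ).choose
/-- The integral of `w dz / (z ^ 2 - 1)` around `(1, 0)`. -/
def sideB : ℂ → ℂ := (exists_sideB γ).choose
/-- The integral of `dz / w` around `(0, 0)`. -/
def middleA : ℂ → ℂ := (exists_middleA γ).choose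
/-- The integral of `w dz / (z ^ 2 - 1)` around `(0, 0)`. -/
def middleB : ℂ → ℂ := (exists_middleB γ).choose

end primitives

/-! ### Comparing the primitives of different charts -/

section glue
variable {γ : ℕ}

/-- The plane without the rays (−∞, 0] and [1, ∞) is star-shaped about 1/2, so F − G is a constant.
With F → 0 at 0 and G → 0 at 1, the constant is the limit of F at 1, hence the integral of the
common derivative over (0, 1). -/
theorem eq_integral_of_hasDerivAt {F G d : ℂ → ℂ} {i : ℝ → ℝ} {κ : ℂ}
    (hF : ∀ z, z ∈ slitPlane → 1 - z ∈ slitPlane → HasDerivAt F (d z) z)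
    (hG : ∀ z, z ∈ slitPlane → 1 - z ∈ slitPlane → HasDerivAt G (d z) z)
    (h0 : Tendsto F (𝓝 0) (𝓝 0)) (h1 : Tendsto G (𝓝 1) (𝓝 0))
    (hd : ∀ t : ℝ, 0 < t → t < 1 → d t = κ * i t) (hi : IntervalIntegrable i volume 0 1)
    {z : ℂ} (hz : z ∈ slitPlane) (hz1 : 1 - z ∈ slitPlane) :
    F z - G z = κ * (∫ t in (0 : ℝ)..1, i t : ℝ) := by
  set Ω : Set ℂ := {z | z ∈ slitPlane ∧ 1 - z ∈ slitPlane} with hΩ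
  have hopen : IsOpen Ω := isOpen_slitPlane.inter
    (isOpen_slitPlane.preimage (by fun_prop : Continuous fun z : ℂ => 1 - z))
  have hhalf : StarConvex ℝ (((1 / 2 : ℝ) : ℂ)) slitPlane :=
    starConvex_ofReal_slitPlane (by norm_num)
  have hstar : StarConvex ℝ (((1 / 2 : ℝ) : ℂ)) Ω := by
    intro x hx a b ha hb hab
    refine ⟨hhalf hx.1 ha hb hab, ?_⟩
    have := hhalf hx.2 ha hb hab
    convert this using 1
    have hab' : (a : ℂ) + b = 1 := by exact_mod_cast hab
    simp only [real_smul]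
    push_cast
    linear_combination -hab'
  have hreal : ∀ t : ℝ, 0 < t → t < 1 → (t : ℂ) ∈ Ω := fun t h0 h1 =>
    ⟨ofReal_mem_slitPlane.2 h0, by
      rw [← ofReal_one, ← ofReal_sub]
      exact ofReal_mem_slitPlane.2 (by linarith)⟩
  have hconn : IsPreconnected Ω :=
    (hstar.isPathConnected (hreal (1 / 2) (by norm_num) (by norm_num))).isConnected.isPreconnected
  obtain ⟨C, hC⟩ := exists_eq_add_const hopen hconn (fun z hz => hF z hz.1 hz.2)
    (fun z hz => hG z hz.1 hz.2)
  rw [hC z ⟨hz, hz1⟩, add_sub_cancel_left]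
  have hint := intervalIntegral.integral_eq_sub_of_hasDerivAt_of_tendsto (f := fun t : ℝ => F t)
    (f' := fun t : ℝ => κ * (i t : ℂ)) zero_lt_one (fa := 0) (fb := C)
    (fun t ht => by
      have hm := hreal t ht.1 ht.2
      rw [← hd t ht.1 ht.2]
      exact (hF t hm.1 hm.2).comp_ofReal) ((show
        IntervalIntegrable (fun t => (i t : ℂ)) volume 0 1 from
      ⟨hi.1.ofReal, hi.2.ofReal⟩).const_mul κ)
    ((h0.comp (continuous_ofReal.tendsto' 0 0 ofReal_zero)).mono_left nhdsWithin_le_nhds)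
    (by
      have h2 : Tendsto (fun t : ℝ => G t + C) (𝓝[<] 1) (𝓝 (0 + C)) :=
        ((h1.comp (continuous_ofReal.tendsto' 1 1 ofReal_one)).mono_left
          nhdsWithin_le_nhds).add_const C
      rw [zero_add] at h2
      refine h2.congr' ?_
      filter_upwards [Ioo_mem_nhdsLT (zero_lt_one' ℝ)] with t ht
      exact (hC t (hreal t ht.1 ht.2)).symm)
  rw [sub_zero, intervalIntegral.integral_const_mul, intervalIntegral.integral_ofReal] at hint
  exact hint.symm

theorem sideA_zero : sideA γ 0 = 0 := (exists_sideA γ).choose_spec.1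
theorem sideB_zero : sideB γ 0 = 0 := (exists_sideB γ).choose_spec.1
theorem middleA_zero : middleA γ 0 = 0 := (exists_middleA γ).choose_spec.1
theorem middleB_zero : middleB γ 0 = 0 := (exists_middleB γ).choose_spec.1

theorem hasDerivAt_sideA {u : ℂ} (hu : u ∈ sideDomain γ) :
    HasDerivAt (sideA γ) (((γ : ℂ) + 1) / sideRoot γ (1 + u ^ (γ + 1))) u :=
  (exists_sideA γ).choose_spec.2 u hu

theorem hasDerivAt_sideB {u : ℂ} (hu : u ∈ sideDomain γ) :
    HasDerivAt (sideB γ) (((γ : ℂ) + 1) * u ^ (γ - 1) * sideRoot γ (1 + u ^ (γ + 1)) /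
      (1 + (1 + u ^ (γ + 1)))) u :=
  (exists_sideB γ).choose_spec.2 u hu

theorem hasDerivAt_middleA {v : ℂ} (hv : v ∈ middleDomain γ) :
    HasDerivAt (middleA γ) (((γ : ℂ) + 1) * v ^ (γ - 1) / middleRoot γ (v ^ (γ + 1))) v :=
  (exists_middleA γ).choose_spec.2 v hv

theorem hasDerivAt_middleB {v : ℂ} (hv : v ∈ middleDomain γ) :
    HasDerivAt (middleB γ) (((γ : ℂ) + 1) * v ^ (γ + 1) * middleRoot γ (v ^ (γ + 1)) /
      ((v ^ (γ + 1)) ^ 2 - 1)) v :=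
  (exists_middleB γ).choose_spec.2 v hv

theorem fullRoot_eq_sideRoot (z : ℂ) : fullRoot γ z = sideRoot γ z * root γ (1 - z) ^ γ := by
  rw [fullRoot, sideRoot]
  ring

theorem fullRoot_eq_middleRoot (z : ℂ) : eps γ ^ γ * fullRoot γ z = root γ z * middleRoot γ z := by
  rw [fullRoot, middleRoot]
  ring

theorem fullRoot_ne_zero {z : ℂ} (hz : z ∈ slitPlane) (hz1 : 1 - z ∈ slitPlane) :
    fullRoot γ z ≠ 0 := by
  rw [fullRoot_eq_sideRoot]
  exact mul_ne_zero (sideRoot_ne_zero hz) (pow_ne_zero _ (root_ne_zero (slitPlane_ne_zero hz1)))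

variable {l m : ℂ}

theorem hasDerivAt_root_one_sub {z : ℂ} (hz : 1 - z ∈ slitPlane) :
    HasDerivAt (fun z => m * root γ (1 - z))
      (-(m * (root γ (1 - z) / (((γ : ℂ) + 1) * (1 - z))))) z := by
  have h := ((hasDerivAt_root (γ := γ) hz).comp z ((hasDerivAt_id z).const_sub 1)).const_mul m
  refine h.congr_deriv ?_
  ring

theorem mul_root_pow (hl : l ^ (γ + 1) = 1) (z : ℂ) : (l * root γ z) ^ (γ + 1) = z := by
  rw [mul_pow, hl, root_pow, one_mul]

theorem one_add_mul_root_pow (hm : m ^ (γ + 1) = -1) (z : ℂ) :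
    1 + (m * root γ (1 - z)) ^ (γ + 1) = z := by
  rw [mul_pow, hm, root_pow]
  ring

theorem mul_root_mem_middleDomain (hl : l ^ (γ + 1) = 1) {z : ℂ} (hz : z ∈ slitPlane)
    (hz1 : 1 - z ∈ slitPlane) : l * root γ z ∈ middleDomain γ := by
  simp only [middleDomain, mem_ofPred_eq, mul_root_pow hl]
  exact ⟨hz1, one_add_mem_slitPlane hz⟩

theorem mul_root_mem_sideDomain (hm : m ^ (γ + 1) = -1) {z : ℂ} (hz : z ∈ slitPlane) :
    m * root γ (1 - z) ∈ sideDomain γ := by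
  simp only [sideDomain, mem_ofPred_eq, one_add_mul_root_pow hm]
  exact hz

theorem tendsto_middle {F : ℂ → ℂ} {F' : ℂ} (hF : HasDerivAt F F' 0)
    (h0 : F 0 = 0) : Tendsto (fun z => F (l * root γ z)) (𝓝 0) (𝓝 0) := by
  have h1 : ContinuousAt (fun z => l * root γ z) 0 := continuousAt_const.mul continuousAt_root_zero
  have h2 : ContinuousAt F (l * root γ 0) := by
    rw [root_zero, mul_zero]
    exact hF.continuousAt
  have := ContinuousAt.comp (g := F) (f := fun z => l * root γ z) h2 h1
  simpa [ContinuousAt, root_zero, h0, Function.comp_def] using this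

theorem tendsto_side {F : ℂ → ℂ} {F' : ℂ} (hF : HasDerivAt F F' 0)
    (h0 : F 0 = 0) : Tendsto (fun z => F (m * root γ (1 - z))) (𝓝 1) (𝓝 0) := by
  have h1 : ContinuousAt (fun z => m * root γ (1 - z)) 1 := by
    refine continuousAt_const.mul (ContinuousAt.comp (g := root γ) (f := fun z : ℂ => 1 - z) ?_
      (by fun_prop))
    rw [sub_self]
    exact continuousAt_root_zero
  have h2 : ContinuousAt F (m * root γ (1 - 1)) := by
    rw [sub_self, root_zero, mul_zero]
    exact hF.continuousAt
  have := ContinuousAt.comp (g := F) (f := fun z => m * root γ (1 - z)) h2 h1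
  simpa [ContinuousAt, root_zero, h0, Function.comp_def] using this

/-- Both primitives are pulled back to the z-plane. The roots of unity l and of −1, m, select the
sheet: v = l z^(1/(γ+1)) and u = m (1 − z)^(1/(γ+1)). The condition `hlm` says that v and u give the
same w, namely θ `fullRoot` z with θ = l ε^γ = −1/m. -/
theorem middleA_sub_sideA (hγ : 0 < γ) (hl : l ^ (γ + 1) = 1) (hm : m ^ (γ + 1) = -1)
    (hlm : l * eps γ ^ γ * m = -1) {z : ℂ} (hz : z ∈ slitPlane) (hz1 : 1 - z ∈ slitPlane) :
    middleA γ (l * root γ z) - sideA γ (m * root γ (1 - z)) =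
      (l * eps γ ^ γ)⁻¹ * (∫ t in (0 : ℝ)..1, integrandA γ t : ℝ) := by
  have hn := natCast_succ_ne_zero γ
  have hl0 : l ≠ 0 := by rintro rfl; simp at hlm
  have hm0 : m ≠ 0 := by rintro rfl; simp at hlm
  have he := eps_ne_zero γ
  refine eq_integral_of_hasDerivAt (F := fun z => middleA γ (l * root γ z))
    (G := fun z => sideA γ (m * root γ (1 - z)))
    (d := fun z => (l * eps γ ^ γ)⁻¹ * (fullRoot γ z)⁻¹) ?_ ?_
    (tendsto_middle (hasDerivAt_middleA zero_mem_middleDomain) middleA_zero)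
    (tendsto_side (hasDerivAt_sideA zero_mem_sideDomain) sideA_zero) ?_
    (intervalIntegrable_integrandA hγ) hz hz1
  · intro z hz hz1
    have h := (hasDerivAt_middleA (mul_root_mem_middleDomain hl hz hz1)).comp z
      ((hasDerivAt_root (γ := γ) hz).const_mul l)
    refine h.congr_deriv ?_
    rw [mul_root_pow hl, ← mul_inv, mul_assoc l, fullRoot_eq_middleRoot]
    have hr : root γ z ≠ 0 := root_ne_zero (slitPlane_ne_zero hz)
    have hD := middleRoot_ne_zero (γ := γ) (slitPlane_ne_zero hz1)
      (slitPlane_ne_zero (one_add_mem_slitPlane hz))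
    have h1 : (l * root γ z) ^ (γ - 1) * (l * root γ z) * (l * root γ z) = z := by
      rw [pow_sub_one_mul hγ.ne', ← pow_succ, mul_root_pow hl]
    have hz0 := slitPlane_ne_zero hz
    field_simp
    linear_combination h1
  · intro z hz hz1
    have h := (hasDerivAt_sideA (mul_root_mem_sideDomain hm hz)).comp z
      (hasDerivAt_root_one_sub (γ := γ) (m := m) hz1)
    refine h.congr_deriv ?_
    rw [one_add_mul_root_pow hm, show (l * eps γ ^ γ)⁻¹ = -m from
      inv_eq_of_mul_eq_one_right (by linear_combination -hlm), fullRoot_eq_sideRoot]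
    have hr : root γ (1 - z) ≠ 0 := root_ne_zero (slitPlane_ne_zero hz1)
    have hE := sideRoot_ne_zero (γ := γ) hz
    have h1 := root_pow_mul γ (1 - z)
    have hz0 := slitPlane_ne_zero hz1
    field_simp
    linear_combination -h1
  · intro t h0 h1
    rw [ofReal_integrandA h0 h1]

/-- Same comparison with w dz/(z² − 1) = −θ `fullRoot` z dz/(1 − z²); now θ enters instead of θ⁻¹.
-/
theorem middleB_sub_sideB (hγ : 0 < γ) (hl : l ^ (γ + 1) = 1) (hm : m ^ (γ + 1) = -1)
    (hlm : l * eps γ ^ γ * m = -1) {z : ℂ} (hz : z ∈ slitPlane) (hz1 : 1 - z ∈ slitPlane) :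
    middleB γ (l * root γ z) - sideB γ (m * root γ (1 - z)) =
      -(l * eps γ ^ γ) * (∫ t in (0 : ℝ)..1, integrandB γ t : ℝ) := by
  have hn := natCast_succ_ne_zero γ
  have hl0 : l ≠ 0 := by rintro rfl; simp at hlm
  have hm0 : m ≠ 0 := by rintro rfl; simp at hlm
  have he := eps_ne_zero γ
  refine eq_integral_of_hasDerivAt (F := fun z => middleB γ (l * root γ z))
    (G := fun z => sideB γ (m * root γ (1 - z)))
    (d := fun z => -(l * eps γ ^ γ) * (fullRoot γ z / (1 - z ^ 2))) ?_ ?_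
    (tendsto_middle (hasDerivAt_middleB zero_mem_middleDomain) middleB_zero)
    (tendsto_side (hasDerivAt_sideB zero_mem_sideDomain) sideB_zero) ?_
    (intervalIntegrable_integrandB hγ) hz hz1
  · intro z hz hz1
    have h := (hasDerivAt_middleB (mul_root_mem_middleDomain hl hz hz1)).comp z
      ((hasDerivAt_root (γ := γ) hz).const_mul l)
    refine h.congr_deriv ?_
    have hz0 := slitPlane_ne_zero hz
    rw [mul_root_pow hl, neg_mul, mul_assoc l, mul_div_assoc' (eps γ ^ γ), fullRoot_eq_middleRoot,
      show z ^ 2 - 1 = -(1 - z ^ 2) by ring]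
    have h2 : 1 - z ^ 2 ≠ 0 := by
      rw [show 1 - z ^ 2 = (1 - z) * (1 + z) by ring]
      exact mul_ne_zero (slitPlane_ne_zero hz1) (slitPlane_ne_zero (one_add_mem_slitPlane hz))
    field_simp
  · intro z hz hz1
    have h := (hasDerivAt_sideB (mul_root_mem_sideDomain hm hz)).comp z
      (hasDerivAt_root_one_sub (γ := γ) (m := m) hz1)
    refine h.congr_deriv ?_
    have hlm' : -(l * eps γ ^ γ) = m⁻¹ := by
      field_simp
      linear_combination -hlm
    rw [one_add_mul_root_pow hm, hlm', fullRoot_eq_sideRoot,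
      show 1 - z ^ 2 = (1 - z) * (1 + z) by ring]
    have hr : root γ (1 - z) ≠ 0 := root_ne_zero (slitPlane_ne_zero hz1)
    have hz0 := slitPlane_ne_zero hz1
    have hz2 := slitPlane_ne_zero (one_add_mem_slitPlane hz)
    have h1 : (m * root γ (1 - z)) ^ (γ - 1) * (m * root γ (1 - z)) * m =
        - root γ (1 - z) ^ γ := by
      rw [pow_sub_one_mul hγ.ne', mul_pow, mul_right_comm, ← pow_succ, hm, neg_one_mul]
    field_simp
    linear_combination (-sideRoot γ z) * h1
  · intro t h0 h1
    rw [ofReal_integrandB h0 h1]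

/-- The map v ↦ εv is the symmetry (z, w) ↦ (−z, εw), which multiplies dz/w by −ε⁻¹; both primitives
vanish at the fixed point v = 0. -/
theorem middleA_eps_mul (hγ : 0 < γ) {v : ℂ} (hv : v ∈ middleDomain γ) :
    eps γ * middleA γ (eps γ * v) = - middleA γ v := by
  have hp : ∀ v : ℂ, (eps γ * v) ^ (γ + 1) = - v ^ (γ + 1) := fun v => by
    rw [mul_pow, eps_pow, neg_one_mul]
  have hm : ∀ v ∈ middleDomain γ, eps γ * v ∈ middleDomain γ := fun v hv => by
    simp only [middleDomain, mem_ofPred_eq, hp, sub_neg_eq_add, ← sub_eq_add_neg]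
    exact ⟨hv.2, hv.1⟩
  obtain ⟨C, hC⟩ := exists_eq_add_const isOpen_middleDomain
    (starConvex_middleDomain.isPathConnected zero_mem_middleDomain).isConnected.isPreconnected
    (f := fun v => eps γ * middleA γ (eps γ * v)) (g := fun v => - middleA γ v)
    (fun v hv => (((hasDerivAt_middleA (hm v hv)).comp v
      ((hasDerivAt_id v).const_mul (eps γ))).const_mul (eps γ)))
    (fun v hv => ((hasDerivAt_middleA hv).neg).congr_deriv (by
      rw [hp, middleRoot_neg, mul_pow, mul_one]
      have h := eps_pow γ
      rw [pow_succ, ← pow_sub_one_mul hγ.ne'] at h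
      linear_combination (-(((γ : ℂ) + 1) * v ^ (γ - 1) / middleRoot γ (v ^ (γ + 1)))) * h))
  have h0 := hC 0 zero_mem_middleDomain
  simp only [mul_zero, middleA_zero, neg_zero, zero_add] at h0
  rw [hC v hv, ← h0, add_zero]

/-- The same symmetry multiplies w dz/(z² − 1) by −ε. -/
theorem middleB_eps_mul {v : ℂ} (hv : v ∈ middleDomain γ) :
    middleB γ (eps γ * v) = - (eps γ * middleB γ v) := by
  have hp : ∀ v : ℂ, (eps γ * v) ^ (γ + 1) = - v ^ (γ + 1) := fun v => by
    rw [mul_pow, eps_pow, neg_one_mul]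
  have hm : ∀ v ∈ middleDomain γ, eps γ * v ∈ middleDomain γ := fun v hv => by
    simp only [middleDomain, mem_ofPred_eq, hp, sub_neg_eq_add, ← sub_eq_add_neg]
    exact ⟨hv.2, hv.1⟩
  obtain ⟨C, hC⟩ := exists_eq_add_const isOpen_middleDomain
    (starConvex_middleDomain.isPathConnected zero_mem_middleDomain).isConnected.isPreconnected
    (f := fun v => middleB γ (eps γ * v)) (g := fun v => - (eps γ * middleB γ v))
    (fun v hv => (((hasDerivAt_middleB (hm v hv)).comp v
      ((hasDerivAt_id v).const_mul (eps γ)))))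
    (fun v hv => (((hasDerivAt_middleB hv).const_mul (eps γ)).neg).congr_deriv (by
      rw [hp, middleRoot_neg, mul_one, neg_sq]
      ring))
  have h0 := hC 0 zero_mem_middleDomain
  simp only [mul_zero, middleB_zero, neg_zero, zero_add] at h0
  rw [hC v hv, ← h0, add_zero]

/-- The (γ + 1)-st powers of w and of `fullRoot` z differ only by the sign (−1)^γ. That the ratio is
unimodular is what later turns its inverse into its conjugate. -/
theorem norm_div_fullRoot {z w : ℂ} (hzw : w ^ (γ + 1) = z * (z ^ 2 - 1) ^ γ) (hz : z ∈ slitPlane)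
    (hz1 : 1 - z ∈ slitPlane) : ‖w / fullRoot γ z‖ = 1 := by
  have hW := fullRoot_ne_zero (γ := γ) hz hz1
  have h2 : (fullRoot γ z) ^ (γ + 1) = z * (1 - z ^ 2) ^ γ := by
    have h : ∀ x : ℂ, (x ^ γ) ^ (γ + 1) = (x ^ (γ + 1)) ^ γ := fun x => by
      rw [← pow_mul, mul_comm, pow_mul]
    rw [fullRoot, mul_pow, mul_pow, h, h, root_pow, root_pow, root_pow, ← mul_pow]
    congr 2
    ring
  have h3 : ‖w / fullRoot γ z‖ ^ (γ + 1) = 1 := by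
    rw [← norm_pow, div_pow, h2, hzw, norm_div, norm_mul, norm_mul, norm_pow, norm_pow,
      norm_sub_rev]
    rw [← norm_pow, ← norm_mul, ← h2]
    exact div_self (norm_ne_zero_iff.2 (pow_ne_zero _ hW))
  exact (pow_eq_one_iff_of_nonneg (norm_nonneg _) (Nat.succ_ne_zero γ)).1 h3

/-- The integrals around `(1, 0)` and around `(0, 0)` differ by a period. -/
theorem side_eq_middle (hγ : 0 < γ) {u z w : ℂ} (hu : 1 + u ^ (γ + 1) = z)
    (huw : u ^ γ * sideRoot γ z = w) (hz : z ∈ slitPlane) (hz1 : 1 - z ∈ slitPlane) :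
    w / middleRoot γ z ∈ middleDomain γ ∧
    sideA γ u = middleA γ (w / middleRoot γ z) -
      (w / fullRoot γ z)⁻¹ * (∫ t in (0 : ℝ)..1, integrandA γ t : ℝ) ∧
    sideB γ u = middleB γ (w / middleRoot γ z) +
      (w / fullRoot γ z) * (∫ t in (0 : ℝ)..1, integrandB γ t : ℝ) := by
  have hr1 : root γ (1 - z) ≠ 0 := root_ne_zero (slitPlane_ne_zero hz1)
  have hr : root γ z ≠ 0 := root_ne_zero (slitPlane_ne_zero hz)
  have hW := fullRoot_ne_zero (γ := γ) hz hz1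
  have hD := middleRoot_ne_zero (γ := γ) (slitPlane_ne_zero hz1)
    (slitPlane_ne_zero (one_add_mem_slitPlane hz))
  have hu' : u ^ (γ + 1) = z - 1 := by rw [← hu]; ring
  -- The sheet constants of the point: m = u / `root` (1 − z), and below l = w / `middleRoot` z /
  -- `root` z.
  have hm : (u / root γ (1 - z)) ^ (γ + 1) = -1 := by
    rw [div_pow, root_pow, hu', div_eq_iff (slitPlane_ne_zero hz1)]
    ring
  have hcurve : w ^ (γ + 1) = z * (z ^ 2 - 1) ^ γ := by
    rw [← huw, mul_pow, sideRoot_pow, ← pow_mul, mul_comm γ, pow_mul, hu', mul_left_comm, ← mul_pow]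
    congr 2
    ring
  have hl : (w / middleRoot γ z / root γ z) ^ (γ + 1) = 1 := by
    rw [div_pow, div_pow, root_pow, middleRoot_pow, hcurve, ← middleRoot_pow,
      mul_div_cancel_right₀ _ (pow_ne_zero _ hD), div_self (slitPlane_ne_zero hz)]
  have hth : w / middleRoot γ z / root γ z * eps γ ^ γ = w / fullRoot γ z := by
    rw [div_div, div_mul_eq_mul_div, div_eq_div_iff (mul_ne_zero hD hr) hW, mul_assoc,
      fullRoot_eq_middleRoot]
    ring
  have hlm : w / middleRoot γ z / root γ z * eps γ ^ γ * (u / root γ (1 - z)) = -1 := by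
    rw [hth, div_mul_div_comm, ← huw, fullRoot_eq_sideRoot, mul_right_comm, ← pow_succ, hu',
      mul_assoc, root_pow_mul,
      div_eq_iff (mul_ne_zero (sideRoot_ne_zero hz) (slitPlane_ne_zero hz1))]
    ring
  have hA := middleA_sub_sideA hγ hl hm hlm hz hz1
  have hB := middleB_sub_sideB hγ hl hm hlm hz hz1
  have hmem := mul_root_mem_middleDomain hl hz hz1
  rw [hth, div_mul_cancel₀ _ hr, div_mul_cancel₀ _ hr1] at hA hB
  rw [div_mul_cancel₀ _ hr] at hmem
  exact ⟨hmem, by rw [← hA]; ring, by linear_combination -hB⟩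

/-- The integrals around `(1, 0)` and around `(-1, 0)` differ by a period. -/
theorem side_add_side (hγ : 0 < γ) {u u' z w : ℂ}
    (h1 : sideMap γ 1 1 u = ((z : OnePoint ℂ), (w : OnePoint ℂ)))
    (h2 : sideMap γ (-1) (eps γ) u' = ((z : OnePoint ℂ), (w : OnePoint ℂ)))
    (hu : u ∈ sideDomain γ) (hu' : u' ∈ sideDomain γ) :
    z ∈ slitPlane ∧ -z ∈ slitPlane ∧
    sideA γ u + (eps γ)⁻¹ * sideA γ u' = -((w / fullRoot γ z)⁻¹ + (w / fullRoot γ (-z))⁻¹) *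
      (∫ t in (0 : ℝ)..1, integrandA γ t : ℝ) ∧
    sideB γ u + eps γ * sideB γ u' = (w / fullRoot γ z + w / fullRoot γ (-z)) *
      (∫ t in (0 : ℝ)..1, integrandB γ t : ℝ) := by
  have he := eps_ne_zero γ
  simp only [sideMap, Prod.mk.injEq, OnePoint.coe_eq_coe, one_mul] at h1 h2
  obtain ⟨h1, h1'⟩ := h1
  obtain ⟨h2, h2'⟩ := h2
  have h3 : 1 + u' ^ (γ + 1) = -z := by rw [← h2]; ring
  have hz : z ∈ slitPlane := h1 ▸ hu
  have hz' : -z ∈ slitPlane := h3 ▸ hu'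
  rw [h1] at h1'
  rw [h3] at h2'
  -- Seen from (−1, 0), the point (z, w) is the image under the symmetry of (−z, w/ε), so the
  -- comparison at (1, 0) applies to the latter.
  have h4 : u' ^ γ * sideRoot γ (-z) = w / eps γ := by rw [← h2', mul_div_cancel_left₀ _ he]
  obtain ⟨-, a2, a3⟩ := side_eq_middle hγ h1 h1' hz
    (by simpa [sub_eq_add_neg] using one_add_mem_slitPlane hz')
  obtain ⟨b1, b2, b3⟩ := side_eq_middle hγ h3 h4 hz' (by simpa using one_add_mem_slitPlane hz)
  rw [middleRoot_neg] at b1 b2 b3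
  have hv : w / middleRoot γ z = eps γ * (w / eps γ / middleRoot γ z) := by
    field_simp
  have c1 := middleA_eps_mul hγ b1
  have c2 := middleB_eps_mul b1
  rw [← hv] at c1 c2
  refine ⟨hz, hz', ?_, ?_⟩
  · rw [a2, b2,
      show middleA γ (w / eps γ / middleRoot γ z) = -(eps γ * middleA γ (w / middleRoot γ z)) by
        rw [c1, neg_neg]]
    simp only [inv_div]
    field_simp
    ring
  · rw [a3, b3, c2]
    field_simp
    ring

end glue

/-! ### The form Φ in the side charts -/

/-- An integral of `dz / (z² w)` around `(1, 0)`. -/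
def sideAlpha (γ : ℕ) (u : ℂ) : ℂ :=
  ((γ : ℂ) + 1) / ((γ : ℂ) + 2) * (u * (1 + (1 + u ^ (γ + 1))) /
    ((1 + u ^ (γ + 1)) * sideRoot γ (1 + u ^ (γ + 1)))) + (γ : ℂ) / ((γ : ℂ) + 2) * sideA γ u

/-- An integral of `w dz / z²` around `(1, 0)`. -/
def sideBeta (γ : ℕ) (u : ℂ) : ℂ :=
  -(((γ : ℂ) + 1) / γ * (u ^ γ * sideRoot γ (1 + u ^ (γ + 1)) / (1 + u ^ (γ + 1)))) + 2 * sideB γ u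

/-- The integrals of the components of `Φ`, given integrals `a`, `b`, `d` of `dz / (z² w)`,
`w dz / z²` and `dz / z²`. -/
def phiVec (c : ℝ) (a b d : ℂ) : Fin 3 → ℂ :=
  ![I * (a - (c : ℂ) ^ 2 * b), -(a + (c : ℂ) ^ 2 * b), 2 * I * c * d]

/-- The integral of `Φ` in the parametrization `sideMap`. -/
def sidePrim (γ : ℕ) (s e : ℂ) (c : ℝ) (u : ℂ) : Fin 3 → ℂ :=
  phiVec c (s / e * sideAlpha γ u) (e * s * sideBeta γ u) (-(s * (1 + u ^ (γ + 1)))⁻¹)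

/-- The form `Φ` in the parametrization `sideMap`. -/
def sideForm (γ : ℕ) (s e : ℂ) (c : ℝ) (u : ℂ) : Fin 3 → ℂ :=
  phiVec c (s / e * (((γ : ℂ) + 1) / ((1 + u ^ (γ + 1)) ^ 2 * sideRoot γ (1 + u ^ (γ + 1)))))
    (e * s * (((γ : ℂ) + 1) * (u ^ γ) ^ 2 * sideRoot γ (1 + u ^ (γ + 1)) /
      (1 + u ^ (γ + 1)) ^ 2))
    (s * (((γ : ℂ) + 1) * u ^ γ) / (s * (1 + u ^ (γ + 1))) ^ 2)

section forms
variable {γ : ℕ} {s e : ℂ}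

theorem hasDerivAt_one_add_pow (u : ℂ) :
    HasDerivAt (fun u : ℂ => 1 + u ^ (γ + 1)) (((γ : ℂ) + 1) * u ^ γ) u := by
  have := (hasDerivAt_pow (γ + 1) u).const_add 1
  simpa using this

theorem hasDerivAt_sideRoot_comp {u : ℂ} (hu : u ∈ sideDomain γ) :
    HasDerivAt (fun u : ℂ => sideRoot γ (1 + u ^ (γ + 1)))
      (sideRoot γ (1 + u ^ (γ + 1)) * u ^ γ * (1 / (1 + u ^ (γ + 1)) +
        γ / (1 + (1 + u ^ (γ + 1))))) u := by
  refine (HasDerivAt.comp u (hasDerivAt_sideRoot (γ := γ) hu)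
    (hasDerivAt_one_add_pow (γ := γ) u)).congr_deriv ?_
  have := natCast_succ_ne_zero γ
  field_simp

/-- On the curve dz/(z²w) = (γ+1)/(γ+2) · d((z² − 1)/(zw)) + γ/(γ+2) · dz/w, and (z² − 1)/(zw)
becomes u(1 + z)/(z `sideRoot` z) in the chart. -/
theorem hasDerivAt_sideAlpha {u : ℂ} (hu : u ∈ sideDomain γ) :
    HasDerivAt (sideAlpha γ)
      (((γ : ℂ) + 1) / ((1 + u ^ (γ + 1)) ^ 2 * sideRoot γ (1 + u ^ (γ + 1)))) u := by
  have h1 := hasDerivAt_one_add_pow (γ := γ) u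
  have h2 := hasDerivAt_sideRoot_comp hu
  have hz0 : 1 + u ^ (γ + 1) ≠ 0 := slitPlane_ne_zero hu
  have hz1 : 1 + (1 + u ^ (γ + 1)) ≠ 0 :=
    slitPlane_ne_zero (one_add_mem_slitPlane (z := 1 + u ^ (γ + 1)) hu)
  have hE : sideRoot γ (1 + u ^ (γ + 1)) ≠ 0 := sideRoot_ne_zero hu
  have hn := natCast_succ_ne_zero γ
  have hn2 : (γ : ℂ) + 2 ≠ 0 := by exact_mod_cast Nat.succ_ne_zero (γ + 1)
  have h3 := ((((hasDerivAt_id u).mul (h1.const_add 1)).div (h1.mul h2)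
    (mul_ne_zero hz0 hE)).const_mul (((γ : ℂ) + 1) / ((γ : ℂ) + 2))).add
    ((hasDerivAt_sideA hu).const_mul ((γ : ℂ) / ((γ : ℂ) + 2)))
  refine h3.congr_deriv ?_
  have hz : u ^ γ * u = 1 + u ^ (γ + 1) - 1 := by rw [pow_succ]; ring
  simp only [Pi.mul_apply, id]
  generalize sideRoot γ (1 + u ^ (γ + 1)) = E at *
  generalize 1 + u ^ (γ + 1) = z at *
  have hz' : z = u ^ γ * u + 1 := by rw [hz]; ring
  field_simp
  rw [hz']
  ring

/-- On the curve w dz/z² = −(γ+1)/γ · d(w/z) + 2w dz/(z² − 1). -/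
theorem hasDerivAt_sideBeta (hγ : 0 < γ) {u : ℂ} (hu : u ∈ sideDomain γ) :
    HasDerivAt (sideBeta γ) (((γ : ℂ) + 1) * (u ^ γ) ^ 2 * sideRoot γ (1 + u ^ (γ + 1)) /
      (1 + u ^ (γ + 1)) ^ 2) u := by
  have h1 := hasDerivAt_one_add_pow (γ := γ) u
  have h2 := hasDerivAt_sideRoot_comp hu
  have hz0 : 1 + u ^ (γ + 1) ≠ 0 := slitPlane_ne_zero hu
  have hz1 : 1 + (1 + u ^ (γ + 1)) ≠ 0 :=
    slitPlane_ne_zero (one_add_mem_slitPlane (z := 1 + u ^ (γ + 1)) hu)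
  have hn := natCast_succ_ne_zero γ
  have hγ0 : (γ : ℂ) ≠ 0 := by exact_mod_cast hγ.ne'
  have h3 := (((((hasDerivAt_pow γ u).mul h2).div h1 hz0).const_mul
    (((γ : ℂ) + 1) / γ)).neg).add ((hasDerivAt_sideB hu).const_mul 2)
  refine h3.congr_deriv ?_
  have hz : u ^ (γ - 1) * u * u = 1 + u ^ (γ + 1) - 1 := by
    rw [pow_sub_one_mul hγ.ne', pow_succ]; ring
  have hp : u ^ γ = u ^ (γ - 1) * u := (pow_sub_one_mul hγ.ne' u).symm
  simp only [Pi.mul_apply]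
  rw [hp]
  generalize sideRoot γ (1 + u ^ (γ + 1)) = E at *
  generalize 1 + u ^ (γ + 1) = z at *
  have hz' : z = u ^ (γ - 1) * u * u + 1 := by rw [hz]; ring
  field_simp
  rw [hz']
  ring

theorem hasDerivAt_phiVec {c : ℝ} {a b d : ℂ → ℂ} {a' b' d' u : ℂ} (ha : HasDerivAt a a' u)
    (hb : HasDerivAt b b' u) (hd : HasDerivAt d d' u) (j : Fin 3) :
    HasDerivAt (fun u => phiVec c (a u) (b u) (d u) j) (phiVec c a' b' d' j) u := by
  fin_cases j
  · exact (ha.sub (hb.const_mul ((c : ℂ) ^ 2))).const_mul I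
  · exact (ha.add (hb.const_mul ((c : ℂ) ^ 2))).neg
  · exact hd.const_mul (2 * I * (c : ℂ))

/-- For z = sx and w = ey with s² = 1, the forms α and β in (z, w) are s/e and es times those in (x,
y), and dz/z² = d(−1/z). -/
theorem hasDerivAt_sidePrim (hγ : 0 < γ) (hs : s ≠ 0) {c : ℝ} {u : ℂ} (hu : u ∈ sideDomain γ)
    (j : Fin 3) : HasDerivAt (fun u => sidePrim γ s e c u j) (sideForm γ s e c u j) u := by
  refine hasDerivAt_phiVec ((hasDerivAt_sideAlpha hu).const_mul _)
    ((hasDerivAt_sideBeta hγ hu).const_mul _) ?_ j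
  have hz0 : s * (1 + u ^ (γ + 1)) ≠ 0 := mul_ne_zero hs (slitPlane_ne_zero hu)
  refine (((hasDerivAt_one_add_pow u).const_mul s).inv hz0).neg.congr_deriv ?_
  ring

theorem continuousOn_sideForm (hs : s ≠ 0) (c : ℝ) (j : Fin 3) :
    ContinuousOn (fun u => sideForm γ s e c u j) (sideDomain γ) := by
  have hE : ContinuousOn (fun u : ℂ => sideRoot γ (1 + u ^ (γ + 1))) (sideDomain γ) :=
    fun u hu => (analyticAt_sideRoot_comp hu).continuousAt.continuousWithinAt
  have hE0 : ∀ u ∈ sideDomain γ, sideRoot γ (1 + u ^ (γ + 1)) ≠ 0 := fun u hu => sideRoot_ne_zero hu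
  have hz0 : ∀ u ∈ sideDomain γ, 1 + u ^ (γ + 1) ≠ 0 := fun u hu => slitPlane_ne_zero hu
  have h1 : ContinuousOn (fun u : ℂ => s / e * (((γ : ℂ) + 1) /
      ((1 + u ^ (γ + 1)) ^ 2 * sideRoot γ (1 + u ^ (γ + 1))))) (sideDomain γ) :=
    continuousOn_const.mul (continuousOn_const.div ((by fun_prop : Continuous fun u : ℂ =>
      (1 + u ^ (γ + 1)) ^ 2).continuousOn.mul hE)
      fun u hu => mul_ne_zero (pow_ne_zero _ (hz0 u hu)) (hE0 u hu))
  have h2 : ContinuousOn (fun u : ℂ => e * s * (((γ : ℂ) + 1) * (u ^ γ) ^ 2 *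
      sideRoot γ (1 + u ^ (γ + 1)) / (1 + u ^ (γ + 1)) ^ 2)) (sideDomain γ) :=
    continuousOn_const.mul (((by fun_prop : Continuous fun u : ℂ =>
      ((γ : ℂ) + 1) * (u ^ γ) ^ 2).continuousOn.mul hE).div
      (by fun_prop) fun u hu => pow_ne_zero _ (hz0 u hu))
  have h3 : ContinuousOn (fun u : ℂ => s * (((γ : ℂ) + 1) * u ^ γ) /
      (s * (1 + u ^ (γ + 1))) ^ 2) (sideDomain γ) :=
    ContinuousOn.div (by fun_prop) (by fun_prop)
      fun u hu => pow_ne_zero _ (mul_ne_zero hs (hz0 u hu))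
  fin_cases j
  · exact continuousOn_const.mul (h1.sub (continuousOn_const.mul h2))
  · exact (h1.add (continuousOn_const.mul h2)).neg
  · exact continuousOn_const.mul h3

/-- Away from the branch point, `Φ` pulls back to `sideForm`. -/
theorem phiCoeff_mul (he : e ≠ 0) (hs : s ^ 2 = 1) (c : ℝ) {u : ℂ} (hu : u ∈ sideDomain γ)
    (hu0 : u ≠ 0) (j : Fin 3) :
    PhiCoeff c (sideMap γ s e u) j * (s * (((γ : ℂ) + 1) * u ^ γ)) = sideForm γ s e c u j := by
  have hs0 : s ≠ 0 := by rintro rfl; simp at hs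
  have hz0 : 1 + u ^ (γ + 1) ≠ 0 := slitPlane_ne_zero hu
  have hE : sideRoot γ (1 + u ^ (γ + 1)) ≠ 0 := sideRoot_ne_zero hu
  have hz : zCoord (sideMap γ s e u) = s * (1 + u ^ (γ + 1)) := rfl
  have hw : wCoord (sideMap γ s e u) = e * (u ^ γ * sideRoot γ (1 + u ^ (γ + 1))) := rfl
  have hp : u ^ γ ≠ 0 := pow_ne_zero _ hu0
  rw [sideForm]
  generalize sideRoot γ (1 + u ^ (γ + 1)) = E at *
  generalize 1 + u ^ (γ + 1) = z at *
  have hzs : (s * z) ^ 2 = z ^ 2 := by rw [mul_pow, hs, one_mul]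
  fin_cases j
  · change (1 - ((c : ℂ) * wCoord _) ^ 2) * (I / (zCoord _ ^ 2 * wCoord _)) * _ = I * (_ - _)
    rw [hz, hw, hzs]
    field_simp
  · change I * (1 + ((c : ℂ) * wCoord _) ^ 2) * (I / (zCoord _ ^ 2 * wCoord _)) * _ = -(_ + _)
    rw [hz, hw, hzs]
    field_simp
    rw [I_sq]
    ring
  · change 2 * ((c : ℂ) * wCoord _) * (I / (zCoord _ ^ 2 * wCoord _)) * _ = 2 * I * c * _
    rw [hz, hw, hzs]
    field_simp

end forms

/-! ### Integrals of Φ along piecewise C¹ paths -/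

section increments
variable {γ : ℕ} {s e : ℂ}

/-- The integrand of the integral of a component of `Φ` along `p`. -/
def phiIntegrand (c : ℝ) (p : ℝ → OnePoint ℂ × OnePoint ℂ) (j : Fin 3) (r : ℝ) : ℂ :=
  PhiCoeff c (p r) j * deriv (fun r => zCoord (p r)) r

/-- Integration of `Φ` along a `C¹` path inside one parametrization. -/
theorem integral_phi_side (hγ : 0 < γ) (he : e ≠ 0) (hs : s ^ 2 = 1) {a b : ℝ} (hab : a < b)
    {p : ℝ → OnePoint ℂ × OnePoint ℂ} {u : ℝ → ℂ} (hu : ContDiffOn ℝ 1 u (Icc a b))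
    (huU : ∀ r ∈ Icc a b, u r ∈ sideDomain γ) (hp : ∀ r ∈ Icc a b, p r = sideMap γ s e (u r))
    (c : ℝ) (j : Fin 3) :
    IntervalIntegrable (phiIntegrand c p j) volume a b ∧
    ∫ r in a..b, phiIntegrand c p j r = sidePrim γ s e c (u b) j - sidePrim γ s e c (u a) j := by
  have hs0 : s ≠ 0 := by rintro rfl; simp at hs
  set f' : ℝ → ℂ := fun r => sideForm γ s e c (u r) j * derivWithin u (Icc a b) r with hf'
  have hder : ∀ r ∈ Ioo a b, HasDerivAt u (derivWithin u (Icc a b) r) r := fun r hr => by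
    have h1 : Icc a b ∈ 𝓝 r := Icc_mem_nhds hr.1 hr.2
    exact ((hu.differentiableOn one_ne_zero r
      (Ioo_subset_Icc_self hr)).hasDerivWithinAt).hasDerivAt h1
  have hcont' : ContinuousOn f' (Icc a b) :=
    ((continuousOn_sideForm hs0 c j).comp hu.continuousOn huU).mul
      (hu.continuousOn_derivWithin (uniqueDiffOn_Icc hab) le_rfl)
  have hint : IntervalIntegrable f' volume a b := by
    refine ContinuousOn.intervalIntegrable ?_
    rwa [uIcc_of_le hab.le]
  have hprim : ∀ v ∈ sideDomain γ, ContinuousAt (fun v => sidePrim γ s e c v j) v :=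
    fun v hv => (hasDerivAt_sidePrim hγ hs0 hv j).continuousAt
  have hFTC := intervalIntegral.integral_eq_sub_of_hasDerivAt_of_le
    (f := fun r => sidePrim γ s e c (u r) j) (f' := f') hab.le
    (fun r hr => ContinuousAt.comp_continuousWithinAt
      (g := fun v => sidePrim γ s e c v j) (hprim _ (huU r hr)) (hu.continuousOn r hr))
    (fun r hr => (hasDerivAt_sidePrim hγ hs0 (huU r (Ioo_subset_Icc_self hr)) j).comp r (hder r hr))
    hint
  -- Where u = 0 the coefficient of dz divides by w = 0 and takes a default value. This is harmless
  -- if the velocity of u vanishes too, and otherwise happens only on a countable set.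
  have hae : ∀ᵐ r, r ∈ uIoc a b → f' r = phiIntegrand c p j r := by
    have hc := (countable_simple_zeros u (derivWithin u (Icc a b)) (Ioo a b) hder).ae_notMem volume
    have hb : ∀ᵐ r : ℝ, r ≠ b := by simp [ae_iff, measure_singleton]
    filter_upwards [hc, hb] with r hr hrb hrab
    rw [uIoc_of_le hab.le] at hrab
    have hrI : r ∈ Ioo a b := ⟨hrab.1, lt_of_le_of_ne hrab.2 hrb⟩
    have hrC := Ioo_subset_Icc_self hrI
    have hz : (fun r => zCoord (p r)) =ᶠ[𝓝 r] fun r => s * (1 + u r ^ (γ + 1)) := by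
      filter_upwards [Icc_mem_nhds hrI.1 hrI.2] with x hx
      rw [hp x hx]
      rfl
    have hd : deriv (fun r => zCoord (p r)) r =
        s * (((γ : ℂ) + 1) * u r ^ γ) * derivWithin u (Icc a b) r := by
      rw [hz.deriv_eq]
      refine HasDerivAt.deriv ?_
      rw [mul_assoc]
      exact ((hasDerivAt_one_add_pow (γ := γ) (u r)).comp r (hder r hrI)).const_mul s
    simp only [phiIntegrand, hf', hd, hp r hrC, ← mul_assoc]
    by_cases h0 : u r = 0
    · have : derivWithin u (Icc a b) r = 0 := by
        by_contra hne
        exact hr ⟨hrI, h0, hne⟩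
      rw [this, mul_zero, mul_zero]
    · rw [← phiCoeff_mul he hs c (huU r hrC) h0 j]
      ring
  refine ⟨hint.congr_ae ((ae_restrict_iff' measurableSet_uIoc).2 hae), ?_⟩
  rw [← hFTC]
  exact (intervalIntegral.integral_congr_ae hae).symm

theorem eventually_uIcc_subset {J V : Set ℝ} (hJ : OrdConnected J) {x : ℝ} (hx : x ∈ J)
    (hV : V ∈ 𝓝[J] x) : ∀ᶠ y in 𝓝[J] x, uIcc x y ⊆ V := by
  obtain ⟨δ, hδ, hsub⟩ := Metric.mem_nhdsWithin_iff.1 hV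
  filter_upwards [self_mem_nhdsWithin, mem_nhdsWithin_of_mem_nhds (Metric.ball_mem_nhds x hδ)]
    with y hyJ hyb
  refine fun r hr => hsub ⟨?_, hJ.uIcc_subset hx hyJ hr⟩
  rw [Real.ball_eq_Ioo] at hyb ⊢
  exact ordConnected_Ioo.uIcc_subset (by constructor <;> linarith) hyb hr

theorem mem_puncturedCurve_iff {q : OnePoint ℂ × OnePoint ℂ} : q ∈ puncturedCurve γ ↔
    ∃ z w : ℂ, q = ((z : OnePoint ℂ), (w : OnePoint ℂ)) ∧ z ≠ 0 ∧
      w ^ (γ + 1) = z * (z ^ 2 - 1) ^ γ := by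
  constructor
  · rintro ⟨⟨z, w, rfl, h⟩ | rfl, h2⟩
    · refine ⟨z, w, rfl, ?_, h⟩
      rintro rfl
      rw [zero_mul] at h
      rw [eq_zero_of_pow_eq_zero h] at h2
      exact h2 (Or.inl rfl)
    · exact absurd (Or.inr rfl) h2
  · rintro ⟨z, w, rfl, hz, h⟩
    refine ⟨Or.inl ⟨z, w, rfl, h⟩, ?_⟩
    rintro (h | h)
    · have := congrArg Prod.fst h
      exact hz (OnePoint.coe_injective this)
    · exact OnePoint.coe_ne_infty _ (congrArg Prod.fst h)

/-- The two pairs `(s, e)` whose parametrizations `sideMap` cover the punctured curve. -/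
def IsSide (γ : ℕ) (s e : ℂ) : Prop := (s = 1 ∧ e = 1) ∨ (s = -1 ∧ e = eps γ)

theorem IsSide.sq (h : IsSide γ s e) : s ^ 2 = 1 := by
  rcases h with ⟨rfl, rfl⟩ | ⟨rfl, rfl⟩ <;> norm_num

theorem IsSide.pow (h : IsSide γ s e) : e ^ (γ + 1) = s := by
  rcases h with ⟨rfl, rfl⟩ | ⟨rfl, rfl⟩
  · exact one_pow _
  · exact eps_pow γ

theorem IsSide.ne_zero_left (h : IsSide γ s e) : s ≠ 0 := by
  rcases h with ⟨rfl, rfl⟩ | ⟨rfl, rfl⟩ <;> norm_num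

theorem IsSide.ne_zero_right (h : IsSide γ s e) : e ≠ 0 := by
  rcases h with ⟨rfl, rfl⟩ | ⟨rfl, rfl⟩
  · exact one_ne_zero
  · exact eps_ne_zero γ

theorem exists_isSide {z : ℂ} (hz : z ≠ 0) : ∃ s e, IsSide γ s e ∧ s * z ∈ slitPlane := by
  by_cases h : z ∈ slitPlane
  · exact ⟨1, 1, Or.inl ⟨rfl, rfl⟩, by rwa [one_mul]⟩
  · refine ⟨-1, eps γ, Or.inr ⟨rfl, rfl⟩, ?_⟩
    rw [mem_slitPlane_iff, not_or, not_lt, not_not] at h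
    rw [mem_slitPlane_iff]
    left
    have : z.re ≠ 0 := fun h0 => hz (Complex.ext h0 h.2)
    simp only [neg_mul, one_mul, neg_re]
    have := lt_of_le_of_ne h.1 this
    linarith

theorem IsSide.sideMap_mem_puncturedCurve (h : IsSide γ s e) {u : ℂ} (hu : u ∈ sideDomain γ) :
    sideMap γ s e u ∈ puncturedCurve γ :=
  mem_puncturedCurve_iff.2 ⟨_, _, rfl, mul_ne_zero h.ne_zero_left (slitPlane_ne_zero hu),
    mem_compactCurve_coe.1 (sideMap_mem h.sq h.pow u)⟩

theorem exists_sideMap_eq (hγ : 0 < γ) {q : OnePoint ℂ × OnePoint ℂ} (hq : q ∈ puncturedCurve γ) :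
    ∃ s e u, IsSide γ s e ∧ u ∈ sideDomain γ ∧ sideMap γ s e u = q := by
  obtain ⟨z, w, rfl, hz, hzw⟩ := mem_puncturedCurve_iff.1 hq
  obtain ⟨s, e, hse, hsz⟩ := exists_isSide (γ := γ) hz
  obtain ⟨h1, h2⟩ := exists_side_coord hse.sq hse.pow hzw hsz hγ
  refine ⟨s, e, _, hse, ?_, h2⟩
  simp only [sideDomain, mem_ofPred_eq, h1, add_sub_cancel]
  exact hsz

/-- A local parametrization of the punctured curve factors through some `sideMap`. -/
theorem LocalParam.exists_isSide_factor (hγ : 0 < γ) (P : LocalParam γ) {t : ℂ} (ht : t ∈ P.U)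
    (h : P.φ t ∈ puncturedCurve γ) : ∃ s e, IsSide γ s e ∧
    ∃ k : ℂ → ℂ, AnalyticAt ℂ k t ∧ deriv k t ≠ 0 ∧
      ∀ᶠ r in 𝓝 t, k r ∈ sideDomain γ ∧ P.φ r = sideMap γ s e (k r) := by
  obtain ⟨z, w, hq, hz, hzw⟩ := mem_puncturedCurve_iff.1 h
  obtain ⟨s, e, hse, hsz⟩ := exists_isSide (γ := γ) hz
  obtain ⟨k, hk, hkU, hkφ⟩ := P.exists_side_factor hγ hse.sq hse.pow ht hq hsz
  exact ⟨s, e, hse, k, hk, P.deriv_ne_zero ht hk hkφ,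
    (hk.continuousAt.eventually_mem (isOpen_sideDomain.mem_nhds hkU)).and hkφ⟩

/-- If `X` restricts to the real part of `sidePrim` in all parametrizations, then it is an integral
of the real part of `Φ` along paths. -/
theorem rePhiIntegral_eq_sub (hγ : 0 < γ) (c : ℝ) {X : OnePoint ℂ × OnePoint ℂ → Fin 3 → ℝ}
    (hX : ∀ s e, IsSide γ s e → ∀ u ∈ sideDomain γ, ∀ j,
      X (sideMap γ s e u) j = (sidePrim γ s e c u j).re)
    {p : ℝ → OnePoint ℂ × OnePoint ℂ} (hp : IsPiecewiseC1Path γ p) :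
    rePhiIntegral c p = WithLp.toLp 2 (X (p 1) - X (p 0)) := by
  -- The relation "the increment of `X` from a to b is the integral" is symmetric and transitive and
  -- holds locally on each side of every parameter, so connectedness of [0, 1] gives it for 0 and 1.
  set Q : ℝ → ℝ → Prop := fun a b => ∀ j, IntervalIntegrable (phiIntegrand c p j) volume a b ∧
    (∫ r in a..b, phiIntegrand c p j r).re = X (p b) j - X (p a) j
  have hsymm : ∀ a b, Q a b → Q b a := fun a b h j => ⟨(h j).1.symm, by
    rw [intervalIntegral.integral_symm, neg_re, (h j).2]; ring⟩
  have htrans : ∀ a b d, Q a b → Q b d → Q a d := fun a b d h h' j =>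
    ⟨(h j).1.trans (h' j).1, by
      rw [← intervalIntegral.integral_add_adjacent_intervals (h j).1 (h' j).1, add_re, (h j).2,
        (h' j).2]
      ring⟩
  have hside : ∀ x ∈ Icc (0 : ℝ) 1, ∀ J : Set ℝ, OrdConnected J → x ∈ J → IsC1At γ p J x →
      ∀ᶠ y in 𝓝[J] x, Q x y := by
    rintro x hx J hJ hxJ ⟨P, τ, hτ, hPτ⟩
    have hxU := hPτ.self_of_nhdsWithin hxJ
    obtain ⟨s, e, hse, k, hk, -, hkφ⟩ := P.exists_isSide_factor hγ hxU.1 (hxU.2 ▸ hp.1 x hx)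
    have hu : ContDiffWithinAt ℝ 1 (fun r => k (τ r)) J x :=
      ContDiffAt.comp_contDiffWithinAt (g := k) x
        ((hk.contDiffAt (n := 1)).restrict_scalars ℝ) hτ
    obtain ⟨V, hV, -, hVu⟩ := hu.contDiffOn (m := 1) le_rfl (by simp)
    rw [insert_eq_of_mem hxJ] at hV
    have hgood := hτ.continuousWithinAt.eventually hkφ
    filter_upwards [eventually_uIcc_subset hJ hxJ (inter_mem hV (inter_mem hPτ hgood))] with y hy j
    have key : ∀ a b, a < b → uIcc a b = uIcc x y →
        IntervalIntegrable (phiIntegrand c p j) volume a b ∧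
        (∫ r in a..b, phiIntegrand c p j r).re = X (p b) j - X (p a) j := by
      intro a b hab huab
      have hsub : ∀ r ∈ Icc a b, k (τ r) ∈ sideDomain γ ∧ p r = sideMap γ s e (k (τ r)) := by
        intro r hr
        rw [← uIcc_of_le hab.le, huab] at hr
        have h := hy hr
        exact ⟨h.2.2.1, h.2.1.2.trans h.2.2.2⟩
      have h1 := integral_phi_side hγ hse.ne_zero_right hse.sq hab (u := fun r => k (τ r)) (p := p)
        (hVu.mono (by rw [← uIcc_of_le hab.le, huab]; exact fun r hr => (hy hr).1))
        (fun r hr => (hsub r hr).1) (fun r hr => (hsub r hr).2) c j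
      refine ⟨h1.1, ?_⟩
      have ha := hsub a (left_mem_Icc.2 hab.le)
      have hb := hsub b (right_mem_Icc.2 hab.le)
      rw [h1.2, sub_re, ha.2, hb.2, hX s e hse _ ha.1, hX s e hse _ hb.1]
    rcases lt_trichotomy x y with hxy | rfl | hxy
    · exact key x y hxy rfl
    · simp
    · obtain ⟨h1, h2⟩ := key y x hxy (uIcc_comm _ _)
      exact ⟨h1.symm, by rw [intervalIntegral.integral_symm, neg_re, h2]; ring⟩
  have hQ : Q 0 1 := by
    refine isPreconnected_Icc.induction₂ Q (fun x hx => ?_) (fun a b d _ _ _ => htrans a b d)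
      (fun a b _ _ => hsymm a b) (left_mem_Icc.2 zero_le_one) (right_mem_Icc.2 zero_le_one)
    rw [← Icc_union_Icc_eq_Icc hx.1 hx.2, nhdsWithin_union, eventually_sup]
    exact ⟨hside x hx _ ordConnected_Icc (right_mem_Icc.2 hx.1) (hp.2 x hx).1,
      hside x hx _ ordConnected_Icc (left_mem_Icc.2 hx.2) (hp.2 x hx).2⟩
  rw [rePhiIntegral]
  congr 1
  ext j
  exact (hQ j).2

end increments

/-! ### Joining points by paths with known integral -/

section paths
variable {γ : ℕ} {s e : ℂ}

theorem IsC1At.comp_affine {p p' : ℝ → OnePoint ℂ × OnePoint ℂ} {I J : Set ℝ} {x m k : ℝ}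
    (h : IsC1At γ p I (m * x + k))
    (hJ : ∀ᶠ r in 𝓝[J] x, m * r + k ∈ I ∧ p' r = p (m * r + k)) : IsC1At γ p' J x := by
  obtain ⟨P, τ, hτ, hP⟩ := h
  have hg : ContDiffWithinAt ℝ 1 (fun r : ℝ => m * r + k) J x := by fun_prop
  have hI : ∀ᶠ r in 𝓝[J] x, m * r + k ∈ I := hJ.mono fun r hr => hr.1
  have ht : Tendsto (fun r : ℝ => m * r + k) (𝓝[J] x) (𝓝[I] (m * x + k)) :=
    tendsto_nhdsWithin_iff.2 ⟨hg.continuousWithinAt, hI⟩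
  refine ⟨P, fun r => τ (m * r + k), ContDiffWithinAt.comp_of_preimage_mem_nhdsWithin
    (g := τ) (t := I) x hτ hg hI, ?_⟩
  filter_upwards [ht.eventually hP, hJ] with r hr hr'
  exact ⟨hr.1, hr'.2.trans hr.2⟩

/-- There is a path from `q` to `q'` along which the integral of `Φ` is `v c`. -/
def JoinedBy (γ : ℕ) (q q' : OnePoint ℂ × OnePoint ℂ) (v : ℝ → Fin 3 → ℂ) : Prop :=
  ∃ p, IsPiecewiseC1Path γ p ∧ p 0 = q ∧ p 1 = q' ∧ ∀ c j,
    IntervalIntegrable (phiIntegrand c p j) volume 0 1 ∧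
      ∫ r in (0 : ℝ)..1, phiIntegrand c p j r = v c j

theorem JoinedBy.symm {q q' : OnePoint ℂ × OnePoint ℂ} {v : ℝ → Fin 3 → ℂ}
    (h : JoinedBy γ q q' v) : JoinedBy γ q' q (-v) := by
  obtain ⟨p, hp, h0, h1, hv⟩ := h
  have hI : ∀ c j, phiIntegrand c (fun r => p (1 - r)) j =
      fun r => -phiIntegrand c p j (1 - r) := by
    intro c j
    ext r
    simp only [phiIntegrand]
    rw [deriv_comp_const_sub (f := fun r => zCoord (p r))]
    ring
  refine ⟨fun r => p (1 - r), ⟨fun x hx => hp.1 _ ⟨by linarith [hx.2], by linarith [hx.1]⟩,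
    fun x hx => ?_⟩, by simpa using h1, by simpa using h0, fun c j => ?_⟩
  · have hx' : 1 - x ∈ Icc (0 : ℝ) 1 := ⟨by linarith [hx.2], by linarith [hx.1]⟩
    obtain ⟨h2, h3⟩ := hp.2 _ hx'
    rw [show 1 - x = (-1) * x + 1 by ring] at h2 h3
    constructor
    · refine h3.comp_affine ?_
      filter_upwards [self_mem_nhdsWithin] with r hr
      exact ⟨⟨by linarith [hr.2], by linarith [hr.1]⟩, by congr 1; ring⟩
    · refine h2.comp_affine ?_
      filter_upwards [self_mem_nhdsWithin] with r hr
      exact ⟨⟨by linarith [hr.2], by linarith [hr.1]⟩, by congr 1; ring⟩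
  · obtain ⟨h2, h3⟩ := hv c j
    rw [hI]
    constructor
    · have := (h2.comp_sub_left 1).symm
      simp only [sub_zero, sub_self] at this
      exact this.neg
    · rw [intervalIntegral.integral_neg, intervalIntegral.integral_comp_sub_left
        (f := fun r => phiIntegrand c p j r)]
      simp [h3]

theorem JoinedBy.trans {q q' q'' : OnePoint ℂ × OnePoint ℂ} {v v' : ℝ → Fin 3 → ℂ}
    (h : JoinedBy γ q q' v) (h' : JoinedBy γ q' q'' v') : JoinedBy γ q q'' (v + v') := by
  obtain ⟨p, hp, h0, h1, hv⟩ := h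
  obtain ⟨p', hp', h0', h1', hv'⟩ := h'
  set P : ℝ → OnePoint ℂ × OnePoint ℂ := fun r => if r ≤ 1 / 2 then p (2 * r) else p' (2 * r - 1)
    with hP
  have hP1 : ∀ r ≤ 1 / 2, P r = p (2 * r) := fun r hr => if_pos hr
  have hP2 : ∀ r, 1 / 2 ≤ r → P r = p' (2 * r - 1) := by
    intro r hr
    rcases hr.eq_or_lt with rfl | hr
    · rw [hP1 _ le_rfl]
      norm_num
      rw [h1, h0']
    · exact if_neg (not_le.2 hr)
  have hI1 : ∀ c j, ∀ r, r < 1 / 2 → phiIntegrand c P j r = 2 * phiIntegrand c p j (2 * r) := by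
    intro c j r hr
    have hev : (fun r => zCoord (P r)) =ᶠ[𝓝 r] fun r => zCoord (p (2 * r)) := by
      filter_upwards [Iio_mem_nhds hr] with x hx
      rw [hP1 x (le_of_lt hx)]
    simp only [phiIntegrand]
    rw [hev.deriv_eq, deriv_comp_mul_left (f := fun r => zCoord (p r)), hP1 r hr.le, real_smul]
    push_cast
    ring
  have hI2 : ∀ c j, ∀ r, 1 / 2 < r →
      phiIntegrand c P j r = 2 * phiIntegrand c p' j (2 * r - 1) := by
    intro c j r hr
    have hev : (fun r => zCoord (P r)) =ᶠ[𝓝 r] fun r => zCoord (p' (2 * r - 1)) := by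
      filter_upwards [Ioi_mem_nhds hr] with x hx
      rw [hP2 x (le_of_lt hx)]
    simp only [phiIntegrand]
    rw [hev.deriv_eq, deriv_comp_mul_left (f := fun r => zCoord (p' (r - 1))),
      deriv_comp_sub_const (f := fun r => zCoord (p' r)), hP2 r hr.le, real_smul]
    push_cast
    ring
  refine ⟨P, ⟨fun x hx => ?_, fun x hx => ?_⟩, ?_, ?_, fun c j => ?_⟩
  · rcases le_total x (1 / 2) with h | h
    · rw [hP1 x h]
      exact hp.1 _ ⟨by linarith [hx.1], by linarith⟩
    · rw [hP2 x h]
      exact hp'.1 _ ⟨by linarith, by linarith [hx.2]⟩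
  · have left1 : x ≤ 1 / 2 → IsC1At γ P (Icc 0 x) x := fun h => by
      have := (hp.2 (2 * x) ⟨by linarith [hx.1], by linarith⟩).1
      rw [show 2 * x = 2 * x + 0 by ring] at this
      refine this.comp_affine ?_
      filter_upwards [self_mem_nhdsWithin] with r hr
      refine ⟨⟨by linarith [hr.1], by linarith [hr.2]⟩, ?_⟩
      rw [hP1 r (hr.2.trans h), add_zero]
    have left2 : 1 / 2 < x → IsC1At γ P (Icc 0 x) x := fun h => by
      have := (hp'.2 (2 * x - 1) ⟨by linarith, by linarith [hx.2]⟩).1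
      rw [show 2 * x - 1 = 2 * x + (-1) by ring] at this
      refine this.comp_affine ?_
      filter_upwards [self_mem_nhdsWithin, mem_nhdsWithin_of_mem_nhds (Ioi_mem_nhds h)]
        with r hr hr2
      refine ⟨⟨by linarith [mem_Ioi.1 hr2], by linarith [hr.2]⟩, ?_⟩
      rw [hP2 r (mem_Ioi.1 hr2).le, ← sub_eq_add_neg]
    have right1 : x < 1 / 2 → IsC1At γ P (Icc x 1) x := fun h => by
      have := (hp.2 (2 * x) ⟨by linarith [hx.1], by linarith⟩).2
      rw [show 2 * x = 2 * x + 0 by ring] at this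
      refine this.comp_affine ?_
      filter_upwards [self_mem_nhdsWithin, mem_nhdsWithin_of_mem_nhds (Iio_mem_nhds h)]
        with r hr hr2
      refine ⟨⟨by linarith [hr.1], by linarith [mem_Iio.1 hr2]⟩, ?_⟩
      rw [hP1 r (mem_Iio.1 hr2).le, add_zero]
    have right2 : 1 / 2 ≤ x → IsC1At γ P (Icc x 1) x := fun h => by
      have := (hp'.2 (2 * x - 1) ⟨by linarith, by linarith [hx.2]⟩).2
      rw [show 2 * x - 1 = 2 * x + (-1) by ring] at this
      refine this.comp_affine ?_
      filter_upwards [self_mem_nhdsWithin] with r hr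
      refine ⟨⟨by linarith [hr.1], by linarith [hr.2]⟩, ?_⟩
      rw [hP2 r (h.trans hr.1), ← sub_eq_add_neg]
    exact ⟨(le_or_gt x (1 / 2)).elim left1 left2, (lt_or_ge x (1 / 2)).elim right1 right2⟩
  · rw [hP1 0 (by norm_num), mul_zero, h0]
  · rw [hP2 1 (by norm_num)]
    norm_num
    exact h1'
  · obtain ⟨i1, e1⟩ := hv c j
    obtain ⟨i2, e2⟩ := hv' c j
    -- The derivative at the junction need not exist, but a single parameter does not affect the
    -- integral.
    have hne : ∀ᵐ r : ℝ, r ≠ 1 / 2 := by simp [ae_iff, measure_singleton]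
    have a1 : ∀ᵐ r : ℝ, r ∈ uIoc 0 (1 / 2) → 2 * phiIntegrand c p j (2 * r) =
        phiIntegrand c P j r := by
      filter_upwards [hne] with r hr hr2
      rw [uIoc_of_le (by norm_num)] at hr2
      exact (hI1 c j r (lt_of_le_of_ne hr2.2 hr)).symm
    have a2 : ∀ᵐ r : ℝ, r ∈ uIoc (1 / 2) 1 → 2 * phiIntegrand c p' j (2 * r - 1) =
        phiIntegrand c P j r := by
      refine Eventually.of_forall fun r hr2 => ?_
      rw [uIoc_of_le (by norm_num)] at hr2
      exact (hI2 c j r hr2.1).symm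
    have b1 : IntervalIntegrable (fun r => 2 * phiIntegrand c p j (2 * r)) volume 0 (1 / 2) := by
      have := i1.comp_mul_left (c := 2)
      rw [zero_div] at this
      exact this.const_mul 2
    have b2 : IntervalIntegrable (fun r => 2 * phiIntegrand c p' j (2 * r - 1))
        volume (1 / 2) 1 := by
      have := (i2.comp_sub_right 1).comp_mul_left (c := 2)
      norm_num at this
      exact this.const_mul 2
    have c1 := b1.congr_ae ((ae_restrict_iff' measurableSet_uIoc).2 a1)
    have c2 := b2.congr_ae ((ae_restrict_iff' measurableSet_uIoc).2 a2)
    refine ⟨c1.trans c2, ?_⟩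
    rw [← intervalIntegral.integral_add_adjacent_intervals c1 c2,
      ← intervalIntegral.integral_congr_ae a1, ← intervalIntegral.integral_congr_ae a2,
      intervalIntegral.integral_const_mul, intervalIntegral.integral_const_mul,
      intervalIntegral.integral_comp_mul_left (f := fun r => phiIntegrand c p j r) (by norm_num),
      intervalIntegral.integral_comp_mul_sub (f := fun r => phiIntegrand c p' j r) (by norm_num)]
    norm_num
    rw [e1, e2]
    ring

/-- The chart domain is star-shaped, so the ray from its centre stays inside it. -/
theorem joinedBy_ray (hγ : 0 < γ) (hse : IsSide γ s e) {u : ℂ} (hu : u ∈ sideDomain γ) :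
    JoinedBy γ (sideMap γ s e 0) (sideMap γ s e u)
      (fun c j => sidePrim γ s e c u j - sidePrim γ s e c 0 j) := by
  have hU : ∀ r ∈ Icc (0 : ℝ) 1, (r : ℂ) * u ∈ sideDomain γ := fun r hr => by
    have := (starConvex_zero_iff.1 starConvex_sideDomain) hu hr.1 hr.2
    rwa [real_smul] at this
  have hd : ContDiff ℝ 1 fun r : ℝ => (r : ℂ) * u := ofRealCLM.contDiff.mul contDiff_const
  have hC : ∀ x : ℝ, ∀ J : Set ℝ, J ⊆ Icc 0 1 →
      IsC1At γ (fun r : ℝ => sideMap γ s e (r * u)) J x := fun x J hJ =>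
    ⟨sideParam γ s e hse.sq hse.pow, fun r => r * u, hd.contDiffWithinAt, by
      filter_upwards [self_mem_nhdsWithin] with r hr
      exact ⟨hU r (hJ hr), rfl⟩⟩
  refine ⟨fun r => sideMap γ s e (r * u), ⟨fun x hx => hse.sideMap_mem_puncturedCurve (hU x hx),
    fun x hx => ⟨hC x _ (Icc_subset_Icc_right hx.2), hC x _ (Icc_subset_Icc_left hx.1)⟩⟩, by simp,
    by simp, fun c j => ?_⟩
  have := integral_phi_side hγ hse.ne_zero_right hse.sq zero_lt_one hd.contDiffOn hU
    (fun r _ => rfl) c j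
  simpa using this

theorem JoinedBy.congr {q q' : OnePoint ℂ × OnePoint ℂ} {v v' : ℝ → Fin 3 → ℂ}
    (h : JoinedBy γ q q' v) (hv : ∀ c j, v c j = v' c j) : JoinedBy γ q q' v' := by
  rwa [show v = v' from funext fun c => funext fun j => hv c j] at h

end paths

/-! ### The jumps of ∫α and ∫β between the two side charts -/

section periods
variable {γ : ℕ} {s e : ℂ}

theorem exists_side_preimage (hγ : 0 < γ) (hse : IsSide γ s e) {z w : ℂ}
    (hzw : w ^ (γ + 1) = z * (z ^ 2 - 1) ^ γ) (hz : s * z ∈ slitPlane) :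
    ∃ u ∈ sideDomain γ, sideMap γ s e u = ((z : OnePoint ℂ), (w : OnePoint ℂ)) := by
  obtain ⟨h1, h2⟩ := exists_side_coord hse.sq hse.pow hzw hz hγ
  refine ⟨_, ?_, h2⟩
  simp only [sideDomain, mem_ofPred_eq, h1, add_sub_cancel]
  exact hz

/-- The integrals of `dz / (z² w)` and `w dz / z²` around `(1, 0)` and around `(-1, 0)` differ by a
period. -/
theorem sideAlpha_add (hγ : 0 < γ) {u u' z w : ℂ}
    (h1 : sideMap γ 1 1 u = ((z : OnePoint ℂ), (w : OnePoint ℂ)))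
    (h2 : sideMap γ (-1) (eps γ) u' = ((z : OnePoint ℂ), (w : OnePoint ℂ)))
    (hu : u ∈ sideDomain γ) (hu' : u' ∈ sideDomain γ) :
    sideAlpha γ u + (eps γ)⁻¹ * sideAlpha γ u' =
      -((w / fullRoot γ z)⁻¹ + (w / fullRoot γ (-z))⁻¹) * (constA γ : ℝ) ∧
    sideBeta γ u + eps γ * sideBeta γ u' =
      (w / fullRoot γ z + w / fullRoot γ (-z)) * (constB γ : ℝ) := by
  obtain ⟨hz, hz', hA, hB⟩ := side_add_side hγ h1 h2 hu hu'
  have he := eps_ne_zero γ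
  simp only [sideMap, Prod.mk.injEq, OnePoint.coe_eq_coe, one_mul] at h1 h2
  obtain ⟨h1, h1'⟩ := h1
  obtain ⟨h2, h2'⟩ := h2
  have h3 : 1 + u' ^ (γ + 1) = -z := by rw [← h2]; ring
  have hE := sideRoot_ne_zero (γ := γ) hz
  have hE' := sideRoot_ne_zero (γ := γ) hz'
  have hz0 := slitPlane_ne_zero hz
  have hγ0 : (γ : ℂ) ≠ 0 := by exact_mod_cast hγ.ne'
  have hn2 : (γ : ℂ) + 2 ≠ 0 := by exact_mod_cast Nat.succ_ne_zero (γ + 1)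
  rw [h1] at h1'
  rw [h3] at h2'
  constructor
  · have hw0 : w ≠ 0 := by
      rintro rfl
      have hu0 : u = 0 := eq_zero_of_pow_eq_zero ((mul_eq_zero.1 h1').resolve_right hE)
      rw [hu0, zero_pow (Nat.succ_ne_zero γ), add_zero] at h1
      rw [← h1] at hz'
      simp [mem_slitPlane_iff] at hz'
      linarith
    have k1 : u * w = (z - 1) * sideRoot γ z := by
      rw [← h1', ← h1, pow_succ]; ring
    have k2 : u' * w = eps γ * ((-z - 1) * sideRoot γ (-z)) := by
      rw [← h2', ← h3, pow_succ]; ring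
    -- The exact part of α is a function on the curve, so its contributions from the two charts
    -- cancel; likewise w/z for β below.
    have e1 : u * (1 + z) / (z * sideRoot γ z) = (z ^ 2 - 1) / (z * w) := by
      rw [div_eq_div_iff (mul_ne_zero hz0 hE) (mul_ne_zero hz0 hw0)]
      linear_combination (1 + z) * z * k1
    have e2 : u' * (1 + -z) / (-z * sideRoot γ (-z)) = -(eps γ * ((z ^ 2 - 1) / (z * w))) := by
      rw [mul_div_assoc', ← neg_div,
        div_eq_div_iff (mul_ne_zero (neg_ne_zero.2 hz0) hE') (mul_ne_zero hz0 hw0)]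
      linear_combination (1 - z) * z * k2
    rw [sideAlpha, sideAlpha, h1, h3, e1, e2, constA]
    push_cast
    field_simp
    field_simp at hA
    linear_combination (γ : ℂ) * z * hA
  · rw [sideBeta, sideBeta, h1, h3, h1', show u' ^ γ * sideRoot γ (-z) = w / eps γ by
      rw [← h2', mul_div_cancel_left₀ _ he], constB]
    push_cast
    field_simp
    linear_combination 2 * γ * z * hB

end periods

/-! ### The constant c for which the periods vanish -/

section harmonic
variable {γ : ℕ} {s e : ℂ}

/-- The harmonic function `∫ dz / (z² w) + c² conj (∫ w dz / z²)` in a parametrization. -/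
def sideHarmonic (γ : ℕ) (s e : ℂ) (c : ℝ) (u : ℂ) : ℂ :=
  s / e * sideAlpha γ u + (c : ℂ) ^ 2 * conj (e * s * sideBeta γ u)

theorem conj_eq_inv_of_norm_eq_one {x : ℂ} (hx : ‖x‖ = 1) : conj x = x⁻¹ :=
  (inv_eq_conj hx).symm

/-- By `sideAlpha_add` the two sides differ by −(θ⁻¹ + θ'⁻¹)A + c² conj(θ + θ')B. Since θ and θ' are
unimodular, this is (θ⁻¹ + θ'⁻¹)(c²B − A) = 0. -/
theorem sideHarmonic_eq (hγ : 0 < γ) {c : ℝ} (hc : c ^ 2 * constB γ = constA γ) {u u' : ℂ}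
    (h : sideMap γ 1 1 u = sideMap γ (-1) (eps γ) u') (hu : u ∈ sideDomain γ)
    (hu' : u' ∈ sideDomain γ) :
    sideHarmonic γ 1 1 c u = sideHarmonic γ (-1) (eps γ) c u' := by
  obtain ⟨z, w, hq, -, hzw⟩ := mem_puncturedCurve_iff.1
    (IsSide.sideMap_mem_puncturedCurve (γ := γ) (Or.inl ⟨rfl, rfl⟩) hu)
  obtain ⟨hz, hz', -⟩ := side_add_side hγ hq (h.symm.trans hq) hu hu'
  obtain ⟨hA, hB⟩ := sideAlpha_add hγ hq (h.symm.trans hq) hu hu'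
  have hz1 : 1 - z ∈ slitPlane := by simpa [sub_eq_add_neg] using one_add_mem_slitPlane hz'
  have hz1' : 1 - -z ∈ slitPlane := by simpa using one_add_mem_slitPlane hz
  have n1 := norm_div_fullRoot hzw hz hz1
  have n2 : ‖w / fullRoot γ (-z)‖ = 1 := by
    have hzw' : (w / eps γ) ^ (γ + 1) = -z * ((-z) ^ 2 - 1) ^ γ := by
      rw [div_pow, eps_pow, hzw, neg_sq, div_neg, div_one, neg_mul]
    have hn : ‖eps γ‖ = 1 := by
      have : ‖eps γ‖ ^ (γ + 1) = 1 := by rw [← norm_pow, eps_pow, norm_neg, norm_one]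
      exact (pow_eq_one_iff_of_nonneg (norm_nonneg _) (Nat.succ_ne_zero γ)).1 this
    have := norm_div_fullRoot hzw' hz' hz1'
    rw [norm_div, norm_div, hn, div_one] at this
    rwa [norm_div]
  have hconj := congrArg conj hB
  simp only [map_add, map_mul, conj_ofReal] at hconj
  rw [conj_eq_inv_of_norm_eq_one n1, conj_eq_inv_of_norm_eq_one n2] at hconj
  have hc' : (c : ℂ) ^ 2 * (constB γ : ℝ) = (constA γ : ℝ) := by exact_mod_cast hc
  simp only [sideHarmonic, map_mul, map_neg, map_one]
  linear_combination hA + (c : ℂ) ^ 2 * hconj +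
    ((w / fullRoot γ z)⁻¹ + (w / fullRoot γ (-z))⁻¹) * hc'

open Classical in
/-- The function `∫ dz / (z² w) + c² conj (∫ w dz / z²)` on the punctured curve. -/
def globalHarmonic (γ : ℕ) (c : ℝ) (q : OnePoint ℂ × OnePoint ℂ) : ℂ :=
  if h : ∃ u ∈ sideDomain γ, sideMap γ 1 1 u = q then sideHarmonic γ 1 1 c h.choose
  else if h : ∃ u ∈ sideDomain γ, sideMap γ (-1) (eps γ) u = q then
    sideHarmonic γ (-1) (eps γ) c h.choose
  else 0

theorem globalHarmonic_sideMap (hγ : 0 < γ) {c : ℝ} (hc : c ^ 2 * constB γ = constA γ)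
    (hse : IsSide γ s e) {u : ℂ} (hu : u ∈ sideDomain γ) :
    globalHarmonic γ c (sideMap γ s e u) = sideHarmonic γ s e c u := by
  rw [globalHarmonic]
  split_ifs with h1 h2
  · obtain ⟨h3, h4⟩ := h1.choose_spec
    rcases hse with ⟨rfl, rfl⟩ | ⟨rfl, rfl⟩
    · rw [sideMap_injOn one_ne_zero one_ne_zero h3 hu h4]
    · exact sideHarmonic_eq hγ hc h4 h3 hu
  · obtain ⟨h3, h4⟩ := h2.choose_spec
    rcases hse with ⟨rfl, rfl⟩ | ⟨rfl, rfl⟩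
    · exact absurd ⟨u, hu, rfl⟩ h1
    · rw [sideMap_injOn (by norm_num) (eps_ne_zero γ) h3 hu h4]
  · rcases hse with ⟨rfl, rfl⟩ | ⟨rfl, rfl⟩
    · exact absurd ⟨u, hu, rfl⟩ h1
    · exact absurd ⟨u, hu, rfl⟩ h2

/-- A primitive of the real part of `Φ` on the punctured curve. -/
def weierstrass (γ : ℕ) (c : ℝ) (q : OnePoint ℂ × OnePoint ℂ) : Fin 3 → ℝ :=
  ![-(globalHarmonic γ c q).im, -(globalHarmonic γ c q).re, 2 * c * ((zCoord q)⁻¹).im]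

/-- With h = a + c² conj b one has Re(i(a − c²b)) = −Im h and Re(−(a + c²b)) = −Re h, so a
single-valued h gives single-valued coordinates. -/
theorem weierstrass_sideMap (hγ : 0 < γ) {c : ℝ} (hc : c ^ 2 * constB γ = constA γ)
    (hse : IsSide γ s e) {u : ℂ} (hu : u ∈ sideDomain γ) (j : Fin 3) :
    weierstrass γ c (sideMap γ s e u) j = (sidePrim γ s e c u j).re := by
  have h := globalHarmonic_sideMap hγ hc hse hu
  have hz : zCoord (sideMap γ s e u) = s * (1 + u ^ (γ + 1)) := rfl
  have hc2 : (c : ℂ) ^ 2 = ((c ^ 2 : ℝ) : ℂ) := by push_cast; rfl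
  rw [sidePrim, weierstrass, h, hz, sideHarmonic, hc2]
  generalize s / e * sideAlpha γ u = a
  generalize e * s * sideBeta γ u = b
  generalize (s * (1 + u ^ (γ + 1)))⁻¹ = d
  fin_cases j
  · change -(a + _ * conj b).im = (I * (a - (c : ℂ) ^ 2 * b)).re
    rw [hc2, add_im, im_ofReal_mul, conj_im, I_mul_re, sub_im, im_ofReal_mul]
    ring
  · change -(a + _ * conj b).re = (-(a + (c : ℂ) ^ 2 * b)).re
    rw [hc2, add_re, re_ofReal_mul, conj_re, neg_re, add_re, re_ofReal_mul]
  · change 2 * c * d.im = (2 * I * c * -d).re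
    rw [show 2 * I * c * -d = ((2 * c : ℝ) : ℂ) * (I * -d) by push_cast; ring, re_ofReal_mul,
      I_mul_re, neg_im]
    ring

theorem rePhiIntegral_eq_weierstrass (hγ : 0 < γ) {c : ℝ} (hc : c ^ 2 * constB γ = constA γ)
    {p : ℝ → OnePoint ℂ × OnePoint ℂ} (hp : IsPiecewiseC1Path γ p) :
    rePhiIntegral c p = WithLp.toLp 2 (weierstrass γ c (p 1) - weierstrass γ c (p 0)) :=
  rePhiIntegral_eq_sub hγ c (fun _ _ hse _ hu => weierstrass_sideMap hγ hc hse hu) hp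

theorem periodCondition_of_sq (hγ : 0 < γ) {c : ℝ} (hc : c ^ 2 * constB γ = constA γ) :
    PeriodCondition γ c := fun p hp h01 => by
  rw [rePhiIntegral_eq_weierstrass hγ hc hp, h01, sub_self]
  rfl

/-- The Weierstrass map based at `q₀`. -/
def weierstrassMap (γ : ℕ) (c : ℝ) (q₀ q : puncturedCurve γ) : EuclideanSpace ℝ (Fin 3) :=
  WithLp.toLp 2 (weierstrass γ c q - weierstrass γ c q₀)

theorem isWeierstrassMap_weierstrassMap (hγ : 0 < γ) {c : ℝ}
    (hc : c ^ 2 * constB γ = constA γ) (q₀ : puncturedCurve γ) :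
    IsWeierstrassMap γ c q₀ (weierstrassMap γ c q₀) := fun q p hp h0 h1 => by
  rw [rePhiIntegral_eq_weierstrass hγ hc hp, h0, h1, weierstrassMap]

end harmonic

/-! ### Uniqueness of c -/

section loops
variable {γ : ℕ}

theorem JoinedBy.rePhi {q q' : OnePoint ℂ × OnePoint ℂ} {v : ℝ → Fin 3 → ℂ}
    (h : JoinedBy γ q q' v) : ∃ p, IsPiecewiseC1Path γ p ∧ p 0 = q ∧ p 1 = q' ∧
      ∀ c, rePhiIntegral c p = WithLp.toLp 2 fun j => (v c j).re := by
  obtain ⟨p, hp, h0, h1, hv⟩ := h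
  refine ⟨p, hp, h0, h1, fun c => ?_⟩
  rw [rePhiIntegral]
  congr 1
  ext j
  rw [← (hv c j).2]
  rfl

/-- The arguments are ±π/(2(γ+1)), strictly inside (−π/2, π/2) because γ > 0. This keeps θ + θ' from
vanishing over z = i. -/
theorem re_root_I_pos (hγ : 0 < γ) : 0 < (root γ I).re ∧ 0 < (root γ (-I)).re := by
  have hγ' : (0 : ℝ) < γ := by exact_mod_cast hγ
  have key : ∀ x : ℝ, |x| ≤ Real.pi / 2 → 0 < (exp ((x : ℂ) * I * (((γ + 1 : ℕ) : ℂ)⁻¹))).re := by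
    intro x hx
    rw [show (x : ℂ) * I * (((γ + 1 : ℕ) : ℂ)⁻¹) = ((x / (γ + 1) : ℝ) : ℂ) * I by
      push_cast; ring, exp_ofReal_mul_I_re]
    have hpi := Real.pi_pos
    have h2 : |x / (γ + 1)| < Real.pi / 2 := by
      rw [abs_div, abs_of_pos (by positivity : (0 : ℝ) < γ + 1), div_lt_iff₀ (by positivity)]
      nlinarith
    exact Real.cos_pos_of_mem_Ioo ⟨(abs_lt.1 h2).1, (abs_lt.1 h2).2⟩
  have hpi := Real.pi_pos
  constructor
  · rw [root, cpow_def_of_ne_zero I_ne_zero, log_I]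
    have := key (Real.pi / 2) (by rw [abs_of_pos (by positivity)])
    push_cast at this ⊢
    exact this
  · rw [root, cpow_def_of_ne_zero (neg_ne_zero.2 I_ne_zero), log_neg_I]
    have := key (-(Real.pi / 2)) (by rw [abs_neg, abs_of_pos (by positivity)])
    push_cast at this ⊢
    rwa [neg_mul] at *

theorem phiVec_sub (c : ℝ) (a b d a' b' d' : ℂ) (j : Fin 3) :
    phiVec c a b d j - phiVec c a' b' d' j = phiVec c (a - a') (b - b') (d - d') j := by
  fin_cases j
  · change I * (a - (c : ℂ) ^ 2 * b) - I * (a' - (c : ℂ) ^ 2 * b') =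
      I * (a - a' - (c : ℂ) ^ 2 * (b - b'))
    ring
  · change -(a + (c : ℂ) ^ 2 * b) - -(a' + (c : ℂ) ^ 2 * b') =
      -(a - a' + (c : ℂ) ^ 2 * (b - b'))
    ring
  · change 2 * I * c * d - 2 * I * c * d' = 2 * I * c * (d - d')
    ring

theorem isSide_one : IsSide γ 1 1 := Or.inl ⟨rfl, rfl⟩

theorem isSide_neg_one : IsSide γ (-1) (eps γ) := Or.inr ⟨rfl, rfl⟩

/-- The path from `(-1, 0)` to `(1, 0)` through a point which is not on the real line. -/
theorem joinedBy_neg_one_one (hγ : 0 < γ) {z w : ℂ} (hzw : w ^ (γ + 1) = z * (z ^ 2 - 1) ^ γ)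
    (hz : z ∈ slitPlane) (hz' : -z ∈ slitPlane) :
    ∃ a, JoinedBy γ (sideMap γ (-1) (eps γ) 0) (sideMap γ 1 1 0)
      (fun c => phiVec c a (sideBeta γ 0 + eps γ * sideBeta γ 0 -
        (w / fullRoot γ z + w / fullRoot γ (-z)) * (constB γ : ℝ)) (-2)) := by
  obtain ⟨u, hu, hm⟩ := exists_side_preimage hγ isSide_one hzw (by rwa [one_mul])
  obtain ⟨u', hu', hm'⟩ := exists_side_preimage hγ isSide_neg_one hzw (by rwa [neg_one_mul])
  have j1 := joinedBy_ray hγ isSide_one hu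
  have j2 := joinedBy_ray hγ isSide_neg_one hu'
  rw [hm] at j1
  rw [hm'] at j2
  obtain ⟨-, hB⟩ := sideAlpha_add hγ hm hm' hu hu'
  have hj := j2.trans j1.symm
  have hzc : (1 : ℂ) * (1 + u ^ (γ + 1)) = -1 * (1 + u' ^ (γ + 1)) := by
    have h1 := congrArg Prod.fst hm
    have h2 := congrArg Prod.fst hm'
    exact OnePoint.coe_injective (h1.trans h2.symm)
  -- The path runs along one ray in each chart and meets at (z, w). The third entry is the increment
  -- of −1/z from z = −1 to z = 1, that is −2.
  refine ⟨(-1 / eps γ * sideAlpha γ u' - -1 / eps γ * sideAlpha γ 0) -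
      (1 / 1 * sideAlpha γ u - 1 / 1 * sideAlpha γ 0), hj.congr fun c j => ?_⟩
  change (sidePrim γ (-1) (eps γ) c u' j - sidePrim γ (-1) (eps γ) c 0 j) +
    -(sidePrim γ 1 1 c u j - sidePrim γ 1 1 c 0 j) = _
  rw [← sub_eq_add_neg]
  simp only [sidePrim, phiVec_sub]
  rw [← hB]
  congr 1
  · ring
  · rw [hzc, zero_pow (Nat.succ_ne_zero γ)]
    norm_num
    ring

/-- A loop along which the integral of `w dz / z²` does not vanish. -/
theorem exists_loop (hγ : 0 < γ) : ∃ q, q ∈ puncturedCurve γ ∧ ∃ a b, b ≠ 0 ∧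
    JoinedBy γ q q (fun c => phiVec c a b 0) := by
  set z : ℂ := I with hz
  have hI : z ∈ slitPlane := by simp [mem_slitPlane_iff, hz]
  have hI' : -z ∈ slitPlane := by simp [mem_slitPlane_iff, hz]
  set w : ℂ := root γ (z * (z ^ 2 - 1) ^ γ) with hw
  have hzw : w ^ (γ + 1) = z * (z ^ 2 - 1) ^ γ := root_pow _ _
  have hne : z * (z ^ 2 - 1) ^ γ ≠ 0 := by
    rw [hz, I_sq]
    exact mul_ne_zero I_ne_zero (pow_ne_zero _ (by norm_num))
  have hw0 : w ≠ 0 := root_ne_zero hne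
  -- A second sheet over z = i exists because γ + 1 ≥ 2; returning on it replaces w by ζw.
  have hprim := Complex.isPrimitiveRoot_exp (γ + 1) (Nat.succ_ne_zero γ)
  set ζ := exp (2 * Real.pi * I / (γ + 1 : ℕ))
  have hζ1 : ζ ≠ 1 := hprim.ne_one (by omega)
  have hzw' : (ζ * w) ^ (γ + 1) = z * (z ^ 2 - 1) ^ γ := by
    rw [mul_pow, hprim.pow_eq_one, one_mul, hzw]
  obtain ⟨a, h⟩ := joinedBy_neg_one_one hγ hzw hI hI'
  obtain ⟨a', h'⟩ := joinedBy_neg_one_one hγ hzw' hI hI'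
  refine ⟨_, isSide_neg_one.sideMap_mem_puncturedCurve zero_mem_sideDomain, a - a',
    (ζ - 1) * (w / fullRoot γ z + w / fullRoot γ (-z)) * (constB γ : ℝ), ?_,
    (h.trans h'.symm).congr fun c j => ?_⟩
  · have hB : ((constB γ : ℝ) : ℂ) ≠ 0 := by exact_mod_cast (constB_pos hγ).ne'
    refine mul_ne_zero (mul_ne_zero (sub_ne_zero.2 hζ1) ?_) hB
    -- It remains to see that the two unimodular numbers θ and θ' do not cancel.
    have hr := re_root_I_pos hγ
    have hW := fullRoot_ne_zero (γ := γ) hI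
      (by simpa [sub_eq_add_neg] using one_add_mem_slitPlane hI')
    have hW' := fullRoot_ne_zero (γ := γ) hI' (by simpa using one_add_mem_slitPlane hI)
    rw [div_add_div _ _ hW hW', ← mul_comm w, ← mul_add]
    refine div_ne_zero (mul_ne_zero hw0 ?_) (mul_ne_zero hW hW')
    have hsum : fullRoot γ (-z) + fullRoot γ z = (root γ (-z) + root γ z) *
        (root γ (1 - z) ^ γ * root γ (1 + z) ^ γ) := by
      rw [fullRoot, fullRoot, sub_neg_eq_add, ← sub_eq_add_neg]
      ring
    rw [hsum]
    refine mul_ne_zero ?_ (right_ne_zero_of_mul hW)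
    intro h0
    have := congrArg re h0
    rw [add_re, zero_re] at this
    linarith [hr.1, hr.2]
  · change phiVec c _ _ _ j + -phiVec c _ _ _ j = _
    rw [← sub_eq_add_neg, phiVec_sub, sub_self]
    congr 1
    ring

/-- Vanishing of the real periods means a = −c² conj b; since b ≠ 0, this fixes c² and hence the
positive c. -/
theorem eq_of_loop {c c' : ℝ} (hc : 0 < c) (hc' : 0 < c') {a b : ℂ} (hb : b ≠ 0)
    (h : ∀ j, (phiVec c a b 0 j).re = 0) (h' : ∀ j, (phiVec c' a b 0 j).re = 0) : c = c' := by
  have key : ∀ x : ℝ, (∀ j, (phiVec x a b 0 j).re = 0) →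
      a.im = x ^ 2 * b.im ∧ a.re = -(x ^ 2 * b.re) := by
    intro x hx
    have hx2 : (x : ℂ) ^ 2 = ((x ^ 2 : ℝ) : ℂ) := by push_cast; rfl
    have h0 : (I * (a - (x : ℂ) ^ 2 * b)).re = 0 := hx 0
    have h1 : (-(a + (x : ℂ) ^ 2 * b)).re = 0 := hx 1
    rw [hx2, I_mul_re, sub_im, im_ofReal_mul] at h0
    rw [hx2, neg_re, add_re, re_ofReal_mul] at h1
    constructor <;> linarith
  obtain ⟨h1, h2⟩ := key c h
  obtain ⟨h3, h4⟩ := key c' h'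
  have hsq : c ^ 2 = c' ^ 2 := by
    by_contra hne
    have hne' : c ^ 2 - c' ^ 2 ≠ 0 := sub_ne_zero.2 hne
    refine hb (Complex.ext ?_ ?_)
    · have : (c ^ 2 - c' ^ 2) * b.re = 0 := by linarith
      exact (mul_eq_zero.1 this).resolve_left hne'
    · have : (c ^ 2 - c' ^ 2) * b.im = 0 := by linarith
      exact (mul_eq_zero.1 this).resolve_left hne'
  exact (pow_left_inj₀ hc.le hc'.le two_ne_zero).1 hsq

theorem exists_joinedBy_center (hγ : 0 < γ) {q : OnePoint ℂ × OnePoint ℂ}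
    (hq : q ∈ puncturedCurve γ) : ∃ v, JoinedBy γ (sideMap γ 1 1 0) q v := by
  obtain ⟨s, e, u, hse, hu, rfl⟩ := exists_sideMap_eq hγ hq
  have h1 := joinedBy_ray hγ hse hu
  rcases hse with ⟨rfl, rfl⟩ | ⟨rfl, rfl⟩
  · exact ⟨_, h1⟩
  · obtain ⟨a, h⟩ := joinedBy_neg_one_one hγ (z := I) (w := root γ (I * (I ^ 2 - 1) ^ γ))
      (root_pow _ _) (by simp [mem_slitPlane_iff]) (by simp [mem_slitPlane_iff])
    exact ⟨_, h.symm.trans h1⟩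

theorem exists_joinedBy (hγ : 0 < γ) {q q' : OnePoint ℂ × OnePoint ℂ}
    (hq : q ∈ puncturedCurve γ) (hq' : q' ∈ puncturedCurve γ) : ∃ v, JoinedBy γ q q' v := by
  obtain ⟨v, hv⟩ := exists_joinedBy_center hγ hq
  obtain ⟨v', hv'⟩ := exists_joinedBy_center hγ hq'
  exact ⟨_, hv.symm.trans hv'⟩

theorem periodCondition_unique (hγ : 0 < γ) {c c' : ℝ} (hc : 0 < c) (hc' : 0 < c')
    (h : PeriodCondition γ c) (h' : PeriodCondition γ c') : c = c' := by
  obtain ⟨q, -, a, b, hb, hj⟩ := exists_loop hγ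
  obtain ⟨p, hp, h0, h1, hv⟩ := hj.rePhi
  refine eq_of_loop (a := a) hc hc' hb (fun j => ?_) fun j => ?_
  · have := h p hp (h0.trans h1.symm)
    rw [hv] at this
    exact congrArg (fun x : EuclideanSpace ℝ (Fin 3) => x j) this
  · have := h' p hp (h0.trans h1.symm)
    rw [hv] at this
    exact congrArg (fun x : EuclideanSpace ℝ (Fin 3) => x j) this

/-- Appending the loop to a path from q₀ does not change its end point, so a well-defined map forces
the real periods of the loop to vanish. -/
theorem wellDefined_unique (hγ : 0 < γ) {q₀ : puncturedCurve γ} {c c' : ℝ} (hc : 0 < c)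
    (hc' : 0 < c') (h : WellDefined γ c q₀) (h' : WellDefined γ c' q₀) : c = c' := by
  obtain ⟨q, hq, a, b, hb, hj⟩ := exists_loop hγ
  obtain ⟨v, hv⟩ := exists_joinedBy hγ q₀.2 hq
  obtain ⟨p, hp, hp0, hp1, hpv⟩ := hv.rePhi
  obtain ⟨p', hp', hp0', hp1', hpv'⟩ := (hv.trans hj).rePhi
  have key : ∀ x : ℝ, WellDefined γ x q₀ → ∀ j, (phiVec x a b 0 j).re = 0 := by
    rintro x ⟨f, hf, -⟩ j
    have h1 := hf ⟨q, hq⟩ p hp hp0 hp1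
    have h2 := hf ⟨q, hq⟩ p' hp' hp0' hp1'
    rw [h1, hpv, hpv'] at h2
    have h3 : (v x j).re = (v x j + phiVec x a b 0 j).re :=
      congrArg (fun x : EuclideanSpace ℝ (Fin 3) => x j) h2
    rw [add_re] at h3
    linarith
  exact eq_of_loop hc hc' hb (key c h) (key c' h')

/-- Every point can be reached from q₀ by an admissible path, so the values of the map are forced.
-/
theorem wellDefined_of_sq (hγ : 0 < γ) {c : ℝ} (hc : c ^ 2 * constB γ = constA γ)
    (q₀ : puncturedCurve γ) : WellDefined γ c q₀ := by
  refine ⟨_, isWeierstrassMap_weierstrassMap hγ hc q₀, fun f hf => ?_⟩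
  ext1 q
  obtain ⟨v, hv⟩ := exists_joinedBy hγ q₀.2 q.2
  obtain ⟨p, hp, h0, h1, -⟩ := hv.rePhi
  rw [hf q p hp h0 h1, isWeierstrassMap_weierstrassMap hγ hc q₀ q p hp h0 h1]

end loops

/-! ### Harmonicity and conformality -/

/-- The real part of a vector in `ℂ³`, as a real linear map. -/
def reVec : (Fin 3 → ℂ) →L[ℝ] EuclideanSpace ℝ (Fin 3) :=
  ((EuclideanSpace.equiv (Fin 3) ℝ).symm : (Fin 3 → ℝ) →L[ℝ] EuclideanSpace ℝ (Fin 3)).comp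
    (ContinuousLinearMap.pi fun j => reCLM.comp (ContinuousLinearMap.proj j))

theorem reVec_apply (v : Fin 3 → ℂ) (j : Fin 3) : reVec v j = (v j).re := rfl

/-- The real part of a holomorphic curve whose derivative is a non-zero null vector is conformal. -/
theorem conformalAt_reVec {G : ℂ → Fin 3 → ℂ} {g : Fin 3 → ℂ} {t : ℂ} (hG : HasDerivAt G g t)
    (hnull : g 0 ^ 2 + g 1 ^ 2 + g 2 ^ 2 = 0) (hg : g ≠ 0) :
    ConformalAt (fun r => reVec (G r)) t := by
  have hd : HasFDerivAt (fun r => reVec (G r))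
      (reVec.comp ((ContinuousLinearMap.toSpanSingleton ℂ g).restrictScalars ℝ)) t :=
    reVec.hasFDerivAt.comp t (hG.hasFDerivAt.restrictScalars ℝ)
  rw [conformalAt_iff hd]
  have hre := congrArg re hnull
  have him := congrArg im hnull
  simp only [sq, add_re, mul_re, zero_re, add_im, mul_im, zero_im] at hre him
  -- For a null vector g, Re g and Im g are orthogonal and of equal length; the conformal factor is
  -- |Re g|², which vanishes only if g = 0.
  refine ⟨(g 0).re ^ 2 + (g 1).re ^ 2 + (g 2).re ^ 2, ?_, fun x y => ?_⟩
  · by_contra hle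
    refine hg (funext fun j => ?_)
    have h0 := sq_nonneg (g 0).re
    have h1 := sq_nonneg (g 1).re
    have h2 := sq_nonneg (g 2).re
    have k0 := sq_nonneg (g 0).im
    have k1 := sq_nonneg (g 1).im
    have k2 := sq_nonneg (g 2).im
    have key : ∀ x : ℂ, x.re ^ 2 ≤ 0 → x.im ^ 2 ≤ 0 → x = 0 := fun x hr hi =>
      Complex.ext (pow_eq_zero_iff two_ne_zero |>.1 (hr.antisymm (sq_nonneg _)))
        (pow_eq_zero_iff two_ne_zero |>.1 (hi.antisymm (sq_nonneg _)))
    have e0 : g 0 = 0 := key _ (by linarith) (by linarith)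
    have e1 : g 1 = 0 := key _ (by linarith) (by linarith)
    have e2 : g 2 = 0 := key _ (by linarith) (by linarith)
    fin_cases j
    exacts [e0, e1, e2]
  · rw [PiLp.inner_apply, Fin.sum_univ_three, Complex.inner]
    simp only [ContinuousLinearMap.comp_apply, ContinuousLinearMap.coe_restrictScalars',
      ContinuousLinearMap.toSpanSingleton_apply, reVec_apply, Pi.smul_apply, smul_eq_mul, mul_re,
      conj_re, conj_im, RCLike.inner_apply, conj_trivial]
    linear_combination (-x.im * y.im) * hre - (x.re * y.im + x.im * y.re) / 2 * him

section immersion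
variable {γ : ℕ} {s e : ℂ}

/-- The sum of squares is 4c²(αβ − (dz/z²)²), which is zero because αβ = (dz/z²)². -/
theorem sideForm_null (hs : s ^ 2 = 1) (he : e ≠ 0) (c : ℝ) {u : ℂ} (hu : u ∈ sideDomain γ) :
    sideForm γ s e c u 0 ^ 2 + sideForm γ s e c u 1 ^ 2 + sideForm γ s e c u 2 ^ 2 = 0 := by
  have hs0 : s ≠ 0 := by rintro rfl; simp at hs
  have hz0 : 1 + u ^ (γ + 1) ≠ 0 := slitPlane_ne_zero hu
  have hE : sideRoot γ (1 + u ^ (γ + 1)) ≠ 0 := sideRoot_ne_zero hu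
  rw [sideForm]
  generalize sideRoot γ (1 + u ^ (γ + 1)) = E at *
  generalize 1 + u ^ (γ + 1) = z at *
  have key : (s / e * (((γ : ℂ) + 1) / (z ^ 2 * E))) *
      (e * s * (((γ : ℂ) + 1) * (u ^ γ) ^ 2 * E / z ^ 2)) =
      (s * (((γ : ℂ) + 1) * u ^ γ) / (s * z) ^ 2) ^ 2 := by
    rw [mul_pow s z, hs, one_mul]
    field_simp
  change (I * (_ - (c : ℂ) ^ 2 * _)) ^ 2 + (-(_ + (c : ℂ) ^ 2 * _)) ^ 2 + (2 * I * c * _) ^ 2 = 0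
  generalize s / e * (((γ : ℂ) + 1) / (z ^ 2 * E)) = a at *
  generalize e * s * (((γ : ℂ) + 1) * (u ^ γ) ^ 2 * E / z ^ 2) = b at *
  generalize s * (((γ : ℂ) + 1) * u ^ γ) / (s * z) ^ 2 = d at *
  linear_combination ((a - (c : ℂ) ^ 2 * b) ^ 2 + 4 * (c : ℂ) ^ 2 * d ^ 2) * I_sq +
    4 * (c : ℂ) ^ 2 * key

/-- The first two components determine α, which has no zeros in the chart, not even at the branch
point. -/
theorem sideForm_ne_zero (hs : s ≠ 0) (he : e ≠ 0) (c : ℝ) {u : ℂ} (hu : u ∈ sideDomain γ) :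
    sideForm γ s e c u ≠ 0 := by
  intro h
  have h0 := congrFun h 0
  have h1 := congrFun h 1
  have ha : s / e * (((γ : ℂ) + 1) / ((1 + u ^ (γ + 1)) ^ 2 * sideRoot γ (1 + u ^ (γ + 1)))) ≠ 0 :=
    mul_ne_zero (div_ne_zero hs he) (div_ne_zero (natCast_succ_ne_zero γ)
      (mul_ne_zero (pow_ne_zero _ (slitPlane_ne_zero hu)) (sideRoot_ne_zero hu)))
  rw [sideForm] at h0 h1
  change I * (_ - (c : ℂ) ^ 2 * _) = 0 at h0
  change -(_ + (c : ℂ) ^ 2 * _) = 0 at h1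
  have h0' := (mul_eq_zero.1 h0).resolve_left I_ne_zero
  refine ha ?_
  linear_combination (1 / 2 : ℂ) * h0' - (1 / 2 : ℂ) * h1

theorem isConformalMinimalImmersion (hγ : 0 < γ) {c : ℝ}
    (hc : c ^ 2 * constB γ = constA γ) (q₀ : puncturedCurve γ) :
    IsConformalMinimalImmersion γ (weierstrassMap γ c q₀) := by
  intro P t ht hq
  obtain ⟨s, e, hse, k, hk, hk0, hkφ⟩ := P.exists_isSide_factor hγ ht hq
  -- Locally the map is the real part of a holomorphic null curve: harmonic because it is a real
  -- part, conformal because the derivative is a non-zero null vector.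
  set G : ℂ → Fin 3 → ℂ := fun r j =>
    sidePrim γ s e c (k r) j - ((weierstrass γ c q₀ j : ℝ) : ℂ) with hG
  have hGd : ∀ r, AnalyticAt ℂ k r → k r ∈ sideDomain γ →
      HasDerivAt G (deriv k r • sideForm γ s e c (k r)) r := by
    intro r hr hrU
    rw [hasDerivAt_pi]
    intro j
    have := ((hasDerivAt_sidePrim (c := c) (e := e) hγ hse.ne_zero_left hrU j).comp r
      hr.differentiableAt.hasDerivAt).sub_const ((weierstrass γ c q₀ j : ℝ) : ℂ)
    refine this.congr_deriv ?_
    rw [Pi.smul_apply, smul_eq_mul, mul_comm]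
  have hev : Function.extend Subtype.val (weierstrassMap γ c q₀) 0 ∘ P.φ =ᶠ[𝓝 t]
      fun r => reVec (G r) := by
    filter_upwards [hkφ] with r hr
    have hm : P.φ r ∈ puncturedCurve γ := hr.2 ▸ hse.sideMap_mem_puncturedCurve hr.1
    have h1 : Function.extend Subtype.val (weierstrassMap γ c q₀) 0 (P.φ r) =
        weierstrassMap γ c q₀ ⟨P.φ r, hm⟩ :=
      Subtype.val_injective.extend_apply (weierstrassMap γ c q₀) 0 ⟨P.φ r, hm⟩
    rw [Function.comp_apply, h1]
    ext j
    rw [reVec_apply, weierstrassMap, hG]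
    change weierstrass γ c (P.φ r) j - weierstrass γ c q₀ j = _
    rw [hr.2, weierstrass_sideMap hγ hc hse hr.1, sub_re, ofReal_re]
  have hGan : AnalyticAt ℂ G t := by
    rw [analyticAt_iff_eventually_differentiableAt]
    filter_upwards [hkφ, hk.eventually_analyticAt] with r hr hr2
    exact (hGd r hr2 hr.1).differentiableAt
  have hkU := hkφ.self_of_nhds.1
  constructor
  · exact (InnerProductSpace.harmonicAt_congr_nhds hev).2 (hGan.harmonicAt.comp_CLM reVec)
  · obtain ⟨f, hf, hconf⟩ := conformalAt_reVec (hGd t hk hkU) (by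
      simp only [Pi.smul_apply, smul_eq_mul, mul_pow, ← mul_add]
      rw [sideForm_null hse.sq hse.ne_zero_right c hkU, mul_zero])
      (smul_ne_zero hk0 (sideForm_ne_zero hse.ne_zero_left hse.ne_zero_right c hkU))
    exact ⟨f, hf.congr_of_eventuallyEq hev, hconf⟩

end immersion

/-! ### The form dz/w on the compact curve -/

section dzDivW
variable {γ : ℕ}

/-- The form `dz / w`, in local parametrizations, extended by continuity. -/
def dzDivW (γ : ℕ) (P : LocalParam γ) (t : ℂ) : ℂ :=
  open Classical in if t ∈ P.U then
    limUnder (𝓝[≠] t) fun r => deriv (fun x => zCoord (P.φ x)) r / wCoord (P.φ r) else 0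

/-- Near `t`, the form `dz / w` is given by the holomorphic function `W`. -/
def IsDzDivW (P : LocalParam γ) (W : ℂ → ℂ) (t : ℂ) : Prop :=
  AnalyticAt ℂ W t ∧ ∀ᶠ r in 𝓝[≠] t, wCoord (P.φ r) ≠ 0 ∧
    HasDerivAt (fun x => zCoord (P.φ x)) (W r * wCoord (P.φ r)) r

theorem IsDzDivW.eq {P : LocalParam γ} {W : ℂ → ℂ} {t : ℂ} (h : IsDzDivW P W t) (ht : t ∈ P.U) :
    dzDivW γ P t = W t := by
  rw [dzDivW, if_pos ht]
  refine Tendsto.limUnder_eq ?_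
  refine (h.1.continuousAt.tendsto.mono_left nhdsWithin_le_nhds).congr' ?_
  filter_upwards [h.2] with r hr
  rw [hr.2.deriv, mul_div_cancel_right₀ _ hr.1]

theorem IsDzDivW.eventually {P : LocalParam γ} {W : ℂ → ℂ} {t : ℂ} (h : IsDzDivW P W t) :
    ∀ᶠ r in 𝓝 t, IsDzDivW P W r := by
  have h2 := h.2
  rw [eventually_nhdsWithin_iff] at h2
  filter_upwards [h.1.eventually_analyticAt, h2.eventually_nhds] with r hr hr2
  refine ⟨hr, ?_⟩
  by_cases hrt : r = t
  · exact hrt ▸ h.2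
  · filter_upwards [hr2.filter_mono nhdsWithin_le_nhds,
      (eventually_ne_nhds hrt).filter_mono nhdsWithin_le_nhds] with x hx hxt
    exact hx hxt

theorem IsDzDivW.comp {P Q : LocalParam γ} {W h : ℂ → ℂ} {t : ℂ} (hQ : IsDzDivW Q W (h t))
    (ht : t ∈ P.U) (hh : AnalyticAt ℂ h t) (hPQ : ∀ᶠ r in 𝓝 t, P.φ r = Q.φ (h r)) :
    IsDzDivW P (fun r => W (h r) * deriv h r) t := by
  have hd := P.deriv_ne_zero ht hh hPQ
  refine ⟨(hQ.1.fun_comp hh).mul hh.deriv, ?_⟩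
  have hne : Tendsto h (𝓝[≠] t) (𝓝[≠] (h t)) := hh.differentiableAt.hasDerivAt.tendsto_nhdsNE hd
  filter_upwards [hne.eventually hQ.2, hPQ.eventually_nhds.filter_mono nhdsWithin_le_nhds,
    hh.eventually_analyticAt.filter_mono nhdsWithin_le_nhds] with r hr hr2 hr3
  rw [hr2.self_of_nhds]
  refine ⟨hr.1, ?_⟩
  have h1 := hr.2.comp r hr3.differentiableAt.hasDerivAt
  refine (h1.congr_of_eventuallyEq ?_).congr_deriv (by ring)
  filter_upwards [hr2] with x hx
  rw [Function.comp_apply, hx]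

theorem dzDivW_mem (h : ∀ (P : LocalParam γ), ∀ t ∈ P.U, ∃ W, IsDzDivW P W t) :
    dzDivW γ ∈ holomorphicForms γ := by
  refine ⟨fun P t ht => ?_, fun P t ht => if_neg ht, fun P Q t k hk ht hkt hPQ => ?_⟩
  · obtain ⟨W, hW⟩ := h P t ht
    refine (hW.1.differentiableAt.congr_of_eventuallyEq ?_).differentiableWithinAt
    filter_upwards [hW.eventually, P.isOpen.mem_nhds ht] with r hr hrU
    exact hr.eq hrU
  · obtain ⟨W, hW⟩ := h Q (k t) hkt
    rw [hW.eq hkt, (hW.comp ht hk hPQ).eq ht]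

/-- If every point `q` is covered by a parametrization `C` with `dz / w ≠ 0` on it, through which
all parametrizations near `q` factor, then all forms are multiples of `dz / w` by functions. -/
theorem exists_quotient {a : LocalParam γ → ℂ → ℂ} (ha : a ∈ holomorphicForms γ)
    (hω : dzDivW γ ∈ holomorphicForms γ)
    (h : ∀ q ∈ compactCurve γ, ∃ (C : LocalParam γ) (u : ℂ), u ∈ C.U ∧ dzDivW γ C u ≠ 0 ∧
      ∀ (P : LocalParam γ), ∀ t ∈ P.U, P.φ t = q →
        ∃ k : ℂ → ℂ, AnalyticAt ℂ k t ∧ k t = u ∧ ∀ᶠ r in 𝓝 t, P.φ r = C.φ (k r)) :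
    ∃ R : OnePoint ℂ × OnePoint ℂ → ℂ, ∀ (P : LocalParam γ), ∀ t ∈ P.U,
      a P t = R (P.φ t) * dzDivW γ P t := by
  have : Nonempty (LocalParam γ) := ⟨middleParam γ⟩
  choose! C u hu hne hk using h
  refine ⟨fun q => a (C q) (u q) / dzDivW γ (C q) (u q), fun P t ht => ?_⟩
  have hq := P.mapsTo ht
  obtain ⟨k, hkan, hkt, hkφ⟩ := hk _ hq P t ht rfl
  have hU := hu _ hq
  rw [← hkt] at hU
  rw [ha.2.2 P _ t k hkan ht hU hkφ, hω.2.2 P _ t k hkan ht hU hkφ, hkt]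
  field_simp [hne _ hq]

end dzDivW

/-! ### The chart around (∞, ∞) for γ = 1 -/

section infinity

/-- A parametrization of the cubic curve around `(∞, ∞)`. -/
def inftyMap (v : ℂ) : OnePoint ℂ × OnePoint ℂ :=
  (sphereInv (v ^ 2), sphereInv (v ^ 3 / root 1 (1 - v ^ 4)))

theorem sphereInv_injective : Function.Injective sphereInv := by
  intro x y h
  by_cases hx : x = 0 <;> by_cases hy : y = 0
  · rw [hx, hy]
  · rw [sphereInv, sphereInv, if_pos hx, if_neg hy] at h
    exact absurd h.symm (OnePoint.coe_ne_infty _)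
  · rw [sphereInv, sphereInv, if_neg hx, if_pos hy] at h
    exact absurd h (OnePoint.coe_ne_infty _)
  · rw [sphereInv, sphereInv, if_neg hx, if_neg hy, OnePoint.coe_eq_coe] at h
    exact inv_injective h

theorem one_sub_mem_slitPlane {x : ℂ} (hx : ‖x‖ < 1) : 1 - x ∈ slitPlane := by
  refine Or.inl ?_
  rw [sub_re, one_re]
  linarith [(abs_le.1 (abs_re_le_norm x)).2]

theorem one_sub_pow_mem_slitPlane {v : ℂ} (hv : v ∈ Metric.ball (0 : ℂ) 1) {n : ℕ} (hn : n ≠ 0) :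
    1 - v ^ n ∈ slitPlane := by
  refine one_sub_mem_slitPlane ?_
  rw [norm_pow]
  exact pow_lt_one₀ (norm_nonneg _) (mem_ball_zero_iff.1 hv) hn

theorem analyticAt_root_one_sub {v : ℂ} (hv : v ∈ Metric.ball (0 : ℂ) 1) :
    AnalyticAt ℂ (fun v => root 1 (1 - v ^ 4)) v :=
  AnalyticAt.fun_comp (analyticAt_root (one_sub_pow_mem_slitPlane hv four_ne_zero))
    (analyticAt_const.sub (analyticAt_id.pow 4))

theorem inftyMap_zero : inftyMap 0 = (∞, ∞) := by
  simp [inftyMap, sphereInv]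

theorem inftyMap_of_ne {v : ℂ} (hv : v ∈ Metric.ball (0 : ℂ) 1) (h0 : v ≠ 0) :
    inftyMap v = ((((v ^ 2)⁻¹ : ℂ) : OnePoint ℂ),
      ((root 1 (1 - v ^ 4) / v ^ 3 : ℂ) : OnePoint ℂ)) := by
  have hr := root_ne_zero (γ := 1)
    (slitPlane_ne_zero (one_sub_pow_mem_slitPlane hv four_ne_zero))
  rw [inftyMap, sphereInv, sphereInv, if_neg (pow_ne_zero _ h0),
    if_neg (div_ne_zero (pow_ne_zero _ h0) hr), inv_div]

/-- The parametrization `inftyMap` as a local parametrization. -/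
def inftyParam : LocalParam 1 where
  U := Metric.ball 0 1
  φ := inftyMap
  isOpen := Metric.isOpen_ball
  mapsTo := by
    intro v hv
    by_cases h0 : v = 0
    · rw [h0, inftyMap_zero]
      exact Or.inr rfl
    · rw [inftyMap_of_ne hv h0, mem_compactCurve_coe, div_pow, root_pow]
      field_simp
      ring
  injOn := by
    intro u hu v hv h
    have h1 := sphereInv_injective (congrArg Prod.fst h)
    have h2 := sphereInv_injective (congrArg Prod.snd h)
    have h3 : u ^ 4 = v ^ 4 := by linear_combination (u ^ 2 + v ^ 2) * h1
    rw [h3] at h2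
    have h4 := (div_left_inj' (root_ne_zero (γ := 1)
      (slitPlane_ne_zero (one_sub_pow_mem_slitPlane hv four_ne_zero)))).1 h2
    by_cases h0 : v = 0
    · rw [h0] at h1 ⊢
      exact pow_eq_zero_iff two_ne_zero |>.1 (by simpa using h1)
    · refine mul_left_cancel₀ (pow_ne_zero 2 h0) ?_
      linear_combination h4 - u * h1
  holomorphic_z := fun t _ => Or.inr ⟨_, analyticAt_id.pow 2, Eventually.of_forall fun _ => rfl⟩
  holomorphic_w := fun t ht => Or.inr ⟨_, (analyticAt_id.pow 3).div (analyticAt_root_one_sub ht)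
    (root_ne_zero (slitPlane_ne_zero (one_sub_pow_mem_slitPlane ht four_ne_zero))),
    Eventually.of_forall fun _ => rfl⟩

/-- In x = 1/z and y = 1/w the chart reads x = v², y = v³/(1 − v⁴)^(1/2), so v = v³/v² = y (1 −
x²)^(1/2) / x, with value 0 at x = 0. -/
theorem inftyMap_div {x y : ℂ} (hx : 1 - x ^ 2 ≠ 0) (hxy : x ^ 3 = y ^ 2 * (1 - x ^ 2)) :
    (y * root 1 (1 - x ^ 2) / x) ^ 2 = x ∧
      inftyMap (y * root 1 (1 - x ^ 2) / x) = (sphereInv x, sphereInv y) := by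
  have hr := root_pow 1 (1 - x ^ 2)
  have hr0 := root_ne_zero (γ := 1) hx
  by_cases h0 : x = 0
  · have : y = 0 := by simpa [h0, @eq_comm ℂ 0] using hxy
    simp [h0, this, inftyMap]
  · have h2 : (y * root 1 (1 - x ^ 2) / x) ^ 2 = x := by
      rw [div_pow, mul_pow, hr, ← hxy]
      field_simp
    refine ⟨h2, ?_⟩
    have h4 : (y * root 1 (1 - x ^ 2) / x) ^ 4 = x ^ 2 := by
      rw [show 4 = 2 * 2 from rfl, pow_mul, h2]
    rw [inftyMap, h4, h2, pow_succ, h2]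
    congr 2
    field_simp

/-- The quotient giving v has a removable singularity at the isolated zero of x: it stays continuous
because v² = x. -/
theorem LocalParam.exists_infty_factor (P : LocalParam 1) {t : ℂ} (ht : t ∈ P.U)
    (h : P.φ t = (∞, ∞)) :
    ∃ k : ℂ → ℂ, AnalyticAt ℂ k t ∧ k t = 0 ∧ ∀ᶠ r in 𝓝 t, P.φ r = inftyMap (k r) := by
  obtain ⟨x, hx, hx0, hxφ⟩ := (P.holomorphic_z t ht).exists_infty (congrArg Prod.fst h)
  obtain ⟨y, hy, hy0, hyφ⟩ := (P.holomorphic_w t ht).exists_infty (congrArg Prod.snd h)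
  have hφ : ∀ᶠ r in 𝓝 t, P.φ r = (sphereInv (x r), sphereInv (y r)) :=
    (hxφ.and hyφ).mono fun r hr => Prod.ext hr.1 hr.2
  have hrel : ∀ᶠ r in 𝓝 t, x r ^ 3 = y r ^ 2 * (1 - x r ^ 2) := by
    filter_upwards [hφ, P.isOpen.mem_nhds ht] with r hr hrU
    have hm := P.mapsTo hrU
    rw [hr] at hm
    by_cases h1 : x r = 0 <;> by_cases h2 : y r = 0
    · simp [h1, h2]
    · rw [sphereInv, sphereInv, if_pos h1, if_neg h2] at hm
      rcases hm with ⟨_, _, hm, -⟩ | hm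
      · exact absurd (congrArg Prod.fst hm).symm (OnePoint.coe_ne_infty _)
      · exact absurd (congrArg Prod.snd hm) (OnePoint.coe_ne_infty _)
    · rw [sphereInv, sphereInv, if_neg h1, if_pos h2] at hm
      rcases hm with ⟨_, _, hm, -⟩ | hm
      · exact absurd (congrArg Prod.snd hm).symm (OnePoint.coe_ne_infty _)
      · exact absurd (congrArg Prod.fst hm) (OnePoint.coe_ne_infty _)
    · rw [sphereInv, sphereInv, if_neg h1, if_neg h2, mem_compactCurve_coe] at hm
      field_simp at hm
      rw [one_add_one_eq_two, div_pow, one_pow, div_mul_eq_mul_div, one_mul,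
        div_eq_iff (pow_ne_zero 2 h2)] at hm
      linear_combination hm
  have hne : ∀ᶠ r in 𝓝 t, 1 - x r ^ 2 ∈ slitPlane := by
    refine (continuousAt_const.sub (hx.continuousAt.pow 2)).eventually_mem
      (isOpen_slitPlane.mem_nhds ?_)
    simp [hx0]
  have hkey : ∀ᶠ r in 𝓝 t, (y r * root 1 (1 - x r ^ 2) / x r) ^ 2 = x r ∧
      P.φ r = inftyMap (y r * root 1 (1 - x r ^ 2) / x r) := by
    filter_upwards [hφ, hrel, hne] with r h1 h2 h3
    have := inftyMap_div (slitPlane_ne_zero h3) h2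
    exact ⟨this.1, h1.trans this.2.symm⟩
  refine ⟨fun r => y r * root 1 (1 - x r ^ 2) / x r, ?_, by simp [hx0],
    hkey.mono fun r hr => hr.2⟩
  have hpunct : ∀ᶠ r in 𝓝[≠] t, x r ≠ 0 := by
    refine hx.eventually_eq_zero_or_eventually_ne_zero.resolve_left fun hc => ?_
    refine P.not_eventually_const ht (q := (∞, ∞)) ?_
    filter_upwards [hkey, hc] with r hr hr2
    rw [hr.2, hr2, div_zero, inftyMap_zero]
  have hnum : AnalyticAt ℂ (fun r => y r * root 1 (1 - x r ^ 2)) t :=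
    hy.mul (AnalyticAt.fun_comp (g := root 1) (f := fun r => 1 - x r ^ 2)
      (analyticAt_root hne.self_of_nhds) (analyticAt_const.sub (hx.pow 2)))
  refine analyticAt_of_differentiable_on_punctured_nhds_of_continuousAt ?_ ?_
  · filter_upwards [hpunct, hnum.eventually_analyticAt.filter_mono nhdsWithin_le_nhds,
      hx.eventually_analyticAt.filter_mono nhdsWithin_le_nhds] with r hr h1 h2
    exact (h1.div h2 hr).differentiableAt
  · rw [ContinuousAt]
    have h0 : y t * root 1 (1 - x t ^ 2) / x t = 0 := by simp [hx0]
    rw [h0]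
    have hlim : Tendsto (fun r => (y r * root 1 (1 - x r ^ 2) / x r) ^ 2) (𝓝 t) (𝓝 0) := by
      have := hx.continuousAt.tendsto
      rw [hx0] at this
      exact this.congr' (hkey.mono fun r hr => hr.1.symm)
    rw [tendsto_zero_iff_norm_tendsto_zero] at hlim ⊢
    simp only [norm_pow] at hlim
    have h2 := hlim.sqrt
    rw [Real.sqrt_zero] at h2
    exact h2.congr fun r => Real.sqrt_sq (norm_nonneg _)

end infinity

/-! ### Genus one for γ = 1 -/

section genus
variable {s e : ℂ}

/-- A connected parametrization on which `dz / w` has no zeros. -/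
structure IsGoodParam (C : LocalParam 1) : Prop where
  isPreconnected : IsPreconnected C.U
  exists_form : ∀ u ∈ C.U, ∃ W, W u ≠ 0 ∧ IsDzDivW C W u

/-- In this chart dz/w = 2(s/e) du / `sideRoot` z, without zeros. The charts at (0, 0) and (∞, ∞)
similarly give 2 dv / `middleRoot` z and −2 dv / (1 − v⁴)^(1/2). -/
theorem isGoodParam_side (hs : s ^ 2 = 1) (he : e ^ (1 + 1) = s) :
    IsGoodParam (sideParam 1 s e hs he) := by
  have he0 : e ≠ 0 := by
    rintro rfl
    rw [zero_pow two_ne_zero] at he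
    simp [← he] at hs
  have hs0 : s ≠ 0 := by rintro rfl; simp at hs
  refine ⟨(starConvex_sideDomain.isPathConnected zero_mem_sideDomain).isConnected.isPreconnected,
    fun u hu => ⟨fun u => 2 * (s / e) / sideRoot 1 (1 + u ^ (1 + 1)), ?_, ?_, ?_⟩⟩
  · exact div_ne_zero (mul_ne_zero two_ne_zero (div_ne_zero hs0 he0)) (sideRoot_ne_zero hu)
  · exact analyticAt_const.div (analyticAt_sideRoot_comp hu) (sideRoot_ne_zero hu)
  · have hnz : ∀ᶠ r in 𝓝[≠] u, r ≠ 0 := by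
      by_cases h0 : u = 0
      · rw [h0]; exact self_mem_nhdsWithin
      · exact (eventually_ne_nhds h0).filter_mono nhdsWithin_le_nhds
    filter_upwards [hnz, mem_nhdsWithin_of_mem_nhds (isOpen_sideDomain.mem_nhds hu)]
      with r hr hrU
    have hE : sideRoot 1 (1 + r ^ (1 + 1)) ≠ 0 := sideRoot_ne_zero hrU
    change e * (r ^ 1 * sideRoot 1 (1 + r ^ (1 + 1))) ≠ 0 ∧
      HasDerivAt (fun x : ℂ => s * (1 + x ^ (1 + 1))) (_ * (e * (r ^ 1 * _))) r
    refine ⟨mul_ne_zero he0 (mul_ne_zero (pow_ne_zero _ hr) hE), ?_⟩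
    refine (((hasDerivAt_pow (1 + 1) r).const_add 1).const_mul s).congr_deriv ?_
    generalize sideRoot 1 (1 + r ^ (1 + 1)) = E at *
    field_simp
    push_cast
    ring

theorem isGoodParam_middle : IsGoodParam (middleParam 1) := by
  have hD : ∀ {v : ℂ}, v ∈ middleDomain 1 → middleRoot 1 (v ^ (1 + 1)) ≠ 0 := fun hv =>
    middleRoot_ne_zero (slitPlane_ne_zero hv.1) (slitPlane_ne_zero hv.2)
  refine ⟨(starConvex_middleDomain.isPathConnected
    zero_mem_middleDomain).isConnected.isPreconnected,
    fun u hu => ⟨fun u => 2 / middleRoot 1 (u ^ (1 + 1)), ?_, ?_, ?_⟩⟩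
  · exact div_ne_zero two_ne_zero (hD hu)
  · exact analyticAt_const.div (analyticAt_middleRoot_comp hu) (hD hu)
  · have hnz : ∀ᶠ r in 𝓝[≠] u, r ≠ 0 := by
      by_cases h0 : u = 0
      · rw [h0]; exact self_mem_nhdsWithin
      · exact (eventually_ne_nhds h0).filter_mono nhdsWithin_le_nhds
    filter_upwards [hnz, mem_nhdsWithin_of_mem_nhds (isOpen_middleDomain.mem_nhds hu)]
      with r hr hrU
    have hE := hD hrU
    change r * middleRoot 1 (r ^ (1 + 1)) ≠ 0 ∧
      HasDerivAt (fun x : ℂ => x ^ (1 + 1)) (_ * (r * _)) r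
    refine ⟨mul_ne_zero hr hE, ?_⟩
    refine (hasDerivAt_pow (1 + 1) r).congr_deriv ?_
    generalize middleRoot 1 (r ^ (1 + 1)) = E at *
    field_simp
    push_cast
    ring

theorem isGoodParam_infty : IsGoodParam inftyParam := by
  have hD : ∀ {v : ℂ}, v ∈ Metric.ball (0 : ℂ) 1 → root 1 (1 - v ^ 4) ≠ 0 := fun hv =>
    root_ne_zero (slitPlane_ne_zero (one_sub_pow_mem_slitPlane hv four_ne_zero))
  refine ⟨(convex_ball (0 : ℂ) 1).isPreconnected,
    fun u hu => ⟨fun u => -2 / root 1 (1 - u ^ 4), ?_, ?_, ?_⟩⟩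
  · exact div_ne_zero (neg_ne_zero.2 two_ne_zero) (hD hu)
  · exact analyticAt_const.div (analyticAt_root_one_sub hu) (hD hu)
  · have hnz : ∀ᶠ r in 𝓝[≠] u, r ≠ 0 := by
      by_cases h0 : u = 0
      · rw [h0]; exact self_mem_nhdsWithin
      · exact (eventually_ne_nhds h0).filter_mono nhdsWithin_le_nhds
    filter_upwards [hnz, mem_nhdsWithin_of_mem_nhds (Metric.isOpen_ball.mem_nhds hu)]
      with r hr hrU
    have hE := hD hrU
    have hw : wCoord (inftyParam.φ r) = root 1 (1 - r ^ 4) / r ^ 3 := by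
      change wCoord (inftyMap r) = _
      rw [inftyMap_of_ne hrU hr]
      rfl
    rw [hw]
    refine ⟨div_ne_zero hE (pow_ne_zero _ hr), ?_⟩
    have hd := (hasDerivAt_pow 2 r).inv (pow_ne_zero 2 hr)
    refine (hd.congr_of_eventuallyEq ?_).congr_deriv ?_
    · filter_upwards [Metric.isOpen_ball.mem_nhds hrU, eventually_ne_nhds hr] with x hx hx0
      change zCoord (inftyMap x) = _
      rw [inftyMap_of_ne hx hx0]
      rfl
    · generalize root 1 (1 - r ^ 4) = E at *
      field_simp
      push_cast
      ring

theorem exists_middle_coord {γ : ℕ} {z w : ℂ} (hzw : w ^ (γ + 1) = z * (z ^ 2 - 1) ^ γ)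
    (h1 : 1 - z ∈ slitPlane) (h2 : 1 + z ∈ slitPlane) :
    (w / middleRoot γ z) ^ (γ + 1) = z ∧
      middleMap γ (w / middleRoot γ z) = ((z : OnePoint ℂ), (w : OnePoint ℂ)) := by
  have h0 := middleRoot_ne_zero (γ := γ) (slitPlane_ne_zero h1) (slitPlane_ne_zero h2)
  have h3 : (w / middleRoot γ z) ^ (γ + 1) = z := by
    rw [div_pow, hzw, ← middleRoot_pow, mul_div_assoc, div_self (pow_ne_zero _ h0), mul_one]
  refine ⟨h3, ?_⟩
  rw [middleMap, h3, div_mul_cancel₀ _ h0]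

theorem dzDivW_mem_one : dzDivW 1 ∈ holomorphicForms 1 ∧
    ∀ q ∈ compactCurve 1, ∃ (C : LocalParam 1) (u : ℂ), u ∈ C.U ∧ dzDivW 1 C u ≠ 0 ∧
      ∀ (P : LocalParam 1), ∀ t ∈ P.U, P.φ t = q →
        ∃ k : ℂ → ℂ, AnalyticAt ℂ k t ∧ k t = u ∧ ∀ᶠ r in 𝓝 t, P.φ r = C.φ (k r) := by
  have key : ∀ q ∈ compactCurve 1, ∃ (C : LocalParam 1) (u : ℂ), u ∈ C.U ∧ IsGoodParam C ∧
      ∀ (P : LocalParam 1), ∀ t ∈ P.U, P.φ t = q →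
        ∃ k : ℂ → ℂ, AnalyticAt ℂ k t ∧ k t = u ∧ ∀ᶠ r in 𝓝 t, P.φ r = C.φ (k r) := by
    rintro q (⟨z, w, rfl, hzw⟩ | rfl)
    · by_cases hz : z = 0
      · subst hz
        have hmem : 1 - (0 : ℂ) ∈ slitPlane ∧ 1 + (0 : ℂ) ∈ slitPlane := by simp
        obtain ⟨h1, h2⟩ := exists_middle_coord hzw hmem.1 hmem.2
        have hu : w / middleRoot 1 0 ∈ (middleParam 1).U := by
          change 1 - _ ∈ slitPlane ∧ 1 + _ ∈ slitPlane
          rwa [h1]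
        refine ⟨middleParam 1, _, hu, isGoodParam_middle, fun P t ht hq => ?_⟩
        obtain ⟨k, hk, hkU, hkφ⟩ := P.exists_middle_factor ht hq hmem.1 hmem.2
        refine ⟨k, hk, (middleParam 1).injOn hkU hu ?_, hkφ⟩
        exact hkφ.self_of_nhds.symm.trans (hq.trans h2.symm)
      · obtain ⟨s, e, hse, hsz⟩ := exists_isSide (γ := 1) hz
        obtain ⟨h1, h2⟩ := exists_side_coord hse.sq hse.pow hzw hsz one_pos
        have hu : (s * z - 1) * sideRoot 1 (s * z) / (w / e) ∈
            (sideParam 1 s e hse.sq hse.pow).U := by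
          change 1 + _ ∈ slitPlane
          rwa [h1, add_sub_cancel]
        refine ⟨sideParam 1 s e hse.sq hse.pow, _, hu, isGoodParam_side _ _,
          fun P t ht hq => ?_⟩
        obtain ⟨k, hk, hkU, hkφ⟩ := P.exists_side_factor one_pos hse.sq hse.pow ht hq hsz
        refine ⟨k, hk, (sideParam 1 s e hse.sq hse.pow).injOn hkU hu ?_, hkφ⟩
        exact hkφ.self_of_nhds.symm.trans (hq.trans h2.symm)
    · exact ⟨inftyParam, 0, Metric.mem_ball_self one_pos, isGoodParam_infty,
        fun P t ht hq => P.exists_infty_factor ht hq⟩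
  refine ⟨dzDivW_mem fun P t ht => ?_, fun q hq => ?_⟩
  · obtain ⟨C, u, hu, hC, hk⟩ := key _ (P.mapsTo ht)
    obtain ⟨k, hkan, hkt, hkφ⟩ := hk P t ht rfl
    rw [← hkt] at hu
    obtain ⟨W, -, hW⟩ := hC.exists_form _ hu
    exact ⟨_, hW.comp ht hkan hkφ⟩
  · obtain ⟨C, u, hu, hC, hk⟩ := key q hq
    obtain ⟨W, hW0, hW⟩ := hC.exists_form u hu
    exact ⟨C, u, hu, (hW.eq hu).symm ▸ hW0, hk⟩

end genus

section genus

/-- The part of the half plane `0 ≤ re z` with `1 / 2 ≤ ‖z‖ ≤ 2`, in the parametrization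
`sideMap`. -/
def sideCompact : Set ℂ :=
  {u | 0 ≤ (1 + u ^ (1 + 1)).re ∧ 1 / 2 ≤ ‖1 + u ^ (1 + 1)‖ ∧ ‖1 + u ^ (1 + 1)‖ ≤ 2}

theorem mem_slitPlane_of_re_nonneg {x : ℂ} (h : 0 ≤ x.re) (h0 : x ≠ 0) : x ∈ slitPlane := by
  rw [mem_slitPlane_iff]
  by_contra hc
  rw [not_or, not_lt, not_not] at hc
  exact h0 (Complex.ext (hc.1.antisymm h) hc.2)

theorem isCompact_sideCompact : IsCompact sideCompact := by
  refine (isCompact_closedBall (0 : ℂ) 2).of_isClosed_subset ?_ ?_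
  · have hc : Continuous fun u : ℂ => 1 + u ^ (1 + 1) := by fun_prop
    exact (isClosed_le continuous_const (continuous_re.comp hc)).inter
      ((isClosed_le continuous_const hc.norm).inter (isClosed_le hc.norm continuous_const))
  · rintro u ⟨-, -, hu⟩
    rw [mem_closedBall_zero_iff]
    have h1 : ‖u ^ (1 + 1)‖ ≤ ‖1 + u ^ (1 + 1)‖ + ‖(1 : ℂ)‖ := by
      have := norm_sub_le (1 + u ^ (1 + 1)) 1
      rwa [add_sub_cancel_left] at this
    rw [norm_one, norm_pow] at h1
    have h2 : ‖u‖ ^ 2 ≤ 3 := h1.trans (by linarith)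
    nlinarith [norm_nonneg u]

theorem sideCompact_subset : sideCompact ⊆ sideDomain 1 := by
  rintro u ⟨h1, h2, -⟩
  refine mem_slitPlane_of_re_nonneg h1 fun h0 => ?_
  rw [h0, norm_zero] at h2
  norm_num at h2

/-- The part `‖z‖ ≤ 1 / 2` or `‖z‖ ≥ 2` of the curve in the parametrizations `middleMap`,
`inftyMap`. -/
def centralCompact : Set ℂ := {v | ‖v ^ (1 + 1)‖ ≤ 1 / 2}

theorem centralCompact_subset : centralCompact ⊆ Metric.ball (0 : ℂ) 1 := by
  intro v hv
  rw [mem_ball_zero_iff]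
  have hv : ‖v ^ (1 + 1)‖ ≤ 1 / 2 := hv
  rw [norm_pow] at hv
  nlinarith [norm_nonneg v]

theorem isCompact_centralCompact : IsCompact centralCompact :=
  (isCompact_closedBall (0 : ℂ) 1).of_isClosed_subset (isClosed_le (by fun_prop) (by fun_prop))
    (centralCompact_subset.trans Metric.ball_subset_closedBall)

theorem one_sub_and_one_add_mem_slitPlane {z : ℂ} (hz : ‖z‖ ≤ 1 / 2) :
    1 - z ∈ slitPlane ∧ 1 + z ∈ slitPlane := by
  refine ⟨one_sub_mem_slitPlane (by linarith), ?_⟩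
  rw [← sub_neg_eq_add]
  exact one_sub_mem_slitPlane (by rw [norm_neg]; linarith)

theorem centralCompact_subset_middleDomain : centralCompact ⊆ middleDomain 1 :=
  fun _ hv => one_sub_and_one_add_mem_slitPlane hv

/-- The pieces are the two halves of 1/2 ≤ |z| ≤ 2, the part |z| ≤ 1/2, and the part |z| ≥ 2 with
(∞, ∞). The parameter v = (1 − i)/2 has v⁻² = 2i; the corresponding point lies in all four charts,
which links them for the maximum principle. -/
theorem exists_compact_cover : ∃ (C : Fin 4 → LocalParam 1) (L : Fin 4 → Set ℂ),
    (∀ i, IsGoodParam (C i) ∧ L i ⊆ (C i).U ∧ IsCompact (L i) ∧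
      ∃ u ∈ (C i).U, (C i).φ u = inftyMap ((1 - I) / 2)) ∧
    ∀ q ∈ compactCurve 1, ∃ i, ∃ u ∈ L i, (C i).φ u = q := by
  have hv : (1 - I) / 2 ∈ Metric.ball (0 : ℂ) 1 := by
    refine centralCompact_subset ?_
    change ‖_‖ ≤ _
    rw [show ((1 - I) / 2) ^ (1 + 1) = -I / 2 by linear_combination (1 / 4 : ℂ) * I_sq]
    simp
  have hv0 : (1 - I) / 2 ≠ 0 := fun h => by simpa using congrArg re h
  have hv2 : (((1 - I) / 2) ^ 2)⁻¹ = 2 * I := by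
    rw [show ((1 - I) / 2) ^ 2 = -I / 2 by linear_combination (1 / 4 : ℂ) * I_sq]
    field_simp
    linear_combination -I_sq
  have hv1 := inftyMap_of_ne hv hv0
  rw [hv2] at hv1
  have hside : ∀ {s e : ℂ} (h : IsSide 1 s e),
      ∃ u ∈ (sideParam 1 s e h.sq h.pow).U,
        (sideParam 1 s e h.sq h.pow).φ u = inftyMap ((1 - I) / 2) := by
    intro s e h
    have hs : s * (2 * I) ∈ slitPlane := by
      rcases h with ⟨rfl, -⟩ | ⟨rfl, -⟩ <;> right <;> simp
    obtain ⟨k, -, hkU, hk⟩ := inftyParam.exists_side_factor one_pos h.sq h.pow hv hv1 hs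
    exact ⟨_, hkU, hk.self_of_nhds.symm⟩
  have hmid : ∃ u ∈ (middleParam 1).U, (middleParam 1).φ u = inftyMap ((1 - I) / 2) := by
    obtain ⟨k, -, hkU, hk⟩ := inftyParam.exists_middle_factor hv hv1
      (Or.inr (by simp)) (Or.inr (by simp))
    exact ⟨_, hkU, hk.self_of_nhds.symm⟩
  have h1 : IsSide 1 1 1 := Or.inl ⟨rfl, rfl⟩
  have h2 : IsSide 1 (-1) (eps 1) := Or.inr ⟨rfl, rfl⟩
  refine ⟨![sideParam 1 1 1 h1.sq h1.pow, sideParam 1 (-1) (eps 1) h2.sq h2.pow, middleParam 1,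
    inftyParam], ![sideCompact, sideCompact, centralCompact, centralCompact], fun i => ?_, ?_⟩
  · fin_cases i
    · exact ⟨isGoodParam_side h1.sq h1.pow, sideCompact_subset, isCompact_sideCompact, hside h1⟩
    · exact ⟨isGoodParam_side h2.sq h2.pow, sideCompact_subset, isCompact_sideCompact, hside h2⟩
    · exact ⟨isGoodParam_middle, centralCompact_subset_middleDomain, isCompact_centralCompact,
        hmid⟩
    · exact ⟨isGoodParam_infty, centralCompact_subset, isCompact_centralCompact, _, hv, rfl⟩
  · have hcov : ∀ {s e z w : ℂ}, IsSide 1 s e → w ^ (1 + 1) = z * (z ^ 2 - 1) ^ 1 →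
        0 ≤ (s * z).re → 1 / 2 ≤ ‖z‖ → ‖z‖ ≤ 2 →
        ∃ u ∈ sideCompact, sideMap 1 s e u = ((z : OnePoint ℂ), (w : OnePoint ℂ)) := by
      intro s e z w h hzw h0 h1 h2
      have hn : ‖s * z‖ = ‖z‖ := by
        rcases h with ⟨rfl, -⟩ | ⟨rfl, -⟩ <;> simp
      have hz : s * z ≠ 0 := fun h0 => by
        rw [h0, norm_zero] at hn
        rw [← hn] at h1
        norm_num at h1
      obtain ⟨h3, h4⟩ := exists_side_coord h.sq h.pow hzw (mem_slitPlane_of_re_nonneg h0 hz)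
        one_pos
      refine ⟨_, ?_, h4⟩
      rw [sideCompact, mem_ofPred_eq, h3, add_sub_cancel, hn]
      exact ⟨h0, h1, h2⟩
    rintro q (⟨z, w, rfl, hzw⟩ | rfl)
    · rcases le_total ‖z‖ (1 / 2) with hz | hz
      · obtain ⟨h3, h4⟩ := one_sub_and_one_add_mem_slitPlane hz
        obtain ⟨h5, h6⟩ := exists_middle_coord hzw h3 h4
        refine ⟨2, _, ?_, h6⟩
        change ‖_‖ ≤ _
        rwa [h5]
      · rcases le_total ‖z‖ 2 with hz2 | hz2
        · rcases le_total 0 z.re with hre | hre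
          · exact ⟨0, hcov h1 hzw (by simpa using hre) hz hz2⟩
          · exact ⟨1, hcov h2 hzw (by simpa using hre) hz hz2⟩
        · have hz0 : z ≠ 0 := by
            rintro rfl
            rw [norm_zero] at hz2
            linarith
          have hz1 : z ^ 2 - 1 ≠ 0 := by
            intro h0
            have : ‖z ^ 2‖ = 1 := by rw [sub_eq_zero.1 h0, norm_one]
            rw [norm_pow] at this
            nlinarith
          have hw0 : w ≠ 0 := by
            rintro rfl
            rw [zero_pow two_ne_zero, pow_one] at hzw
            exact mul_ne_zero hz0 hz1 hzw.symm
          have hne : 1 - z⁻¹ ^ 2 ≠ 0 := by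
            intro h0
            refine hz1 ?_
            field_simp at h0
            simpa using h0
          obtain ⟨h3, h4⟩ := inftyMap_div (x := z⁻¹) (y := w⁻¹) hne (by
            rw [inv_pow w]
            have : w ^ 2 = z * (z ^ 2 - 1) := by simpa using hzw
            rw [this]
            field_simp)
          refine ⟨3, _, ?_, h4.trans ?_⟩
          · change ‖_‖ ≤ _
            rw [one_add_one_eq_two, h3, norm_inv, one_div]
            exact inv_anti₀ two_pos hz2
          · rw [sphereInv, sphereInv, if_neg (inv_ne_zero hz0), if_neg (inv_ne_zero hw0), inv_inv,
              inv_inv]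
    · exact ⟨3, 0, by simp [centralCompact], inftyMap_zero⟩

/-- Every holomorphic form on the cubic curve is a multiple of `dz / w`. -/
theorem exists_smul_dzDivW {a : LocalParam 1 → ℂ → ℂ} (ha : a ∈ holomorphicForms 1) :
    ∃ r : ℂ, a = r • dzDivW 1 := by
  obtain ⟨hω, hcov⟩ := dzDivW_mem_one
  obtain ⟨R, hR⟩ := exists_quotient ha hω hcov
  obtain ⟨C, L, hC, hL⟩ := exists_compact_cover
  have hdiff : ∀ i, DifferentiableOn ℂ (fun u => R ((C i).φ u)) (C i).U := by
    intro i
    have hne : ∀ u ∈ (C i).U, dzDivW 1 (C i) u ≠ 0 := fun u hu => by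
      obtain ⟨W, hW0, hW⟩ := (hC i).1.exists_form u hu
      rwa [hW.eq hu]
    refine ((ha.1 (C i)).div (hω.1 (C i)) hne).congr fun u hu => ?_
    exact ((div_eq_iff (hne u hu)).2 (hR (C i) u hu)).symm
  -- The quotient R of the form by dz/w is holomorphic in each chart. Its modulus attains its
  -- maximum by compactness, R is then constant on the connected chart containing the maximum, and
  -- the common point over z = 2i carries the maximum to all the other charts.
  have hK : IsCompact (⋃ i, (fun u => ‖R ((C i).φ u)‖) '' L i) :=
    isCompact_iUnion fun i => (hC i).2.2.1.image_of_continuousOn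
      ((hdiff i).continuousOn.norm.mono (hC i).2.1)
  obtain ⟨m, hm, hmax⟩ := hK.exists_isGreatest (by
    obtain ⟨i, u, hu, -⟩ := hL (∞, ∞) (Or.inr rfl)
    exact ⟨_, mem_iUnion.2 ⟨i, u, hu, rfl⟩⟩)
  have hle : ∀ q ∈ compactCurve 1, ‖R q‖ ≤ m := by
    intro q hq
    obtain ⟨i, u, hu, rfl⟩ := hL q hq
    exact hmax (mem_iUnion.2 ⟨i, u, hu, rfl⟩)
  have hconst : ∀ i, ∀ u ∈ (C i).U, ‖R ((C i).φ u)‖ = m →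
      ∀ v ∈ (C i).U, R ((C i).φ v) = R ((C i).φ u) := by
    intro i u hu hum v hv
    refine Complex.eqOn_of_isPreconnected_of_isMaxOn_norm (hC i).1.isPreconnected (C i).isOpen
      (hdiff i) hu (fun x hx => ?_) hv
    change ‖_‖ ≤ ‖_‖
    rw [hum]
    exact hle _ ((C i).mapsTo hx)
  have hm1 : ‖R (inftyMap ((1 - I) / 2))‖ = m := by
    obtain ⟨i, u, hu, hum⟩ := mem_iUnion.1 hm
    obtain ⟨v, hv, hvq⟩ := (hC i).2.2.2
    rw [← hvq, hconst i u ((hC i).2.1 hu) hum v hv]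
    exact hum
  refine ⟨R (inftyMap ((1 - I) / 2)), funext fun P => funext fun t => ?_⟩
  by_cases ht : t ∈ P.U
  · obtain ⟨i, u, hu, huq⟩ := hL _ (P.mapsTo ht)
    obtain ⟨v, hv, hvq⟩ := (hC i).2.2.2
    have := hconst i v hv (by rwa [hvq]) u ((hC i).2.1 hu)
    rw [hR P t ht, ← huq, this, hvq]
    rfl
  · rw [ha.2.1 P t ht]
    simp [hω.2.1 P t ht]

theorem genus_one : genus 1 = 1 := by
  obtain ⟨hω, hcov⟩ := dzDivW_mem_one
  refine finrank_eq_one (⟨dzDivW 1, hω⟩ : holomorphicForms 1) (fun h0 => ?_) fun a => ?_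
  · obtain ⟨C, u, -, hne, -⟩ := hcov (∞, ∞) (Or.inr rfl)
    exact hne (congrFun (congrFun (congrArg Subtype.val h0) C) u)
  · obtain ⟨r, hr⟩ := exists_smul_dzDivW a.2
    exact ⟨r, Subtype.ext hr.symm⟩

end genus

/-! ### The degree of the Gauss map for γ = 1 -/

section degree

/-- The cubic `z ^ 3 - z - b` has three different roots unless its discriminant vanishes. -/
theorem encard_cubic {b : ℂ} (hb : 27 * b ^ 2 ≠ 4) : {z : ℂ | z ^ 3 - z = b}.encard = 3 := by
  obtain ⟨r, hr⟩ := IsAlgClosed.exists_root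
    (Polynomial.X ^ 3 - Polynomial.X - Polynomial.C b : Polynomial ℂ) (by
      rw [show (Polynomial.X ^ 3 - Polynomial.X - Polynomial.C b : Polynomial ℂ).degree = 3 by
        compute_degree!]
      norm_num)
  -- Splitting off the root r leaves z² + rz + r² − 1, with discriminant 4 − 3r² = d² and roots (−r
  -- ± d)/2. Any coincidence among the three roots gives 27b² = 4.
  obtain ⟨d, hd⟩ := IsAlgClosed.exists_pow_nat_eq (4 - 3 * r ^ 2) two_pos
  have hr : r ^ 3 - r = b := by
    simpa [Polynomial.IsRoot, sub_eq_zero] using hr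
  subst hr
  rw [encard_eq_three]
  refine ⟨r, (-r + d) / 2, (-r - d) / 2, fun h => hb ?_, fun h => hb ?_, fun h => hb ?_, ?_⟩
  · have h3 : d = 3 * r := by linear_combination -2 * h
    rw [h3] at hd
    linear_combination (9 / 4 * r ^ 4 - 15 / 4 * r ^ 2 + 1) * hd
  · have h3 : d = -3 * r := by linear_combination 2 * h
    rw [h3] at hd
    linear_combination (9 / 4 * r ^ 4 - 15 / 4 * r ^ 2 + 1) * hd
  · have h3 : d = 0 := by linear_combination h
    rw [h3] at hd
    linear_combination (9 * r ^ 4 - 6 * r ^ 2 + 1) * hd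
  · ext z
    have hfac : z ^ 3 - z - (r ^ 3 - r) =
        (z - r) * ((z - (-r + d) / 2) * (z - (-r - d) / 2)) := by
      linear_combination (z - r) / 4 * hd
    rw [mem_ofPred_eq, ← sub_eq_zero, hfac, mul_eq_zero, mul_eq_zero, sub_eq_zero, sub_eq_zero,
      sub_eq_zero]
    rfl

theorem hasDegree_gaussSphere {c : ℝ} (hc : c ≠ 0) : HasDegree 1 (gaussSphere c) 3 := by
  have hc' : (c : ℂ) ≠ 0 := ofReal_ne_zero.2 hc
  -- The exceptional values are ∞, taken only at (∞, ∞), and cw with 27w⁴ = 4, where the cubic z³ −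
  -- z = w² has a multiple root.
  refine ⟨insert ∞ ((fun w : ℂ => ((c * w : ℂ) : OnePoint ℂ)) '' {w | w ^ 4 = 4 / 27}), ?_,
    fun v hv => ?_⟩
  · refine (Finite.image _ ?_).insert _
    refine ((Polynomial.nthRoots 4 (4 / 27 : ℂ)).toFinset.finite_toSet).subset fun w hw => ?_
    simpa [Polynomial.mem_nthRoots] using hw
  · rw [mem_insert_iff, not_or] at hv
    obtain ⟨x, rfl⟩ := OnePoint.ne_infty_iff_exists.1 hv.1
    have hw : 27 * ((x / c) ^ 2) ^ 2 ≠ 4 := fun h => hv.2 ⟨x / c, by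
      rw [mem_ofPred_eq]
      linear_combination (1 / 27 : ℂ) * h, congrArg _ (mul_div_cancel₀ _ hc')⟩
    rw [show ((3 : ℕ) : ℕ∞) = 3 from rfl, ← encard_cubic hw]
    have hinj : Function.Injective
        fun z : ℂ => ((z : OnePoint ℂ), ((x / c : ℂ) : OnePoint ℂ)) := fun z z' h =>
      OnePoint.coe_injective (congrArg Prod.fst h)
    rw [← hinj.encard_image]
    congr 1
    ext q
    constructor
    · rintro ⟨⟨z, w, rfl, hzw⟩ | rfl, hq⟩
      · have h1 : (c : ℂ) * w = x := OnePoint.coe_injective hq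
        have h2 : w = x / c := by rw [← h1, mul_div_cancel_left₀ _ hc']
        refine ⟨z, ?_, by rw [h2]⟩
        rw [mem_ofPred_eq, ← h2]
        linear_combination -hzw
      · exact absurd hq.symm (OnePoint.coe_ne_infty x)
    · rintro ⟨z, hz, rfl⟩
      rw [mem_ofPred_eq] at hz
      refine ⟨mem_compactCurve_coe.2 ?_, ?_⟩
      · linear_combination -hz
      · change ((c * (x / c) : ℂ) : OnePoint ℂ) = _
        rw [mul_div_cancel₀ _ hc']

end degree

end TwoEnds

end

theorem mainTheorem2 (γ : ℕ) (hγ : 0 < γ) :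
    -- the two integrals converge and are positive
    IntervalIntegrable (TwoEnds.integrandA γ) MeasureTheory.volume 0 1 ∧
    IntervalIntegrable (TwoEnds.integrandB γ) MeasureTheory.volume 0 1 ∧
    0 < TwoEnds.constA γ ∧ 0 < TwoEnds.constB γ ∧
    -- there is a unique `c > 0` for which the period condition holds
    (∃! c : ℝ, 0 < c ∧ TwoEnds.PeriodCondition γ c) ∧
    -- there is a unique `c > 0` for which `f` is well defined, whatever the base point
    (∀ q₀ : TwoEnds.puncturedCurve γ, ∃! c : ℝ, 0 < c ∧ TwoEnds.WellDefined γ c q₀) ∧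
    -- this `c` is `√(A_γ / B_γ)` in both cases, and `f` is then a conformal minimal immersion
    TwoEnds.PeriodCondition γ √(TwoEnds.constA γ / TwoEnds.constB γ) ∧
    (∀ q₀ : TwoEnds.puncturedCurve γ,
      TwoEnds.WellDefined γ √(TwoEnds.constA γ / TwoEnds.constB γ) q₀ ∧
      ∃ f : TwoEnds.puncturedCurve γ → EuclideanSpace ℝ (Fin 3),
        TwoEnds.IsWeierstrassMap γ √(TwoEnds.constA γ / TwoEnds.constB γ) q₀ f ∧
        TwoEnds.IsConformalMinimalImmersion γ f) ∧
    -- for `γ = 1` the surface has genus one and its Gauss map has degree `γ + 2`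
    (γ = 1 → TwoEnds.genus γ = 1 ∧
      TwoEnds.HasDegree γ
        (TwoEnds.gaussSphere √(TwoEnds.constA γ / TwoEnds.constB γ)) (γ + 2)) := by
  have hA := TwoEnds.constA_pos hγ
  have hB := TwoEnds.constB_pos hγ
  have hpos : 0 < √(TwoEnds.constA γ / TwoEnds.constB γ) := Real.sqrt_pos.2 (div_pos hA hB)
  have hsq : √(TwoEnds.constA γ / TwoEnds.constB γ) ^ 2 * TwoEnds.constB γ = TwoEnds.constA γ := by
    rw [Real.sq_sqrt (div_pos hA hB).le, div_mul_cancel₀ _ hB.ne']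
  have hper := TwoEnds.periodCondition_of_sq hγ hsq
  have hwell := fun q₀ => TwoEnds.wellDefined_of_sq hγ hsq q₀
  refine ⟨TwoEnds.intervalIntegrable_integrandA hγ,
    TwoEnds.intervalIntegrable_integrandB hγ, hA, hB,
    ⟨_, ⟨hpos, hper⟩, fun c hc => TwoEnds.periodCondition_unique hγ hc.1 hpos hc.2 hper⟩,
    fun q₀ => ⟨_, ⟨hpos, hwell q₀⟩, fun c hc =>
      TwoEnds.wellDefined_unique hγ hc.1 hpos hc.2 (hwell q₀)⟩, hper,
    fun q₀ => ⟨hwell q₀, TwoEnds.weierstrassMap γ _ q₀,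
      TwoEnds.isWeierstrassMap_weierstrassMap hγ hsq q₀,
      TwoEnds.isConformalMinimalImmersion hγ hsq q₀⟩, ?_⟩
  rintro rfl
  exact ⟨TwoEnds.genus_one, TwoEnds.hasDegree_gaussSphere hpos.ne'⟩
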